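/- Let $I\in\{(0,\infty),\mathbb R\}$, let $\bar I$ denote the closure of $I$ in $\mathbb R$, and let $(X_0,X_1)$ be an interpolation couple of complex Banach spaces, i.e. $X_0$ and $X_1$ are continuously and injectively embedded in a Hausdorff topological vector space. Write $w_\gamma(t)=|t|^\gamma$. Let $s_0\in(0,1)$, $p_0,p_1\in(1,\infty)$, $\gamma_0\in(-1,p_0-1)$ and $\gamma_1\in(-1,p_1-1)$, and set $$\delta_0=s_0-\frac{1+\gamma_0}{p_0},\qquad \delta_1=-\frac{1+\gamma_1}{p_1},\qquad \theta=\frac{\delta_0}{\delta_0-\delta_1},\qquad \frac1p=\frac{1-\theta}{p_0}+\frac{\theta}{p_1}.$$ Assume that $\delta_0>0$. Let $F^{s_0}_{p_0,p_0}(\mathbb R,w_{\gamma_0};X_0)$ be the weighted Triebel--Lizorkin space of all $X_0$-valued tempered distributions $g$ for which $$\|g\|_{F^{s_0}_{p_0,p_0}(\mathbb R,w_{\gamma_0};X_0)}=\big\|\big(2^{s_0k}\varphi_k*g\big)_{k\ge0}\big\|_{L^{p_0}(\mathbb R,w_{\gamma_0};\ell^{p_0}(X_0))}<\infty ,$$ where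 $(\varphi_k)_{k\ge0}$ is an inhomogeneous Littlewood--Paley sequence of Schwartz functions: $0\le\widehat\varphi_0\le1$, $\widehat\varphi_0(\xi)=1$ for $|\xi|\le1$, $\widehat\varphi_0(\xi)=0$ for $|\xi|\ge\frac32$, $\widehat\varphi_1(\xi)=\widehat\varphi_0(\xi/2)-\widehat\varphi_0(\xi)$, and $\widehat\varphi_k(\xi)=\widehat\varphi_1(2^{-k+1}\xi)$ for $k\ge2$. Let $F^{s_0}_{p_0,p_0}(I,w_{\gamma_0};X_0)$ be the space of restrictions to $I$ of such $g$, with the quotient norm. Let $\mathrm{Tr}_0$ denote the unique extension of $v\mapsto v(0)$, $v\in F^{s_0}_{p_0,p_0}(I,w_{\gamma_0};X_0)\cap C(\bar I;X_0)$, to a bounded linear operator $F^{s_0}_{p_0,p_0}(I,w_{\gamma_0};X_0)\to X_0$; that is, $\mathrm{Tr}_0u=\lim_n v_n(0)$ whenever $v_n\in F^{s_0}_{p_0,p_0}(I,w_{\gamma_0};X_0)\cap C(\bar I;X_0)$ converge to $u$ in $F^{s_0}_{p_0,p_0}(I,w_{\gamma_0};X_0)$. Then there is a constant $C$, depending only on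 $s_0,p_0,p_1,\gamma_0,\gamma_1$, such that for all $u\in F^{s_0}_{p_0,p_0}(I,w_{\gamma_0};X_0)\cap L^{p_1}(I,w_{\gamma_1};X_1)$ the trace $\mathrm{Tr}_0u\in X_0$ is well defined, belongs to the real interpolation space $(X_0,X_1)_{\theta,p}$, normed by the $K$-method, and $$\|\mathrm{Tr}_0u\|_{(X_0,X_1)_{\theta,p}}\le C\,\Big([u]^{(1)}_{F^{s_0}_{p_0,p_0}(I,w_{\gamma_0};X_0)}\Big)^{1-\theta}\Big(\|u\|_{L^{p_1}(I,w_{\gamma_1};X_1)}\Big)^{\theta},$$ where $$[u]^{(1)}_{F^{s_0}_{p_0,p_0}(I,w_{\gamma_0};X_0)}=\Big(\int_I\int_0^\infty\Big(t^{-s_0}\,\frac1t\int_{\{|h|<t,\;x+h\in I\}}\|u(x+h)-u(x)\|_{X_0}\,dh\Big)^{p_0}\frac{dt}{t}\,|x|^{\gamma_0}\,dx\Big)^{1/p_0}.$$ -/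

import Mathlib

open MeasureTheory Filter Topology Set
open scoped ENNReal NNReal SchwartzMap FourierTransform

noncomputable section

namespace WeightedTrace

/-! ### Real interpolation (the `K`-method) for a couple of spaces embedded in `V` -/

section Interpolation

variable {X₀ X₁ V : Type*} [NormedAddCommGroup X₀] [NormedSpace ℂ X₀]
  [NormedAddCommGroup X₁] [NormedSpace ℂ X₁]
  [AddCommGroup V] [Module ℂ V] [TopologicalSpace V]

/-- Peetre's `K`-functional `K(t, v) = inf {‖x₀‖ + t ‖x₁‖ : v = x₀ + x₁}`; it is `∞` when
`v` does not belong to `X₀ + X₁`. -/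
def kFunctional (ι₀ : X₀ →L[ℂ] V) (ι₁ : X₁ →L[ℂ] V) (t : ℝ) (v : V) : ℝ≥0∞ :=
  ⨅ (x₀ : X₀) (x₁ : X₁) (_ : ι₀ x₀ + ι₁ x₁ = v), (‖x₀‖ₑ + ENNReal.ofReal t * ‖x₁‖ₑ)

/-- The norm of the real interpolation space `(X₀, X₁)_{θ,p}` for finite `p`, as an extended
norm on `V`: `‖t ↦ t^{-θ} K(t, v)‖_{L^p(ℝ₊, dt/t)}`. The space `(X₀, X₁)_{θ,p}` is the set of
all `v` for which it is finite. -/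
def interpNorm (ι₀ : X₀ →L[ℂ] V) (ι₁ : X₁ →L[ℂ] V) (θ p : ℝ) (v : V) : ℝ≥0∞ :=
  (∫⁻ t in Ioi (0 : ℝ),
    (ENNReal.ofReal (t ^ (-θ)) * kFunctional ι₀ ι₁ t v) ^ p * ENNReal.ofReal t⁻¹) ^ (1 / p)

end Interpolation

/-! ### Function spaces on `ℝ` and on `I ⊆ ℝ` with the weight `|t|^γ` -/

section Spaces

variable {X : Type*} [NormedAddCommGroup X]

/-- The weighted norm of `L^p(I, |t|^γ; X)`. -/
def weightedLpNorm (I : Set ℝ) (p γ : ℝ) (f : ℝ → X) : ℝ≥0∞ :=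
  (∫⁻ x in I, ‖f x‖ₑ ^ p * ENNReal.ofReal (|x| ^ γ)) ^ (1 / p)

/-- Membership in `L^p(I, |t|^γ; X)`. -/
def MemWeightedLp (I : Set ℝ) (p γ : ℝ) (f : ℝ → X) : Prop :=
  AEStronglyMeasurable f (volume.restrict I) ∧ weightedLpNorm I p γ f < ∞

variable [NormedSpace ℂ X]

/-- The class `Φ(ℝ)` of inhomogeneous Littlewood-Paley sequences. -/
structure IsLittlewoodPaley (φ : ℕ → 𝓢(ℝ, ℂ)) : Prop where
  range : ∀ ξ : ℝ, ∃ r ∈ Icc (0 : ℝ) 1, 𝓕 (φ 0) ξ = (r : ℂ)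
  eq_one : ∀ ξ : ℝ, |ξ| ≤ 1 → 𝓕 (φ 0) ξ = 1
  eq_zero : ∀ ξ : ℝ, 3 / 2 ≤ |ξ| → 𝓕 (φ 0) ξ = 0
  one : ∀ ξ : ℝ, 𝓕 (φ 1) ξ = 𝓕 (φ 0) (ξ / 2) - 𝓕 (φ 0) ξ
  step : ∀ k : ℕ, 2 ≤ k → ∀ ξ : ℝ, 𝓕 (φ k) ξ = 𝓕 (φ 1) (ξ / 2 ^ (k - 1))

/-- The Schwartz function `y ↦ φ (x - y)`. -/
def reflectTranslate (φ : 𝓢(ℝ, ℂ)) (x : ℝ) : 𝓢(ℝ, ℂ) :=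
  SchwartzMap.compSubConstCLM ℂ x
    (SchwartzMap.compCLMOfContinuousLinearEquiv ℂ (ContinuousLinearEquiv.neg ℝ) φ)

theorem reflectTranslate_apply (φ : 𝓢(ℝ, ℂ)) (x y : ℝ) :
    reflectTranslate φ x y = φ (x - y) := by
  simp [reflectTranslate]

/-- The convolution `φ * g` of a Schwartz function with an `X`-valued tempered distribution,
a smooth function. -/
def conv (φ : 𝓢(ℝ, ℂ)) (g : 𝓢'(ℝ, X)) (x : ℝ) : X :=
  g (reflectTranslate φ x)

/-- The extended norm of `F^s_{p,q}(ℝ, |t|^γ; X)` for finite `q`: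
`‖(2^{sk} φ_k * g)_k‖_{L^p(ℝ, |t|^γ; ℓ^q(X))}`. -/
def normF (φ : ℕ → 𝓢(ℝ, ℂ)) (s p q γ : ℝ) (g : 𝓢'(ℝ, X)) : ℝ≥0∞ :=
  (∫⁻ x : ℝ, (∑' k : ℕ, (ENNReal.ofReal ((2 : ℝ) ^ (s * k)) * ‖conv (φ k) g x‖ₑ) ^ q) ^ (p / q)
    * ENNReal.ofReal (|x| ^ γ)) ^ (1 / p)

/-- The restriction of the tempered distribution `g` to `I` is the regular distribution given
by the function `u`. -/
def RestrictsTo (I : Set ℝ) (g : 𝓢'(ℝ, X)) (u : ℝ → X) : Prop :=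
  ∀ ψ : 𝓢(ℝ, ℂ), HasCompactSupport ψ → tsupport ψ ⊆ I → g ψ = ∫ x in I, ψ x • u x

/-- The quotient norm of `F^s_{p,q}(I, |t|^γ; X)` (for regular distributions `u`). -/
def normFOn (φ : ℕ → 𝓢(ℝ, ℂ)) (I : Set ℝ) (s p q γ : ℝ) (u : ℝ → X) : ℝ≥0∞ :=
  ⨅ (g : 𝓢'(ℝ, X)) (_ : RestrictsTo I g u), normF φ s p q γ g

/-- The regular distribution `u` belongs to `F^s_{p,q}(I, |t|^γ; X)`. -/
def MemF (φ : ℕ → 𝓢(ℝ, ℂ)) (I : Set ℝ) (s p q γ : ℝ) (u : ℝ → X) : Prop :=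
  LocallyIntegrableOn u I ∧ normFOn φ I s p q γ u < ∞

/-- `x = Tr₀ u`, where `Tr₀` is the continuous extension of `v ↦ v(0)` from
`F^s_{p,q}(I, |t|^γ; X) ∩ C(Ī; X)` to `F^s_{p,q}(I, |t|^γ; X)`: there are continuous `v n` with
`v n → u` in `F^s_{p,q}(I, |t|^γ; X)` and `v n 0 → x`. -/
def IsTraceZero (φ : ℕ → 𝓢(ℝ, ℂ)) (I : Set ℝ) (s p q γ : ℝ) (u : ℝ → X) (x : X) : Prop :=
  ∃ v : ℕ → ℝ → X,
    (∀ n, MemF φ I s p q γ (v n) ∧ ContinuousOn (v n) (closure I)) ∧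
    Tendsto (fun n => normFOn φ I s p q γ (u - v n)) atTop (𝓝 0) ∧
    Tendsto (fun n => v n 0) atTop (𝓝 x)

end Spaces

/-! ### Difference seminorms -/

section Differences

variable {X : Type*} [NormedAddCommGroup X]

/-- The `m`-th order difference `Δ_h^m f (x) = ∑_j (m choose j) (-1)^j f(x + (m - j) h)`. -/
def nthDifference (m : ℕ) (h : ℝ) (f : ℝ → X) (x : ℝ) : X :=
  ∑ j ∈ Finset.range (m + 1),
    ((-1 : ℤ) ^ j * (m.choose j : ℤ)) • f (x + ((m : ℝ) - (j : ℝ)) * h)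

/-- The means `d_t^m f (x) = t⁻¹ ∫_{|h| < t, x + m h ∈ I} ‖Δ_h^m f (x)‖ dh`. -/
def diffMean (I : Set ℝ) (m : ℕ) (t : ℝ) (f : ℝ → X) (x : ℝ) : ℝ≥0∞ :=
  ENNReal.ofReal t⁻¹ * ∫⁻ h in {h : ℝ | |h| < t ∧ x + (m : ℝ) * h ∈ I}, ‖nthDifference m h f x‖ₑ

/-- The difference seminorm `[f]^{(m)}` of `F^s_{p,q}(I, |t|^γ; X)` for finite `q`:
`‖(∫_0^∞ (t^{-s} d_t^m f)^q dt/t)^{1/q}‖_{L^p(I, |t|^γ)}`. -/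
def diffSeminorm (I : Set ℝ) (m : ℕ) (s p q γ : ℝ) (f : ℝ → X) : ℝ≥0∞ :=
  (∫⁻ x in I,
    ((∫⁻ t in Ioi (0 : ℝ), (ENNReal.ofReal (t ^ (-s)) * diffMean I m t f x) ^ q
        * ENNReal.ofReal t⁻¹) ^ (1 / q)) ^ p
      * ENNReal.ofReal (|x| ^ γ)) ^ (1 / p)

end Differences

end WeightedTrace

end

open WeightedTrace

/-! # The trace at zero and real interpolation

Fix a smooth bump with integral `1` supported in `(1/2, 1]`, and let `A_j u` be the average of `u`
against its dilation `bumpAt j` to the scale `2ʲ`, `j ∈ ℤ`. Since `u` takes values in both spaces,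
`A_j u` lies in `X₀ ∩ X₁`, so that the trace `x` satisfies
`K(t, x) ≤ ‖x - A_j u‖_{X₀} + t ‖A_j u‖_{X₁}` for every `j`.

*Size of the two parts.* Hölder's inequality on `(2ʲ⁻¹, 2ʲ]` bounds the `ℓ^{p₁}` norm of
`2^{-jδ₁} ‖A_j u‖` by the norm of `u` in `L^{p₁}(|t|^{γ₁}; X₁)`
(`exists_tsum_rpow_dyadicAverage_le`). The increments `A_j u - A_{j-1} u` are averages of first
differences of `u` over steps smaller than `2ʲ`, so the `ℓ^{p₀}` norm of
`2^{-jδ₀} ‖A_j u - A_{j-1} u‖` is bounded by the difference seminorm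
(`exists_tsum_rpow_dyadicAverage_sub_le`), and as `A_j u → x` for `j → -∞`, a discrete Hardy
inequality (`exists_tsum_rpow_enorm_sub_le`) passes from the increments to `x - A_j u`.

*Interpolation.* From such a discrete decomposition the norm in `(X₀, X₁)_{θ,p}` is estimated as in
the espaces de moyennes of Lions and Peetre (`exists_rpow_lintegral_le`). The exponents `p₀` and `p₁`
differ, so `j` cannot simply be matched with `log t`; the `t`-axis is cut at nodes where both parts
are of the same size, which become a geometrically bounded sequence once the data are replaced by an
increasing, slowly growing majorant (`exists_majorant`).

*The trace.* For an extension `g ∈ F^s_{p,p}(ℝ, |t|^γ; X)` of `u`, with `0 < s - (1 + γ)/p`, the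
trace is the absolutely convergent sum of the values at `0` of the Littlewood-Paley blocks of `g`.
Everything rests on reproducing kernels: since `φ_k * g` reproduces itself under a Schwartz kernel of
scale `2⁻ᵏ`, which is dominated by the Cauchy kernel `a / (a² + x²)` with `a = 2⁻ᵏ`, weighted `L^p`
norms of blocks control their values at `0` and their averages. This gives convergence of `A_j u` to
the sum (`tsum_rpow_apply_bumpAt_sub_lt_top`), in particular finiteness of all sequence norms above.
The low-frequency truncations of `g` are continuous and converge to `g` in the norm, while the
averages show that evaluation at `0` of continuous functions is bounded by the norm of `F^s_{p,p}`;
hence the trace exists and is unique (`isTraceZero_iff`). That distributions may be moved under the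
convolution integral (`apply_schwartzConv`) needs an argument, the Schwartz space not being normable.
-/

noncomputable section

namespace WeightedTrace

/-! ### Jensen's inequality and Schur's test -/

/-- Jensen's inequality for `x ↦ x ^ p` and the measure with density `κ`, which need not be
normalised. -/
theorem rpow_lintegral_mul_le {α : Type*} [MeasurableSpace α] (μ : Measure α) {p : ℝ} (hp : 1 < p)
    {κ f : α → ℝ≥0∞} (hκ : AEMeasurable κ μ) (hf : AEMeasurable f μ) :
    (∫⁻ x, κ x * f x ∂μ) ^ p ≤ (∫⁻ x, κ x ∂μ) ^ (p - 1) * ∫⁻ x, κ x * f x ^ p ∂μ := by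
  have hp0 : 0 < p := by linarith
  have hpq := Real.HolderConjugate.conjExponent hp
  set q := p.conjExponent
  have hq0 : 0 < q := hpq.symm.pos
  have key := ENNReal.lintegral_mul_le_Lp_mul_Lq μ hpq.symm (hκ.pow_const (1 / q))
    ((hκ.pow_const (1 / p)).mul hf)
  have e1 : ∀ x, ((fun x => κ x ^ (1 / q)) * ((fun x => κ x ^ (1 / p)) * f)) x = κ x * f x := by
    intro x
    simp only [Pi.mul_apply]
    rw [← mul_assoc, ← ENNReal.rpow_add_of_nonneg _ _ (by positivity) (by positivity)]
    have : 1 / q + 1 / p = 1 := by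
      simpa [one_div] using hpq.symm.inv_add_inv_eq_one
    rw [this, ENNReal.rpow_one]
  have e2 : ∀ x, (κ x ^ (1 / q)) ^ q = κ x := by
    intro x; rw [← ENNReal.rpow_mul, one_div, inv_mul_cancel₀ hq0.ne', ENNReal.rpow_one]
  have e3 : ∀ x, (((fun x => κ x ^ (1 / p)) * f) x) ^ p = κ x * f x ^ p := by
    intro x
    simp only [Pi.mul_apply]
    rw [ENNReal.mul_rpow_of_nonneg _ _ hp0.le, ← ENNReal.rpow_mul, one_div,
      inv_mul_cancel₀ hp0.ne', ENNReal.rpow_one]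
  simp only [e1, e2, e3] at key
  calc (∫⁻ x, κ x * f x ∂μ) ^ p
      ≤ ((∫⁻ x, κ x ∂μ) ^ (1 / q) * (∫⁻ x, κ x * f x ^ p ∂μ) ^ (1 / p)) ^ p := by gcongr
    _ = _ := by
      rw [ENNReal.mul_rpow_of_nonneg _ _ hp0.le, ← ENNReal.rpow_mul, ← ENNReal.rpow_mul]
      have h1 : 1 / q * p = p - 1 := by
        have := hpq.symm.inv_add_inv_eq_one
        field_simp at this ⊢
        linarith
      rw [h1, one_div, inv_mul_cancel₀ hp0.ne', ENNReal.rpow_one]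

/-- Schur's test with a weight `b` on the source and power weights on both sides: integrate the
kernel against `b` in one variable and against `A ^ (p - 1)` in the other. -/
theorem lintegral_rpow_le_of_schur {α β : Type*} [MeasurableSpace α] [MeasurableSpace β]
    (μ : Measure α) (ν : Measure β) [SFinite μ] [SFinite ν] {p : ℝ} (hp : 1 < p)
    {K : α → β → ℝ≥0∞} (hK : Measurable (Function.uncurry K)) {f b w' : β → ℝ≥0∞}
    (hf : Measurable f) (hb : Measurable b) (hw' : Measurable w') (hb0 : ∀ᵐ y ∂ν, b y ≠ 0 ∧ b y ≠ ∞)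
    {A w : α → ℝ≥0∞} (hA : Measurable A) (hw : Measurable w)
    (h1 : ∀ᵐ x ∂μ, ∫⁻ y, K x y * b y ∂ν ≤ A x) {B : ℝ≥0∞}
    (h2 : ∀ᵐ y ∂ν, ∫⁻ x, K x y * (A x ^ (p - 1) * w x) ∂μ ≤ B * (b y ^ (p - 1) * w' y)) :
    ∫⁻ x, (∫⁻ y, K x y * f y ∂ν) ^ p * w x ∂μ ≤ B * ∫⁻ y, f y ^ p * w' y ∂ν := by
  have hp0 : 0 < p := by linarith
  have hKx : ∀ x, Measurable (K x) := fun x => hK.comp measurable_prodMk_left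
  have hKy : ∀ y, Measurable fun x => K x y := fun y => hK.comp measurable_prodMk_right
  have s1 : ∀ᵐ x ∂μ, (∫⁻ y, K x y * f y ∂ν) ^ p * w x ≤
      ∫⁻ y, K x y * b y * (f y / b y) ^ p * (A x ^ (p - 1) * w x) ∂ν := by
    filter_upwards [h1] with x hx
    have e : ∫⁻ y, K x y * f y ∂ν = ∫⁻ y, K x y * b y * (f y / b y) ∂ν := by
      refine lintegral_congr_ae ?_
      filter_upwards [hb0] with y hy
      rw [mul_assoc, ENNReal.mul_div_cancel hy.1 hy.2]
    rw [e, lintegral_mul_const _ (by fun_prop)]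
    calc _ ≤ ((∫⁻ y, K x y * b y ∂ν) ^ (p - 1) * ∫⁻ y, K x y * b y * (f y / b y) ^ p ∂ν) * w x := by
          gcongr
          exact rpow_lintegral_mul_le ν hp (by fun_prop) (by fun_prop)
      _ ≤ (A x ^ (p - 1) * ∫⁻ y, K x y * b y * (f y / b y) ^ p ∂ν) * w x := by
          have : 0 ≤ p - 1 := by linarith
          gcongr
      _ = _ := by ring
  calc _ ≤ ∫⁻ x, ∫⁻ y, K x y * b y * (f y / b y) ^ p * (A x ^ (p - 1) * w x) ∂ν ∂μ :=
        lintegral_mono_ae s1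
    _ = ∫⁻ y, ∫⁻ x, K x y * b y * (f y / b y) ^ p * (A x ^ (p - 1) * w x) ∂μ ∂ν := by
        refine lintegral_lintegral_swap (Measurable.aemeasurable ?_)
        have : Measurable fun z : α × β => K z.1 z.2 := hK
        simp only [Function.uncurry_def]
        fun_prop
    _ = ∫⁻ y, b y * (f y / b y) ^ p * ∫⁻ x, K x y * (A x ^ (p - 1) * w x) ∂μ ∂ν := by
        refine lintegral_congr fun y => ?_
        rw [← lintegral_const_mul _ (by fun_prop)]
        refine lintegral_congr fun x => ?_
        ring
    _ ≤ ∫⁻ y, B * (f y ^ p * w' y) ∂ν := by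
        refine lintegral_mono_ae ?_
        filter_upwards [h2, hb0] with y hy hby
        calc _ ≤ b y * (f y / b y) ^ p * (B * (b y ^ (p - 1) * w' y)) := by gcongr
          _ = (b y ^ (1 : ℝ) * b y ^ (p - 1)) * (f y / b y) ^ p * (B * w' y) := by
            rw [ENNReal.rpow_one]; ring
          _ = (b y * (f y / b y)) ^ p * (B * w' y) := by
            rw [← ENNReal.rpow_add _ _ hby.1 hby.2, ENNReal.mul_rpow_of_nonneg _ _ hp0.le]
            congr 3; ring
          _ = _ := by rw [ENNReal.mul_div_cancel hby.1 hby.2]; ring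
    _ = _ := by rw [lintegral_const_mul _ (by fun_prop)]

/-- Schur's test for sums over two countable sets, without weights. -/
theorem tsum_rpow_le_of_schur {α β : Type*} [Countable α] [Countable β] {p : ℝ} (hp : 1 < p)
    (K : α → β → ℝ≥0∞) (f : β → ℝ≥0∞) {A B : ℝ≥0∞}
    (h1 : ∀ x, ∑' y, K x y ≤ A) (h2 : ∀ y, ∑' x, K x y ≤ B) :
    ∑' x, (∑' y, K x y * f y) ^ p ≤ A ^ (p - 1) * B * ∑' y, f y ^ p := by
  let _ : MeasurableSpace α := ⊤
  let _ : MeasurableSpace β := ⊤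
  have := lintegral_rpow_le_of_schur (α := α) (β := β) Measure.count Measure.count hp
    (K := K) (measurable_of_countable _) (f := f) (b := fun _ => 1) (w' := fun _ => 1)
    (measurable_of_countable _) measurable_const measurable_const (by simp) (A := fun _ => A)
    (w := fun _ => 1) measurable_const measurable_const (B := A ^ (p - 1) * B)
    (by simpa [lintegral_count] using h1)
    (by
      refine Eventually.of_forall fun y => ?_
      simp only [lintegral_count, mul_one, ENNReal.one_rpow, ENNReal.tsum_mul_right]
      rw [mul_comm]
      gcongr
      exact h2 y)
  simpa [lintegral_count] using this

/-! ### The kernel `a / (a² + x²)` -/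

/-- The Cauchy kernel at scale `a`, up to a factor `π`. It dominates every `L¹`-normalised
dilation of a Schwartz function to scale `a`. -/
def cauchyKernel (a x : ℝ) : ℝ := a / (a ^ 2 + x ^ 2)

theorem cauchyKernel_nonneg {a : ℝ} (ha : 0 < a) (x : ℝ) : 0 ≤ cauchyKernel a x := by
  unfold cauchyKernel; positivity

@[fun_prop]
theorem measurable_cauchyKernel (a : ℝ) : Measurable (cauchyKernel a) := by
  unfold cauchyKernel; fun_prop

theorem cauchyKernel_neg (a x : ℝ) : cauchyKernel a (-x) = cauchyKernel a x := by
  simp [cauchyKernel]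

theorem cauchyKernel_eq {a : ℝ} (ha : 0 < a) (x : ℝ) :
    cauchyKernel a x = a⁻¹ * cauchyKernel 1 (a⁻¹ * x) := by
  unfold cauchyKernel; field_simp

theorem lintegral_comp_const_mul {c : ℝ} (hc : 0 < c) {f : ℝ → ℝ≥0∞} (hf : Measurable f) :
    ∫⁻ x, f (c * x) = ENNReal.ofReal c⁻¹ * ∫⁻ x, f x := by
  conv_rhs => rw [← Real.smul_map_volume_mul_left hc.ne', lintegral_smul_measure,
    lintegral_map hf (by fun_prop)]
  rw [smul_eq_mul, ← mul_assoc, ← ENNReal.ofReal_mul (by positivity), abs_of_pos hc,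
    inv_mul_cancel₀ hc.ne', ENNReal.ofReal_one, one_mul]

theorem lintegral_cauchyKernel {a : ℝ} (ha : 0 < a) :
    ∫⁻ x, ENNReal.ofReal (cauchyKernel a x) = ENNReal.ofReal Real.pi := by
  have h1 : ∫⁻ x, ENNReal.ofReal (cauchyKernel 1 x) = ENNReal.ofReal Real.pi := by
    rw [← ofReal_integral_eq_lintegral_ofReal]
    · rw [← integral_univ_inv_one_add_sq]; simp [cauchyKernel, one_div]
    · convert integrable_inv_one_add_sq using 2 with x
      simp [cauchyKernel]
    · exact Eventually.of_forall (cauchyKernel_nonneg one_pos)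
  simp_rw [cauchyKernel_eq ha, ENNReal.ofReal_mul (inv_nonneg.2 ha.le)]
  have hm := (measurable_cauchyKernel 1).ennreal_ofReal
  rw [lintegral_const_mul _ (by fun_prop),
    lintegral_comp_const_mul (f := fun x => ENNReal.ofReal (cauchyKernel 1 x))
      (inv_pos.2 ha) hm, h1, ← mul_assoc, ← ENNReal.ofReal_mul (by positivity), inv_inv,
    inv_mul_cancel₀ ha.ne', ENNReal.ofReal_one, one_mul]

theorem lintegral_comp_abs {f : ℝ → ℝ≥0∞} :
    ∫⁻ x, f |x| = 2 * ∫⁻ x in Ioi 0, f x := by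
  have h1 : ∫⁻ x in Ioi 0, f |x| = ∫⁻ x in Ioi 0, f x :=
    setLIntegral_congr_fun measurableSet_Ioi fun x hx => by rw [abs_of_pos hx]
  have h2 : ∫⁻ x in Iio 0, f |x| = ∫⁻ x in Ioi 0, f |x| := by
    have := (Measure.measurePreserving_neg (volume : Measure ℝ)).setLIntegral_comp_preimage_emb
      (MeasurableEquiv.neg ℝ).measurableEmbedding (fun x => f |x|) (Ioi 0)
    simpa using this
  rw [← lintegral_add_compl _ (measurableSet_Ioi (a := (0 : ℝ))), compl_Ioi,
    ← setLIntegral_congr (Iio_ae_eq_Iic (a := (0 : ℝ))), h2, h1, two_mul]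

theorem lintegral_Ioc_rpow {b R : ℝ} (hb : -1 < b) (hR : 0 ≤ R) :
    ∫⁻ x in Ioc 0 R, ENNReal.ofReal (x ^ b) = ENNReal.ofReal (R ^ (b + 1) / (b + 1)) := by
  rw [← ofReal_integral_eq_lintegral_ofReal]
  · rw [← intervalIntegral.integral_of_le hR, integral_rpow (Or.inl hb),
      Real.zero_rpow (by linarith), sub_zero]
  · exact (intervalIntegrable_iff_integrableOn_Ioc_of_le hR).1
      (intervalIntegral.intervalIntegrable_rpow' hb)
  · filter_upwards [ae_restrict_mem measurableSet_Ioc] with x hx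
    exact Real.rpow_nonneg hx.1.le _

theorem setLIntegral_abs_rpow {b R : ℝ} (hb : -1 < b) (hR : 0 ≤ R) :
    ∫⁻ x in {x : ℝ | |x| ≤ R}, ENNReal.ofReal (|x| ^ b) =
      2 * ENNReal.ofReal (R ^ (b + 1) / (b + 1)) := by
  have : ∀ x : ℝ, ({x : ℝ | |x| ≤ R}).indicator (fun x => ENNReal.ofReal (|x| ^ b)) x
      = (fun y => (Iic R).indicator (fun y => ENNReal.ofReal (y ^ b)) y) |x| := by
    intro x; simp [indicator]
  rw [← lintegral_indicator (measurableSet_le (by fun_prop) (by fun_prop))]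
  simp_rw [this]
  rw [lintegral_comp_abs, ← lintegral_Ioc_rpow hb hR, lintegral_indicator measurableSet_Iic,
    Measure.restrict_restrict measurableSet_Iic, Iic_inter_Ioi]

/-- Power weights `|x| ^ (-b)` with `0 ≤ b < 1` are in the class `A₁`, tested on Cauchy kernels. -/
theorem lintegral_cauchyKernel_mul_abs_rpow_le {b : ℝ} (hb0 : 0 ≤ b) (hb1 : b < 1) :
    ∃ C : ℝ≥0, ∀ a : ℝ, 0 < a → ∀ x : ℝ, x ≠ 0 →
      ∫⁻ y, ENNReal.ofReal (cauchyKernel a (x - y)) * ENNReal.ofReal (|y| ^ (-b)) ≤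
        C * ENNReal.ofReal (|x| ^ (-b)) := by
  refine ⟨Real.toNNReal (2 ^ b * Real.pi + 2 ^ b / (1 - b)), fun a ha x hx => ?_⟩
  have hx' : 0 < |x| := abs_pos.2 hx
  have h1b : 0 < 1 - b := by linarith
  -- for `|y| ≤ |x| / 2` the kernel is at most `|x|⁻¹`, otherwise the weight is comparable to its
  -- value at `x`
  have pt : ∀ y, ENNReal.ofReal (cauchyKernel a (x - y)) * ENNReal.ofReal (|y| ^ (-b)) ≤
      ENNReal.ofReal (2 ^ b * |x| ^ (-b)) * ENNReal.ofReal (cauchyKernel a (x - y)) +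
      ENNReal.ofReal (|x|⁻¹) *
        ({y : ℝ | |y| ≤ |x| / 2}).indicator (fun y => ENNReal.ofReal (|y| ^ (-b))) y := by
    intro y
    by_cases hy : |y| ≤ |x| / 2
    · rw [indicator_of_mem (by exact hy)]
      refine le_trans ?_ le_add_self
      gcongr
      have hz : |x| / 2 ≤ |x - y| := by
        have := abs_sub_abs_le_abs_sub x y; linarith
      unfold cauchyKernel
      rw [← sq_abs (x - y), inv_eq_one_div, div_le_div_iff₀ (by positivity) hx']
      nlinarith [sq_nonneg (a - |x - y|)]
    · rw [indicator_of_notMem (by exact hy), mul_zero, add_zero, mul_comm]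
      push Not at hy
      gcongr
      calc |y| ^ (-b) ≤ (|x| / 2) ^ (-b) :=
            Real.rpow_le_rpow_of_nonpos (by positivity) hy.le (by linarith)
        _ = _ := by
          rw [Real.div_rpow hx'.le (by norm_num), Real.rpow_neg (by norm_num : (0 : ℝ) ≤ 2)]
          field_simp
  refine (lintegral_mono pt).trans ?_
  have hm : Measurable fun y => ENNReal.ofReal (cauchyKernel a (x - y)) :=
    ((measurable_cauchyKernel a).comp (by fun_prop)).ennreal_ofReal
  have hs : MeasurableSet {y : ℝ | |y| ≤ |x| / 2} :=
    measurableSet_le (by fun_prop) (by fun_prop)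
  rw [lintegral_add_left (by fun_prop), lintegral_const_mul _ hm, lintegral_const_mul _
    (Measurable.indicator (by fun_prop) hs),
    lintegral_indicator hs, setLIntegral_abs_rpow (by linarith) (by positivity),
    lintegral_sub_left_eq_self (fun y => ENNReal.ofReal (cauchyKernel a y)) x,
    lintegral_cauchyKernel ha, ← ENNReal.ofReal_mul (by positivity),
    show (2 : ℝ≥0∞) = ENNReal.ofReal 2 by simp, ← ENNReal.ofReal_mul (by positivity),
    ← ENNReal.ofReal_mul (by positivity),
    ← ENNReal.ofReal_add (by positivity) (mul_nonneg (by positivity) (mul_nonneg (by norm_num)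
      (div_nonneg (by positivity) (by linarith))))]
  change _ ≤ ENNReal.ofReal _ * _
  rw [← ENNReal.ofReal_mul (by positivity)]
  refine ENNReal.ofReal_le_ofReal (le_of_eq ?_)
  have e : (|x| / 2) ^ (-b + 1) = |x| ^ (-b) * |x| * (2 ^ b / 2) := by
    rw [Real.div_rpow hx'.le (by norm_num), Real.rpow_add hx', Real.rpow_one,
      Real.rpow_add (by norm_num : (0 : ℝ) < 2), Real.rpow_one,
      Real.rpow_neg (by norm_num : (0 : ℝ) ≤ 2)]
    field_simp
  rw [e, show -b + 1 = 1 - b by ring]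
  field_simp

/-- Convolution with Cauchy kernels is bounded on `L^p(|x|^γ)`, `-1 < γ < p - 1`, uniformly in the
scale. -/
theorem lintegral_rpow_cauchyKernel_conv_le {p γ : ℝ} (hp : 1 < p) (hγ : γ ∈ Ioo (-1 : ℝ) (p - 1)) :
    ∃ C : ℝ≥0, ∀ a : ℝ, 0 < a → ∀ F : ℝ → ℝ≥0∞, Measurable F →
      ∫⁻ x, (∫⁻ y, ENNReal.ofReal (cauchyKernel a (x - y)) * F y) ^ p * ENNReal.ofReal (|x| ^ γ) ≤
        C * ∫⁻ y, F y ^ p * ENNReal.ofReal (|y| ^ γ) := by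
  obtain ⟨hγ1, hγ2⟩ := hγ
  have hp1 : 0 < p - 1 := by linarith
  -- the Schur weight is `|y| ^ (-t)`; both `t` and `t (p - 1) - γ` must lie in `[0, 1)`
  set t : ℝ := max γ 0 / (p - 1) with ht
  have ht0 : 0 ≤ t := by positivity
  have ht1 : t < 1 := by rw [ht, div_lt_one hp1]; exact max_lt hγ2 hp1
  have htp : t * (p - 1) = max γ 0 := by rw [ht]; field_simp
  have hu0 : 0 ≤ t * (p - 1) - γ := by rw [htp]; linarith [le_max_left γ 0]
  have hu1 : t * (p - 1) - γ < 1 := by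
    rw [htp]; rcases max_cases γ 0 with h | h <;> linarith
  obtain ⟨C₁, hC₁⟩ := lintegral_cauchyKernel_mul_abs_rpow_le ht0 ht1
  obtain ⟨C₂, hC₂⟩ := lintegral_cauchyKernel_mul_abs_rpow_le hu0 hu1
  refine ⟨C₁ ^ (p - 1) * C₂, fun a ha F hF => ?_⟩
  have hE : Measurable (Function.uncurry fun x y => ENNReal.ofReal (cauchyKernel a (x - y))) :=
    ((measurable_cauchyKernel a).comp (by fun_prop :
      Measurable fun z : ℝ × ℝ => z.1 - z.2)).ennreal_ofReal
  have hne : ∀ᵐ x : ℝ, x ≠ 0 := by simp [ae_iff, measure_singleton]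
  have key : ∀ x : ℝ, x ≠ 0 → ENNReal.ofReal (|x| ^ (-t)) ^ (p - 1) * ENNReal.ofReal (|x| ^ γ) =
      ENNReal.ofReal (|x| ^ (-(t * (p - 1) - γ))) := by
    intro x hx
    have hx' : 0 < |x| := abs_pos.2 hx
    rw [ENNReal.ofReal_rpow_of_nonneg (by positivity) hp1.le, ← ENNReal.ofReal_mul (by positivity),
      ← Real.rpow_mul hx'.le, ← Real.rpow_add hx']
    congr 2; ring
  refine lintegral_rpow_le_of_schur volume volume hp hE hF
    (b := fun y => ENNReal.ofReal (|y| ^ (-t))) (by fun_prop) (by fun_prop) ?_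
    (A := fun x => C₁ * ENNReal.ofReal (|x| ^ (-t))) (by fun_prop) (by fun_prop) ?_ ?_
  · filter_upwards [hne] with y hy
    have : 0 < |y| := abs_pos.2 hy
    simp; positivity
  · filter_upwards [hne] with x hx using hC₁ a ha x hx
  · filter_upwards [hne] with y hy
    have e : ∀ᵐ x : ℝ, ENNReal.ofReal (cauchyKernel a (x - y)) *
        ((C₁ * ENNReal.ofReal (|x| ^ (-t))) ^ (p - 1) * ENNReal.ofReal (|x| ^ γ)) =
        C₁ ^ (p - 1) * (ENNReal.ofReal (cauchyKernel a (y - x)) *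
          ENNReal.ofReal (|x| ^ (-(t * (p - 1) - γ)))) := by
      filter_upwards [hne] with x hx
      rw [ENNReal.mul_rpow_of_nonneg _ _ hp1.le, mul_assoc, key x hx, ← cauchyKernel_neg, neg_sub]
      ring
    rw [lintegral_congr_ae e, lintegral_const_mul _ (by fun_prop), key y hy]
    calc _ ≤ (C₁ : ℝ≥0∞) ^ (p - 1) * (C₂ * ENNReal.ofReal (|y| ^ (-(t * (p - 1) - γ)))) := by
          gcongr; exact hC₂ a ha y hy
      _ = _ := by
          rw [ENNReal.coe_mul, ENNReal.coe_rpow_of_nonneg _ hp1.le, mul_assoc]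

/-- Pairing with a Cauchy kernel at scale `a` centred at the origin is controlled by the norm of
`L^p(|x|^γ)`, with the factor `a ^ (-(1 + γ) / p)` dictated by scaling. -/
theorem lintegral_cauchyKernel_mul_le {p γ : ℝ} (hp : 1 < p) (hγ : γ ∈ Ioo (-1 : ℝ) (p - 1)) :
    ∃ C : ℝ≥0, ∀ a : ℝ, 0 < a → ∀ F : ℝ → ℝ≥0∞, Measurable F →
      ∫⁻ x, ENNReal.ofReal (cauchyKernel a x) * F x ≤
        C * ENNReal.ofReal (a ^ (-((1 + γ) / p))) *
          (∫⁻ x, F x ^ p * ENNReal.ofReal (|x| ^ γ)) ^ (1 / p) := by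
  obtain ⟨hγ1, hγ2⟩ := hγ
  have hp0 : 0 < p := by linarith
  have hp1 : 0 < p - 1 := by linarith
  have hpq := Real.HolderConjugate.conjExponent hp
  set q := p.conjExponent with hq
  have hq' : q = p / (p - 1) := rfl
  have hq0 : 0 < q := hpq.symm.pos
  have hq1 : 1 < q := hpq.symm.lt
  have hpq1 : p⁻¹ + q⁻¹ = 1 := hpq.inv_add_inv_eq_one
  set h : ℝ → ℝ → ℝ≥0∞ := fun a x => ENNReal.ofReal (cauchyKernel a x * |x| ^ (-(γ / p))) with hh
  have hm : ∀ a, Measurable (h a) := fun a => by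
    have := measurable_cauchyKernel a; simp only [hh]; fun_prop
  -- `γ < p - 1` gives integrability at the origin and `-1 < γ` integrability at infinity
  have hfin : ∫⁻ x, h 1 x ^ q < ∞ := by
    have e : ∀ x, h 1 x ^ q = (fun y => h 1 y ^ q) |x| := fun x => by
      simp [hh, cauchyKernel]
    rw [lintegral_congr e, lintegral_comp_abs (f := fun y => h 1 y ^ q)]
    refine ENNReal.mul_lt_top (by simp) ?_
    rw [← Ioc_union_Ioi_eq_Ioi zero_le_one]
    refine (lintegral_union_le _ _ _).trans_lt (ENNReal.add_lt_top.2 ⟨?_, ?_⟩)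
    · have hβ : -1 < -(γ / p) * q := by
        rw [hq', show -(γ / p) * (p / (p - 1)) = -(γ / (p - 1)) by field_simp, neg_lt_neg_iff,
          div_lt_one hp1]
        exact hγ2
      refine lt_of_le_of_lt ?_ ((lintegral_Ioc_rpow hβ zero_le_one).trans_lt ENNReal.ofReal_lt_top)
      refine setLIntegral_mono (by fun_prop) fun x hx => ?_
      have hx0 := hx.1
      rw [ENNReal.ofReal_rpow_of_nonneg (mul_nonneg (cauchyKernel_nonneg one_pos x) (by positivity))
        hq0.le, Real.rpow_mul hx0.le]
      have := cauchyKernel_nonneg one_pos x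
      gcongr
      rw [abs_of_pos hx0]
      refine mul_le_of_le_one_left (Real.rpow_nonneg hx0.le _) ?_
      unfold cauchyKernel
      rw [div_le_one (by positivity)]; nlinarith [sq_nonneg x]
    · have hβ : (-2 - γ / p) * q < -1 := by
        have : -1 < γ / p := by rw [lt_div_iff₀ hp0]; linarith
        nlinarith
      have := (integrableOn_Ioi_rpow_of_lt hβ (one_pos (α := ℝ))).lintegral_lt_top
      refine lt_of_le_of_lt ?_ this
      refine setLIntegral_mono (by fun_prop) fun x hx => ?_
      have hx0 : 0 < x := lt_trans (one_pos (α := ℝ)) hx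
      rw [ENNReal.ofReal_rpow_of_nonneg (mul_nonneg (cauchyKernel_nonneg one_pos x) (by positivity))
        hq0.le, Real.rpow_mul hx0.le, abs_of_pos hx0, sub_eq_add_neg, Real.rpow_add hx0]
      have h1 : cauchyKernel 1 x ≤ x ^ (-2 : ℝ) := by
        rw [Real.rpow_neg hx0.le, Real.rpow_two]
        unfold cauchyKernel
        rw [inv_eq_one_div]
        gcongr
        nlinarith
      have := cauchyKernel_nonneg one_pos x
      gcongr
  have hscale : ∀ a, 0 < a → (∫⁻ x, h a x ^ q) ^ (1 / q) =
      ENNReal.ofReal (a ^ (-((1 + γ) / p))) * (∫⁻ x, h 1 x ^ q) ^ (1 / q) := by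
    intro a ha
    have e : ∀ x, h a x ^ q = ENNReal.ofReal (a ^ (-1 - γ / p)) ^ q * (fun y => h 1 y ^ q) (a⁻¹ * x) := by
      intro x
      simp only [hh]
      rw [← ENNReal.mul_rpow_of_nonneg _ _ hq0.le, ← ENNReal.ofReal_mul (by positivity),
        cauchyKernel_eq ha, abs_mul, abs_of_pos (inv_pos.2 ha), Real.mul_rpow (by positivity)
        (by positivity), Real.rpow_sub ha, Real.rpow_neg_one, Real.inv_rpow ha.le,
        ← Real.rpow_neg ha.le, neg_neg]
      congr 2; field_simp
    rw [lintegral_congr e, lintegral_const_mul _ (by fun_prop),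
      lintegral_comp_const_mul (f := fun y => h 1 y ^ q) (inv_pos.2 ha) ((hm 1).pow_const q),
      ENNReal.mul_rpow_of_nonneg _ _ (by positivity), ENNReal.mul_rpow_of_nonneg _ _ (by positivity),
      ← ENNReal.rpow_mul, one_div, mul_inv_cancel₀ hq0.ne', ENNReal.rpow_one, ← mul_assoc, inv_inv,
      ENNReal.ofReal_rpow_of_nonneg ha.le (by positivity), ← ENNReal.ofReal_mul (by positivity),
      ← Real.rpow_add ha]
    congr 3
    have : q⁻¹ = 1 - p⁻¹ := by linarith
    rw [this]; field_simp; ring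
  refine ⟨((∫⁻ x, h 1 x ^ q) ^ (1 / q)).toNNReal, fun a ha F hF => ?_⟩
  rw [ENNReal.coe_toNNReal (ENNReal.rpow_lt_top_of_nonneg (by positivity) hfin.ne).ne,
    mul_comm (_ ^ (1 / q)), ← hscale a ha]
  have := ENNReal.lintegral_mul_le_Lp_mul_Lq volume hpq.symm (hm a).aemeasurable
    (g := fun x => F x * ENNReal.ofReal (|x| ^ (γ / p))) (by fun_prop)
  have e1 : ∀ x, (F x * ENNReal.ofReal (|x| ^ (γ / p))) ^ p = F x ^ p * ENNReal.ofReal (|x| ^ γ) := by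
    intro x
    rw [ENNReal.mul_rpow_of_nonneg _ _ hp0.le, ENNReal.ofReal_rpow_of_nonneg (by positivity) hp0.le,
      ← Real.rpow_mul (by positivity), div_mul_cancel₀ _ hp0.ne']
  simp only [e1] at this
  refine le_trans (le_of_eq (lintegral_congr_ae ?_)) this
  have hne : ∀ᵐ x : ℝ, x ≠ 0 := by simp [ae_iff, measure_singleton]
  filter_upwards [hne] with x hx
  have hx' : 0 < |x| := abs_pos.2 hx
  simp only [Pi.mul_apply, hh]
  rw [ENNReal.ofReal_mul (cauchyKernel_nonneg ha x), mul_comm (F x), ← mul_assoc, mul_assoc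
    (ENNReal.ofReal _), ← ENNReal.ofReal_mul (by positivity), ← Real.rpow_add hx', neg_add_cancel,
    Real.rpow_zero, ENNReal.ofReal_one, mul_one]

/-! ### Convolution, translation and dyadic dilation of Schwartz functions -/

/-- Convolution of scalar Schwartz functions. -/
def schwartzConv (f g : 𝓢(ℝ, ℂ)) : 𝓢(ℝ, ℂ) :=
  SchwartzMap.convolution (ContinuousLinearMap.mul ℂ ℂ) f g

theorem schwartzConv_apply (f g : 𝓢(ℝ, ℂ)) (y : ℝ) :
    schwartzConv f g y = ∫ t, f t * g (y - t) := by
  rw [schwartzConv, SchwartzMap.convolution_apply]; rfl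

theorem fourier_schwartzConv (f g : 𝓢(ℝ, ℂ)) (ξ : ℝ) :
    𝓕 (schwartzConv f g) ξ = 𝓕 f ξ * 𝓕 g ξ := by
  rw [schwartzConv, SchwartzMap.fourier_convolution]; simp

theorem schwartzMap_ext_fourier {f g : 𝓢(ℝ, ℂ)} (h : ∀ ξ, 𝓕 f ξ = 𝓕 g ξ) : f = g := by
  have h' : 𝓕 f = 𝓕 g := SchwartzMap.ext h
  have := congrArg (𝓕⁻ · : 𝓢(ℝ, ℂ) → 𝓢(ℝ, ℂ)) h'
  simpa using this

theorem schwartzConv_comm (f g : 𝓢(ℝ, ℂ)) : schwartzConv f g = schwartzConv g f :=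
  schwartzMap_ext_fourier fun ξ => by simp only [fourier_schwartzConv, mul_comm]

theorem schwartzConv_assoc (f g h : 𝓢(ℝ, ℂ)) :
    schwartzConv (schwartzConv f g) h = schwartzConv f (schwartzConv g h) :=
  schwartzMap_ext_fourier fun ξ => by simp only [fourier_schwartzConv, mul_assoc]

theorem schwartzConv_sum {ι : Type*} (s : Finset ι) (f : 𝓢(ℝ, ℂ)) (g : ι → 𝓢(ℝ, ℂ)) :
    schwartzConv f (∑ i ∈ s, g i) = ∑ i ∈ s, schwartzConv f (g i) := by
  simp [schwartzConv]

/-- Translation `f ↦ f (· - x)`. -/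
abbrev translate (x : ℝ) (f : 𝓢(ℝ, ℂ)) : 𝓢(ℝ, ℂ) := SchwartzMap.compSubConstCLM ℂ x f

theorem translate_schwartzConv (x : ℝ) (f g : 𝓢(ℝ, ℂ)) :
    schwartzConv f (translate x g) = translate x (schwartzConv f g) := by
  ext y
  simp only [translate, SchwartzMap.compSubConstCLM_apply, schwartzConv_apply]
  congr with t; congr 2; ring

theorem translate_schwartzConv_left (x : ℝ) (f g : 𝓢(ℝ, ℂ)) :
    schwartzConv (translate x f) g = translate x (schwartzConv f g) := by
  rw [schwartzConv_comm, translate_schwartzConv, schwartzConv_comm]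

/-- A convolution is differentiated by differentiating one factor; on the Fourier side both are
multiplication by the same symbol. -/
theorem schwartzConv_derivCLM (f g : 𝓢(ℝ, ℂ)) :
    SchwartzMap.derivCLM ℂ ℂ (schwartzConv f g) =
      schwartzConv f (SchwartzMap.derivCLM ℂ ℂ g) := by
  have key : ∀ (h : 𝓢(ℝ, ℂ)) (ξ : ℝ),
      𝓕 (SchwartzMap.derivCLM ℂ ℂ h) ξ = (2 * Real.pi * Complex.I * ξ) * 𝓕 h ξ := by
    intro h ξ
    have e : ((SchwartzMap.derivCLM ℂ ℂ h : 𝓢(ℝ, ℂ)) : ℝ → ℂ) = deriv h := by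
      ext x; simp
    rw [SchwartzMap.fourier_coe, e, Real.fourier_deriv h.integrable
      h.differentiable (e ▸ (SchwartzMap.derivCLM ℂ ℂ h).integrable),
      SchwartzMap.fourier_coe]
    rfl
  refine schwartzMap_ext_fourier fun ξ => ?_
  rw [key, fourier_schwartzConv, fourier_schwartzConv, key]; ring

theorem two_zpow_ne_zero (n : ℤ) : (2 : ℝ) ^ n ≠ 0 := zpow_ne_zero _ two_ne_zero

/-- The `L¹`-normalised dyadic dilation `f ↦ 2ⁿ f(2ⁿ ·)`. -/
def dyadicDilation (n : ℤ) (f : 𝓢(ℝ, ℂ)) : 𝓢(ℝ, ℂ) :=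
  ((2 : ℂ) ^ n) • SchwartzMap.compCLMOfContinuousLinearEquiv ℂ
    (ContinuousLinearEquiv.unitsEquivAut ℝ (Units.mk0 _ (two_zpow_ne_zero n))) f

theorem dyadicDilation_apply (n : ℤ) (f : 𝓢(ℝ, ℂ)) (x : ℝ) :
    dyadicDilation n f x = (2 : ℂ) ^ n * f (2 ^ n * x) := by
  simp [dyadicDilation, mul_comm x]

theorem fourier_dyadicDilation (n : ℤ) (f : 𝓢(ℝ, ℂ)) (ξ : ℝ) :
    𝓕 (dyadicDilation n f) ξ = 𝓕 f (2 ^ (-n) * ξ) := by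
  rw [SchwartzMap.fourier_coe, SchwartzMap.fourier_coe, Real.fourier_real_eq, Real.fourier_real_eq]
  have h2 : (0 : ℝ) < 2 ^ n := by positivity
  have := Measure.integral_comp_mul_left
    (fun v : ℝ => Real.fourierChar (-(v * (2 ^ (-n) * ξ))) • f v) (2 ^ n)
  rw [abs_of_pos (inv_pos.2 h2)] at this
  have h3 : ∀ v : ℝ, Real.fourierChar (-(v * ξ)) • dyadicDilation n f v =
      ((2 : ℝ) ^ n) • (Real.fourierChar (-(2 ^ n * v * (2 ^ (-n) * ξ))) • f (2 ^ n * v)) := by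
    intro v
    have : 2 ^ n * v * (2 ^ (-n) * ξ) = v * ξ := by
      rw [zpow_neg]; field_simp
    rw [this, dyadicDilation_apply, smul_comm]
    congr 1
    rw [Complex.real_smul]; push_cast; rfl
  simp_rw [h3]
  rw [integral_smul, this, smul_smul, mul_inv_cancel₀ h2.ne', one_smul]

theorem fourier_reflectTranslate_zero (f : 𝓢(ℝ, ℂ)) (ξ : ℝ) :
    𝓕 (reflectTranslate f 0) ξ = 𝓕 f (-ξ) := by
  rw [SchwartzMap.fourier_coe, SchwartzMap.fourier_coe, Real.fourier_real_eq, Real.fourier_real_eq,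
    ← integral_neg_eq_self]
  congr with v
  simp [reflectTranslate_apply]

theorem reflectTranslate_eq_translate (f : 𝓢(ℝ, ℂ)) (x : ℝ) :
    reflectTranslate f x = translate x (reflectTranslate f 0) := by
  ext y
  simp [reflectTranslate_apply]

theorem integral_dyadicDilation (n : ℤ) (f : 𝓢(ℝ, ℂ)) : ∫ x, dyadicDilation n f x = ∫ x, f x := by
  have h2 : (0 : ℝ) < 2 ^ n := by positivity
  simp_rw [dyadicDilation_apply]
  rw [integral_const_mul, Measure.integral_comp_mul_left (fun x => f x), abs_of_pos (inv_pos.2 h2),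
    Complex.real_smul]
  push_cast
  rw [← mul_assoc, mul_inv_cancel₀ (zpow_ne_zero _ two_ne_zero), one_mul]

/-! ### Translation is continuous in the Schwartz space -/

theorem iteratedDeriv_derivCLM_iterate (f : 𝓢(ℝ, ℂ)) (l : ℕ) (x : ℝ) :
    ((SchwartzMap.derivCLM ℂ ℂ)^[l] f : 𝓢(ℝ, ℂ)) x = iteratedDeriv l f x := by
  induction l generalizing x with
  | zero => simp
  | succ l ih =>
    rw [Function.iterate_succ_apply', SchwartzMap.derivCLM_apply, iteratedDeriv_succ]
    congr 1
    ext y; exact ih y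

theorem translate_derivCLM_iterate (f : 𝓢(ℝ, ℂ)) (l : ℕ) (x : ℝ) :
    (SchwartzMap.derivCLM ℂ ℂ)^[l] (translate x f) =
      translate x ((SchwartzMap.derivCLM ℂ ℂ)^[l] f) := by
  ext y
  rw [iteratedDeriv_derivCLM_iterate, translate, SchwartzMap.compSubConstCLM_apply,
    iteratedDeriv_derivCLM_iterate]
  exact congrFun (iteratedDeriv_comp_sub_const l f x) y

theorem abs_pow_le_add (k : ℕ) (y z : ℝ) : |y| ^ k ≤ 2 ^ k * (|y - z| ^ k + |z| ^ k) := by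
  have h : |y| ≤ 2 * max |y - z| |z| := by
    have : |y| ≤ |y - z| + |z| := by simpa using abs_add_le (y - z) z
    linarith [le_max_left |y - z| |z|, le_max_right |y - z| |z|]
  calc |y| ^ k ≤ (2 * max |y - z| |z|) ^ k := by gcongr
    _ = 2 ^ k * (max |y - z| |z|) ^ k := mul_pow _ _ _
    _ ≤ _ := by
      gcongr
      rcases max_choice |y - z| |z| with h | h <;> rw [h] <;> simp

theorem abs_pow_mul_norm_translate_le (f : 𝓢(ℝ, ℂ)) (k : ℕ) (x y : ℝ) :
    |y| ^ k * ‖f (y - x)‖ ≤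
      2 ^ k * (SchwartzMap.seminorm ℂ k 0 f + |x| ^ k * SchwartzMap.seminorm ℂ 0 0 f) := by
  have h1 := SchwartzMap.norm_pow_mul_le_seminorm ℂ f k (y - x)
  have h2 := SchwartzMap.norm_le_seminorm ℂ f (y - x)
  rw [Real.norm_eq_abs] at h1
  calc |y| ^ k * ‖f (y - x)‖ ≤ 2 ^ k * (|y - x| ^ k + |x| ^ k) * ‖f (y - x)‖ := by
        gcongr; exact abs_pow_le_add k y x
    _ = 2 ^ k * (|y - x| ^ k * ‖f (y - x)‖ + |x| ^ k * ‖f (y - x)‖) := by ring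
    _ ≤ _ := by gcongr

theorem abs_pow_mul_norm_translate_sub_le (f : 𝓢(ℝ, ℂ)) (k : ℕ) {R x x' : ℝ} (hx : |x| ≤ R)
    (hx' : |x'| ≤ R) (y : ℝ) :
    |y| ^ k * ‖f (y - x) - f (y - x')‖ ≤
      2 ^ k * (SchwartzMap.seminorm ℂ k 0 (SchwartzMap.derivCLM ℂ ℂ f) +
        R ^ k * SchwartzMap.seminorm ℂ 0 0 (SchwartzMap.derivCLM ℂ ℂ f)) * |x - x'| := by
  set f' := SchwartzMap.derivCLM ℂ ℂ f
  have hR : 0 ≤ R := (abs_nonneg x).trans hx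
  have hd : ∀ z ∈ Icc (-R) R, HasDerivWithinAt (fun z => ((|y| ^ k : ℝ) : ℂ) * f (y - z))
      (((|y| ^ k : ℝ) : ℂ) * (-(f' (y - z)))) (Icc (-R) R) z := by
    intro z _
    have h := (f.hasDerivAt (y - z)).scomp z ((hasDerivAt_id z).const_sub y)
    have := (h.const_mul ((|y| ^ k : ℝ) : ℂ)).hasDerivWithinAt (s := Icc (-R) R)
    simpa [Function.comp_def, f'] using this
  have := Convex.norm_image_sub_le_of_norm_hasDerivWithin_le hd
    (C := 2 ^ k * (SchwartzMap.seminorm ℂ k 0 f' + R ^ k * SchwartzMap.seminorm ℂ 0 0 f'))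
    (fun z hz => ?_) (convex_Icc _ _) (abs_le.1 hx') (abs_le.1 hx)
  · rw [← mul_sub, norm_mul, Complex.norm_real, norm_pow, Real.norm_eq_abs, abs_abs] at this
    simpa using this
  · rw [norm_mul, Complex.norm_real, norm_pow, Real.norm_eq_abs, abs_abs, norm_neg]
    refine (abs_pow_mul_norm_translate_le f' k z y).trans ?_
    have : |z| ≤ R := abs_le.2 hz
    gcongr

theorem continuous_translate (f : 𝓢(ℝ, ℂ)) : Continuous fun x => translate x f := by
  refine continuous_iff_continuousAt.2 fun x₀ => ?_
  rw [ContinuousAt, (schwartz_withSeminorms ℂ ℝ ℂ).tendsto_nhds]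
  rintro ⟨k, l⟩ ε hε
  set h := (SchwartzMap.derivCLM ℂ ℂ)^[l] f
  set M := 2 ^ k * (SchwartzMap.seminorm ℂ k 0 (SchwartzMap.derivCLM ℂ ℂ h) +
        (|x₀| + 1) ^ k * SchwartzMap.seminorm ℂ 0 0 (SchwartzMap.derivCLM ℂ ℂ h)) with hM
  have hM0 : 0 ≤ M := by positivity
  have hlim : Tendsto (fun x => M * |x - x₀|) (𝓝 x₀) (𝓝 0) := by
    have : Continuous fun x => M * |x - x₀| := by fun_prop
    simpa using this.tendsto x₀
  filter_upwards [hlim.eventually_lt_const hε, Metric.ball_mem_nhds x₀ one_pos] with x hx hx1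
  refine lt_of_le_of_lt ?_ hx
  rw [SchwartzMap.schwartzSeminormFamily_apply]
  refine SchwartzMap.seminorm_le_bound' ℂ k l _ (by positivity) fun y => ?_
  rw [← iteratedDeriv_derivCLM_iterate]
  have e : (SchwartzMap.derivCLM ℂ ℂ)^[l] (translate x f - translate x₀ f) =
      translate x h - translate x₀ h := by
    rw [← translate_derivCLM_iterate, ← translate_derivCLM_iterate]
    have : ∀ a b : 𝓢(ℝ, ℂ), (SchwartzMap.derivCLM ℂ ℂ)^[l] (a - b) =
        (SchwartzMap.derivCLM ℂ ℂ)^[l] a - (SchwartzMap.derivCLM ℂ ℂ)^[l] b := fun a b => by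
      simp
    exact this _ _
  rw [e]
  refine abs_pow_mul_norm_translate_sub_le h k ?_ (by linarith) y
  have : |x - x₀| < 1 := by simpa [Real.dist_eq] using hx1
  have := abs_sub_abs_le_abs_sub x x₀
  linarith

/-! ### Pairing a tempered distribution with a convolution -/

section Pairing

open scoped BoundedContinuousFunction

/-- The integral of a function with values in a closed subspace lies in that subspace. -/
theorem integral_mem_of_isClosed {α E : Type*} [MeasurableSpace α] {μ : Measure α}
    [NormedAddCommGroup E] [NormedSpace ℂ E] [CompleteSpace E] (S : Submodule ℂ E)
    (hS : IsClosed (S : Set E)) {f : α → E} (hf : Integrable f μ) (hfS : ∀ᵐ x ∂μ, f x ∈ S) :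
    ∫ x, f x ∂μ ∈ S := by
  have : IsClosed (S : Set E) := hS
  have h := S.mkQL.integral_comp_comm hf
  have h0 : ∫ x, S.mkQL (f x) ∂μ = 0 := by
    refine integral_eq_zero_of_ae ?_
    filter_upwards [hfS] with x hx
    exact (Submodule.Quotient.mk_eq_zero S).2 hx
  exact (Submodule.Quotient.mk_eq_zero S).1 (h.symm.trans h0)

/-- The weighted derivative `y ↦ y ^ k f⁽ˡ⁾(y)` as a map from the Schwartz space to bounded
continuous functions. Its sup norm is the `(k, l)`-th Schwartz seminorm. -/
def weightedDeriv (i : ℕ × ℕ) : 𝓢(ℝ, ℂ) →L[ℂ] (ℝ →ᵇ ℂ) :=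
  (SchwartzMap.toBoundedContinuousFunctionCLM ℂ ℝ ℂ).comp
    ((SchwartzMap.smulLeftCLM ℂ (fun y : ℝ => (y : ℂ) ^ i.1)).comp
      ((SchwartzMap.derivCLM ℂ ℂ : 𝓢(ℝ, ℂ) →L[ℂ] 𝓢(ℝ, ℂ)) ^ i.2))

theorem weightedDeriv_apply (i : ℕ × ℕ) (f : 𝓢(ℝ, ℂ)) (y : ℝ) :
    weightedDeriv i f y = (y : ℂ) ^ i.1 * ((SchwartzMap.derivCLM ℂ ℂ)^[i.2] f : 𝓢(ℝ, ℂ)) y := by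
  have h : Function.HasTemperateGrowth fun y : ℝ => (y : ℂ) ^ i.1 := by fun_prop
  simp [weightedDeriv, SchwartzMap.smulLeftCLM_apply_apply h]

theorem seminorm_le_norm_weightedDeriv (i : ℕ × ℕ) (f : 𝓢(ℝ, ℂ)) :
    schwartzSeminormFamily ℂ ℝ ℂ i f ≤ ‖weightedDeriv i f‖ := by
  refine SchwartzMap.seminorm_le_bound' ℂ i.1 i.2 f (norm_nonneg _) fun y => ?_
  have := (weightedDeriv i f).norm_coe_le_norm y
  rw [weightedDeriv_apply, norm_mul, norm_pow, Complex.norm_real, Real.norm_eq_abs,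
    iteratedDeriv_derivCLM_iterate] at this
  exact this

theorem norm_weightedDeriv_translate_le (i : ℕ × ℕ) (f : 𝓢(ℝ, ℂ)) :
    ∃ C : ℝ, ∀ x, ‖weightedDeriv i (translate x f)‖ ≤ C * (1 + |x| ^ i.1) := by
  set h := (SchwartzMap.derivCLM ℂ ℂ)^[i.2] f
  refine ⟨2 ^ i.1 * (SchwartzMap.seminorm ℂ i.1 0 h + SchwartzMap.seminorm ℂ 0 0 h), fun x => ?_⟩
  have h1 : 0 ≤ SchwartzMap.seminorm ℂ i.1 0 h := apply_nonneg _ _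
  have h2 : 0 ≤ SchwartzMap.seminorm ℂ 0 0 h := apply_nonneg _ _
  refine (BoundedContinuousFunction.norm_le (by positivity)).2 fun y => ?_
  rw [weightedDeriv_apply, norm_mul, norm_pow, Complex.norm_real, Real.norm_eq_abs,
    translate_derivCLM_iterate]
  refine (abs_pow_mul_norm_translate_le h i.1 x y).trans ?_
  rw [mul_assoc]
  gcongr
  nlinarith [mul_nonneg (pow_nonneg (abs_nonneg x) i.1) h1, pow_nonneg (abs_nonneg x) i.1]

theorem weightedDeriv_schwartzConv (i : ℕ × ℕ) (ψ f : 𝓢(ℝ, ℂ)) (y : ℝ) :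
    weightedDeriv i (schwartzConv ψ f) y = ∫ x, ψ x * weightedDeriv i (translate x f) y := by
  have hD : ∀ l : ℕ, (SchwartzMap.derivCLM ℂ ℂ)^[l] (schwartzConv ψ f) =
      schwartzConv ψ ((SchwartzMap.derivCLM ℂ ℂ)^[l] f) := by
    intro l
    induction l with
    | zero => rfl
    | succ l ih =>
      rw [Function.iterate_succ_apply', Function.iterate_succ_apply', ih, schwartzConv_derivCLM]
  rw [weightedDeriv_apply, hD, schwartzConv_apply, ← integral_const_mul]
  congr with x
  rw [weightedDeriv_apply, translate_derivCLM_iterate, translate,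
    SchwartzMap.compSubConstCLM_apply]
  ring

variable {X : Type*} [NormedAddCommGroup X] [NormedSpace ℂ X]

/-- A tempered distribution with values in a normed space is of finite order. -/
theorem exists_norm_le_sum_weightedDeriv (g : 𝓢'(ℝ, X)) :
    ∃ (s : Finset (ℕ × ℕ)) (C : ℝ), 0 ≤ C ∧
      ∀ f : 𝓢(ℝ, ℂ), ‖g f‖ ≤ C * ∑ i ∈ s, ‖weightedDeriv i f‖ := by
  have hc : Continuous ((normSeminorm ℂ X).comp (g : 𝓢(ℝ, ℂ) →ₗ[ℂ] X)) :=
    continuous_norm.comp (map_continuous g)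
  obtain ⟨s, C, -, hC⟩ := Seminorm.bound_of_continuous (schwartz_withSeminorms ℂ ℝ ℂ) _ hc
  refine ⟨s, C, C.2, fun f => (hC f).trans ?_⟩
  rw [smul_apply, NNReal.smul_def, smul_eq_mul]
  have h1 := Seminorm.le_def.1 (Seminorm.finset_sup_le_sum (schwartzSeminormFamily ℂ ℝ ℂ) s) f
  have h2 : (∑ i ∈ s, schwartzSeminormFamily ℂ ℝ ℂ i) f =
      ∑ i ∈ s, schwartzSeminormFamily ℂ ℝ ℂ i f := by simp
  rw [h2] at h1
  refine mul_le_mul_of_nonneg_left (h1.trans ?_) C.2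
  exact Finset.sum_le_sum fun i _ => seminorm_le_norm_weightedDeriv i f

theorem continuous_apply_translate (g : 𝓢'(ℝ, X)) (f : 𝓢(ℝ, ℂ)) :
    Continuous fun x => g (translate x f) :=
  (map_continuous g).comp (continuous_translate f)

theorem integrable_mul_one_add_abs_pow (ψ : 𝓢(ℝ, ℂ)) (k : ℕ) :
    Integrable fun x => ‖ψ x‖ * (1 + |x| ^ k) := by
  have h1 := ψ.integrable_pow_mul volume 0
  have h2 := ψ.integrable_pow_mul volume k
  refine (h1.add h2).congr (Eventually.of_forall fun x => ?_)
  simp [Real.norm_eq_abs]; ring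

theorem integrable_smul_weightedDeriv_translate (ψ f : 𝓢(ℝ, ℂ)) (i : ℕ × ℕ) :
    Integrable fun x => ψ x • weightedDeriv i (translate x f) := by
  obtain ⟨C, hC⟩ := norm_weightedDeriv_translate_le i f
  refine ((integrable_mul_one_add_abs_pow ψ i.1).const_mul C).mono' ?_ ?_
  · have := (weightedDeriv i).continuous.comp (continuous_translate f)
    exact (ψ.continuous.smul this).aestronglyMeasurable
  · refine Eventually.of_forall fun x => ?_
    rw [norm_smul]
    calc _ ≤ ‖ψ x‖ * (C * (1 + |x| ^ i.1)) := by gcongr; exact hC x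
      _ = _ := by ring

theorem integrable_smul_apply_translate (g : 𝓢'(ℝ, X)) (ψ f : 𝓢(ℝ, ℂ)) :
    Integrable fun x => ψ x • g (translate x f) := by
  obtain ⟨s, C, hC0, hC⟩ := exists_norm_le_sum_weightedDeriv g
  have := (integrable_finsetSum s fun i _ =>
    (integrable_smul_weightedDeriv_translate ψ f i).norm).const_mul C
  refine this.mono' (ψ.continuous.smul (continuous_apply_translate g f)).aestronglyMeasurable ?_
  refine Eventually.of_forall fun x => ?_
  simp only [norm_smul]
  rw [← Finset.mul_sum]
  calc _ ≤ ‖ψ x‖ * (C * ∑ i ∈ s, ‖weightedDeriv i (translate x f)‖) := by gcongr; exact hC _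
    _ = _ := by ring

/-- A tempered distribution may be moved under the integral `ψ * f = ∫ ψ(x) f(· - x) dx`. The
Schwartz space is not normable, so the integral is taken in the closure of the graph of `g` in
a product of finitely many spaces of bounded continuous functions with `X`; over `0` this closure
is trivial because `g` is bounded by finitely many Schwartz seminorms. -/
theorem apply_schwartzConv [CompleteSpace X] (g : 𝓢'(ℝ, X)) (ψ f : 𝓢(ℝ, ℂ)) :
    g (schwartzConv ψ f) = ∫ x, ψ x • g (translate x f) := by
  obtain ⟨s, C, hC0, hC⟩ := exists_norm_le_sum_weightedDeriv g
  let Φ : 𝓢(ℝ, ℂ) →ₗ[ℂ] (s → (ℝ →ᵇ ℂ)) × X :=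
    (LinearMap.pi fun i : s => (weightedDeriv (i : ℕ × ℕ) : 𝓢(ℝ, ℂ) →ₗ[ℂ] (ℝ →ᵇ ℂ))).prod
      (g : 𝓢(ℝ, ℂ) →ₗ[ℂ] X)
  have hΦ1 : ∀ f i, (Φ f).1 i = weightedDeriv i f := fun f i => rfl
  have hΦ2 : ∀ f, (Φ f).2 = g f := fun f => rfl
  let H : Submodule ℂ ((s → (ℝ →ᵇ ℂ)) × X) := (LinearMap.range Φ).topologicalClosure
  have hHc : IsClosed (H : Set ((s → (ℝ →ᵇ ℂ)) × X)) := Submodule.isClosed_topologicalClosure _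
  have hΦH : ∀ f, Φ f ∈ H := fun f => Submodule.le_topologicalClosure _ (LinearMap.mem_range_self Φ f)
  have hH : ∀ z ∈ H, ‖z.2‖ ≤ C * ∑ i, ‖z.1 i‖ := by
    have hcl : IsClosed {z : (s → (ℝ →ᵇ ℂ)) × X | ‖z.2‖ ≤ C * ∑ i, ‖z.1 i‖} :=
      isClosed_le (by fun_prop) (by fun_prop)
    refine fun z hz => closure_minimal ?_ hcl hz
    rintro _ ⟨f, rfl⟩
    have := hC f
    rw [← Finset.sum_coe_sort] at this
    exact this
  have hint1 : Integrable fun x => fun i : s => ψ x • weightedDeriv (i : ℕ × ℕ) (translate x f) :=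
    Integrable.of_eval fun i => integrable_smul_weightedDeriv_translate ψ f i
  have hint : Integrable fun x => ψ x • Φ (translate x f) :=
    hint1.prodMk (integrable_smul_apply_translate g ψ f)
  have hmem := integral_mem_of_isClosed H hHc hint
    (Eventually.of_forall fun x => H.smul_mem _ (hΦH _))
  set J := ∫ x, ψ x • Φ (translate x f) with hJ
  have hJ2 : J.2 = ∫ x, ψ x • g (translate x f) :=
    ((ContinuousLinearMap.snd ℂ (s → (ℝ →ᵇ ℂ)) X).integral_comp_comm hint).symm
  have hJ1 : ∀ i : s, J.1 i = weightedDeriv i (schwartzConv ψ f) := by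
    intro i
    ext y
    let L : (s → (ℝ →ᵇ ℂ)) × X →L[ℂ] ℂ := (BoundedContinuousFunction.evalCLM ℂ y).comp
      ((ContinuousLinearMap.proj i).comp (ContinuousLinearMap.fst ℂ (s → (ℝ →ᵇ ℂ)) X))
    have := L.integral_comp_comm hint
    rw [weightedDeriv_schwartzConv]
    exact this.symm
  -- `J` and the graph point over `ψ * f` lie in `H` and have the same first component
  have hz := hH _ (H.sub_mem hmem (hΦH (schwartzConv ψ f)))
  have h0 : ∀ i : s, (J - Φ (schwartzConv ψ f)).1 i = 0 := fun i => by
    change J.1 i - (Φ (schwartzConv ψ f)).1 i = 0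
    rw [hJ1, hΦ1, sub_self]
  simp only [h0, norm_zero, Finset.sum_const_zero, mul_zero, norm_le_zero_iff] at hz
  have : J.2 - g (schwartzConv ψ f) = 0 := hz
  rw [← hJ2]
  exact (sub_eq_zero.1 this).symm

end Pairing

/-! ### Low-frequency truncations converge in the Schwartz space -/

/-- Multiplying by the dilations `χ(2⁻ⁿ ·)` keeps Schwartz seminorms bounded uniformly in `n`. -/
theorem seminorm_truncation_le (f χ : 𝓢(ℝ, ℂ)) (k l : ℕ) :
    ∃ M : ℝ, 0 ≤ M ∧ ∀ (n : ℕ) (F : 𝓢(ℝ, ℂ)), (∀ ξ, F ξ = f ξ * χ ((2 ^ n)⁻¹ * ξ)) → ∀ ξ,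
      |ξ| ^ k * ‖iteratedDeriv l F ξ‖ ≤ M := by
  refine ⟨∑ i ∈ Finset.range (l + 1), (l.choose i : ℝ) * SchwartzMap.seminorm ℂ k i f *
    SchwartzMap.seminorm ℂ 0 (l - i) χ, by positivity, fun n F hF ξ => ?_⟩
  set c : ℝ := (2 ^ n)⁻¹
  have hc1 : |c| ≤ 1 := by
    rw [abs_of_pos (by positivity)]
    exact inv_le_one_of_one_le₀ (one_le_pow₀ (by norm_num))
  have hFe : (F : ℝ → ℂ) = fun ξ => f ξ * (fun ξ => χ (c * ξ)) ξ := funext hF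
  have hχ : ContDiff ℝ l fun ξ => χ (c * ξ) := (χ.smooth l).comp (by fun_prop)
  have h := norm_iteratedFDeriv_mul_le (f.smooth l) hχ ξ (n := l) le_rfl
  rw [← norm_iteratedFDeriv_eq_norm_iteratedDeriv, hFe]
  refine (mul_le_mul_of_nonneg_left h (by positivity)).trans ?_
  rw [Finset.mul_sum]
  refine Finset.sum_le_sum fun i _ => ?_
  rw [norm_iteratedFDeriv_eq_norm_iteratedDeriv, norm_iteratedFDeriv_eq_norm_iteratedDeriv]
  have h1 := SchwartzMap.le_seminorm' ℂ k i f ξ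
  have h2 : ‖iteratedDeriv (l - i) (fun ξ => χ (c * ξ)) ξ‖ ≤ SchwartzMap.seminorm ℂ 0 (l - i) χ := by
    have hs : ContDiff ℝ (l - i : ℕ) χ := χ.smooth (l - i : ℕ)
    have hd : iteratedDeriv (l - i) (fun ξ => χ (c * ξ)) ξ =
        c ^ (l - i) • iteratedDeriv (l - i) χ (c * ξ) :=
      congrFun (iteratedDeriv_comp_const_smul hs c) ξ
    rw [hd]
    have := SchwartzMap.le_seminorm' ℂ 0 (l - i) χ (c * ξ)
    rw [pow_zero, one_mul] at this
    rw [norm_smul, norm_pow, Real.norm_eq_abs]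
    calc _ ≤ 1 * ‖iteratedDeriv (l - i) χ (c * ξ)‖ := by
          gcongr; exact pow_le_one₀ (abs_nonneg _) hc1
      _ ≤ _ := by rwa [one_mul]
  calc _ = (l.choose i : ℝ) * (|ξ| ^ k * ‖iteratedDeriv i f ξ‖) *
        ‖iteratedDeriv (l - i) (fun ξ => χ (c * ξ)) ξ‖ := by ring
    _ ≤ _ := by gcongr

/-- If `𝓕 Θ = 1` on the unit interval, then the dilates of `Θ` form an approximate identity in the
topology of the Schwartz space. On the Fourier side the error is supported in `|ξ| ≥ 2ⁿ`, where one
extra power of `|ξ|` gains a factor `2⁻ⁿ`. -/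
theorem tendsto_schwartzConv_dyadicDilation {Θ : 𝓢(ℝ, ℂ)} (hΘ : ∀ ξ : ℝ, |ξ| ≤ 1 → 𝓕 Θ ξ = 1)
    (ψ : 𝓢(ℝ, ℂ)) :
    Tendsto (fun n : ℕ => schwartzConv ψ (dyadicDilation n Θ)) atTop (𝓝 ψ) := by
  set F : ℕ → 𝓢(ℝ, ℂ) := fun n => 𝓕 (schwartzConv ψ (dyadicDilation n Θ)) with hFdef
  have hF : ∀ n ξ, F n ξ = 𝓕 ψ ξ * 𝓕 Θ ((2 ^ n)⁻¹ * ξ) := by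
    intro n ξ
    rw [hFdef]
    simp only [fourier_schwartzConv, fourier_dyadicDilation, zpow_neg, zpow_natCast]
  suffices h : Tendsto F atTop (𝓝 (𝓕 ψ)) by
    have := ((FourierTransform.fourierInvCLM ℂ 𝓢(ℝ, ℂ)).continuous.tendsto _).comp h
    simpa [Function.comp_def, hFdef] using this
  rw [(schwartz_withSeminorms ℂ ℝ ℂ).tendsto_nhds]
  rintro ⟨k, l⟩ ε hε
  obtain ⟨M, hM0, hM⟩ := seminorm_truncation_le (𝓕 ψ) (𝓕 Θ) (k + 1) l
  set M' := M + SchwartzMap.seminorm ℂ (k + 1) l (𝓕 ψ)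
  have hM' : 0 ≤ M' := by positivity
  have hlim : Tendsto (fun n : ℕ => (1 / 2 : ℝ) ^ n * M') atTop (𝓝 0) := by
    simpa using (tendsto_pow_atTop_nhds_zero_of_lt_one (by norm_num : (0 : ℝ) ≤ 1 / 2)
      (by norm_num)).mul_const M'
  filter_upwards [hlim.eventually_lt_const hε] with n hn
  refine lt_of_le_of_lt ?_ hn
  rw [SchwartzMap.schwartzSeminormFamily_apply]
  refine SchwartzMap.seminorm_le_bound' ℂ k l _ (by positivity) fun ξ => ?_
  have h2n : (0 : ℝ) < 2 ^ n := by positivity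
  rcases lt_or_ge |ξ| (2 ^ n) with hξ | hξ
  · have hz : ((F n - 𝓕 ψ : 𝓢(ℝ, ℂ)) : ℝ → ℂ) =ᶠ[𝓝 ξ] fun _ => (0 : ℂ) := by
      have : IsOpen {ξ : ℝ | |ξ| < 2 ^ n} := isOpen_lt (by fun_prop) (by fun_prop)
      filter_upwards [this.mem_nhds hξ] with ζ hζ
      have hζ' : |(2 ^ n)⁻¹ * ζ| ≤ 1 := by
        rw [abs_mul, abs_of_pos (inv_pos.2 h2n), inv_mul_le_one₀ h2n]
        exact le_of_lt hζ
      rw [sub_apply, hF, hΘ _ hζ', mul_one, sub_self]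
    rw [hz.iteratedDeriv_eq l]
    have : iteratedDeriv l (fun _ : ℝ => (0 : ℂ)) ξ = 0 := by
      simp
    rw [this, norm_zero, mul_zero]
    positivity
  · have h1 := hM n (F n) (hF n) ξ
    have h2 := SchwartzMap.le_seminorm' ℂ (k + 1) l (𝓕 ψ) ξ
    have h3 : iteratedDeriv l (F n - 𝓕 ψ : 𝓢(ℝ, ℂ)) ξ =
        iteratedDeriv l (F n) ξ - iteratedDeriv l (𝓕 ψ : 𝓢(ℝ, ℂ)) ξ := by
      have := iteratedDeriv_sub (n := l) (x := ξ) ((F n).smooth l).contDiffAt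
        ((𝓕 ψ : 𝓢(ℝ, ℂ)).smooth l).contDiffAt
      exact this
    rw [h3]
    calc _ = (1 / 2 : ℝ) ^ n * (2 ^ n * (|ξ| ^ k *
          ‖iteratedDeriv l (F n) ξ - iteratedDeriv l (𝓕 ψ : 𝓢(ℝ, ℂ)) ξ‖)) := by
          rw [← mul_assoc, ← mul_pow]; norm_num
      _ ≤ (1 / 2 : ℝ) ^ n * (|ξ| * (|ξ| ^ k *
          (‖iteratedDeriv l (F n) ξ‖ + ‖iteratedDeriv l (𝓕 ψ : 𝓢(ℝ, ℂ)) ξ‖))) := by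
          gcongr; exact norm_sub_le _ _
      _ = (1 / 2 : ℝ) ^ n * (|ξ| ^ (k + 1) * ‖iteratedDeriv l (F n) ξ‖ +
          |ξ| ^ (k + 1) * ‖iteratedDeriv l (𝓕 ψ : 𝓢(ℝ, ℂ)) ξ‖) := by ring
      _ ≤ _ := mul_le_mul_of_nonneg_left (add_le_add h1 h2) (by positivity)

/-! ### Pointwise bounds by Cauchy kernels -/

theorem exists_norm_le_cauchyKernel_one (f : 𝓢(ℝ, ℂ)) :
    ∃ C : ℝ, 0 ≤ C ∧ ∀ x, ‖f x‖ ≤ C * cauchyKernel 1 x := by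
  refine ⟨SchwartzMap.seminorm ℂ 0 0 f + SchwartzMap.seminorm ℂ 2 0 f, by positivity, fun x => ?_⟩
  have h0 := SchwartzMap.norm_le_seminorm ℂ f x
  have h2 := SchwartzMap.norm_pow_mul_le_seminorm ℂ f 2 x
  rw [Real.norm_eq_abs, sq_abs] at h2
  unfold cauchyKernel
  rw [mul_one_div, le_div_iff₀ (by positivity)]
  linarith

/-- Dilations of a Schwartz function are dominated by Cauchy kernels of the same scale. -/
theorem exists_norm_dyadicDilation_le (f : 𝓢(ℝ, ℂ)) :
    ∃ C : ℝ, 0 ≤ C ∧ ∀ (n : ℤ) (x : ℝ),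
      ‖dyadicDilation n f x‖ ≤ C * cauchyKernel (2 ^ (-n)) x := by
  obtain ⟨C, hC0, hC⟩ := exists_norm_le_cauchyKernel_one f
  refine ⟨C, hC0, fun n x => ?_⟩
  rw [dyadicDilation_apply, norm_mul, cauchyKernel_eq (by positivity : (0 : ℝ) < 2 ^ (-n)),
    zpow_neg, inv_inv, norm_zpow, Complex.norm_ofNat]
  calc _ ≤ (2 : ℝ) ^ n * (C * cauchyKernel 1 (2 ^ n * x)) := by gcongr; exact hC _
    _ = _ := by ring

/-- For shifts of bounded size, the mean value theorem does not spoil the decay at infinity. -/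
theorem exists_norm_sub_translate_le (f : 𝓢(ℝ, ℂ)) :
    ∃ C : ℝ, 0 ≤ C ∧ ∀ y h : ℝ, |h| ≤ 2 → ‖f (y - h) - f y‖ ≤ C * |h| * cauchyKernel 1 y := by
  obtain ⟨C, hC0, hC⟩ := exists_norm_le_cauchyKernel_one (SchwartzMap.derivCLM ℂ ℂ f)
  refine ⟨9 * C, by positivity, fun y h hh => ?_⟩
  have hs : Convex ℝ {z : ℝ | |z - y| ≤ 2} := by
    have := convex_closedBall y (2 : ℝ)
    simpa [Metric.closedBall, Real.dist_eq] using this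
  have := Convex.norm_image_sub_le_of_norm_hasDerivWithin_le (f := f) (f' := fun z => deriv f z)
    (s := {z : ℝ | |z - y| ≤ 2}) (C := 9 * C * cauchyKernel 1 y) (x := y) (y := y - h)
    (fun z _ => (f.hasDerivAt z).hasDerivWithinAt) ?_ hs (by simp) (by simpa using hh)
  · refine this.trans (le_of_eq ?_)
    rw [sub_sub_cancel_left, norm_neg, Real.norm_eq_abs]; ring
  · intro z hz
    have hz' : |z - y| ≤ 2 := hz
    have h1 := hC z
    rw [SchwartzMap.derivCLM_apply] at h1
    refine h1.trans ?_
    rw [mul_comm 9 C, mul_assoc]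
    gcongr
    unfold cauchyKernel
    rw [mul_one_div, div_le_div_iff₀ (by positivity) (by positivity)]
    have := abs_le.1 hz'
    nlinarith [sq_nonneg (z + y), sq_nonneg (2 * z - y), sq_nonneg (z - y),
      mul_nonneg (sub_nonneg.2 this.1) (sub_nonneg.2 this.2)]

theorem integral_norm_dyadicDilation (n : ℤ) (f : 𝓢(ℝ, ℂ)) :
    ∫ x, ‖dyadicDilation n f x‖ = ∫ x, ‖f x‖ := by
  have h2 : (0 : ℝ) < 2 ^ n := by positivity
  simp_rw [dyadicDilation_apply, norm_mul]
  rw [integral_const_mul, Measure.integral_comp_mul_left (fun x => ‖f x‖),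
    abs_of_pos (inv_pos.2 h2), norm_zpow, Complex.norm_ofNat, smul_eq_mul, ← mul_assoc,
    mul_inv_cancel₀ h2.ne', one_mul]

/-- Averaging a dilate of `Θ` against a bump at a smaller scale changes it little. -/
theorem exists_norm_schwartzConv_dyadicDilation_sub_le {η : 𝓢(ℝ, ℂ)} (hη : ∫ x, η x = 1)
    (hη0 : ∀ x, 1 < |x| → η x = 0) (Θ : 𝓢(ℝ, ℂ)) :
    ∃ C : ℝ, 0 ≤ C ∧ ∀ (m j : ℤ), m + j ≤ 1 → ∀ x : ℝ,
      ‖schwartzConv (dyadicDilation (-j) η) (dyadicDilation m Θ) x - dyadicDilation m Θ x‖ ≤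
        C * 2 ^ (m + j) * cauchyKernel (2 ^ (-m)) x := by
  obtain ⟨C, hC0, hC⟩ := exists_norm_sub_translate_le Θ
  have hI : 0 ≤ ∫ x, ‖η x‖ := integral_nonneg fun x => norm_nonneg _
  refine ⟨(∫ x, ‖η x‖) * C, by positivity, fun m j hmj x => ?_⟩
  set ηj := dyadicDilation (-j) η
  set c := dyadicDilation m Θ
  have hm : (0 : ℝ) < 2 ^ m := by positivity
  have hK := cauchyKernel_nonneg (by positivity : (0 : ℝ) < 2 ^ (-m)) x
  have e : schwartzConv ηj c x - c x = ∫ t, ηj t * (c (x - t) - c x) := by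
    have h1 : Integrable fun t => ηj t * c (x - t) := by
      refine (ηj.integrable.bdd_mul (c.continuous.comp (by fun_prop :
        Continuous fun t : ℝ => x - t)).aestronglyMeasurable
        (c := SchwartzMap.seminorm ℂ 0 0 c) (Eventually.of_forall fun t =>
        SchwartzMap.norm_le_seminorm ℂ c _)).congr (Eventually.of_forall fun t => ?_)
      simp [mul_comm]
    have h2 : Integrable fun t => ηj t * c x := ηj.integrable.mul_const _
    simp_rw [mul_sub]
    rw [integral_sub h1 h2, schwartzConv_apply, integral_mul_const, integral_dyadicDilation, hη,
      one_mul]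
  rw [e]
  have hb : ∀ t, ‖ηj t * (c (x - t) - c x)‖ ≤
      ‖ηj t‖ * (C * 2 ^ (m + j) * cauchyKernel (2 ^ (-m)) x) := by
    intro t
    rw [norm_mul]
    by_cases ht : 1 < |2 ^ (-j) * t|
    · have : ηj t = 0 := by
        simp only [ηj, dyadicDilation_apply, hη0 _ ht, mul_zero]
      simp [this]
    · push Not at ht
      gcongr
      have ht' : |2 ^ m * t| ≤ 2 ^ (m + j) := by
        have : (2 : ℝ) ^ m * t = 2 ^ (m + j) * (2 ^ (-j) * t) := by
          rw [zpow_add₀ two_ne_zero, zpow_neg]; field_simp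
        rw [this, abs_mul, abs_of_pos (by positivity)]
        exact mul_le_of_le_one_right (by positivity) ht
      have h2 : |2 ^ m * t| ≤ 2 := by
        refine ht'.trans ?_
        calc (2 : ℝ) ^ (m + j) ≤ 2 ^ (1 : ℤ) := zpow_le_zpow_right₀ (by norm_num) hmj
          _ = 2 := by norm_num
      have h := hC (2 ^ m * x) (2 ^ m * t) h2
      have e : c (x - t) - c x = (2 : ℂ) ^ m * (Θ (2 ^ m * x - 2 ^ m * t) - Θ (2 ^ m * x)) := by
        simp only [c, dyadicDilation_apply]
        rw [mul_sub (2 ^ m : ℝ)]; ring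
      rw [e, norm_mul, cauchyKernel_eq (by positivity : (0 : ℝ) < 2 ^ (-m)), zpow_neg, inv_inv,
        norm_zpow, Complex.norm_ofNat]
      have hK' := cauchyKernel_nonneg one_pos (2 ^ m * x)
      calc _ ≤ (2 : ℝ) ^ m * (C * 2 ^ (m + j) * cauchyKernel 1 (2 ^ m * x)) := by
            gcongr; exact h.trans (by gcongr)
        _ = _ := by ring
  refine (norm_integral_le_of_norm_le (ηj.integrable.norm.mul_const _)
    (Eventually.of_forall hb)).trans (le_of_eq ?_)
  rw [integral_mul_const, integral_norm_dyadicDilation]; ring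

/-! ### Littlewood-Paley sequences -/

section LittlewoodPaley

variable {φ : ℕ → 𝓢(ℝ, ℂ)}

/-- The reflection `y ↦ φ_k(-y)` of a Littlewood-Paley function, so that
`φ_k * g (x) = ⟨g, lpAtom φ k (· - x)⟩`. -/
def lpAtom (φ : ℕ → 𝓢(ℝ, ℂ)) (k : ℕ) : 𝓢(ℝ, ℂ) := reflectTranslate (φ k) 0

/-- The kernel `2ⁿ φ₀(-2ⁿ ·)` of the low-frequency truncation `∑_{k ≤ n} φ_k * ·`. -/
def lpTruncation (φ : ℕ → 𝓢(ℝ, ℂ)) (n : ℕ) : 𝓢(ℝ, ℂ) := dyadicDilation n (lpAtom φ 0)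

theorem conv_eq_apply_translate {X : Type*} [NormedAddCommGroup X] [NormedSpace ℂ X]
    (g : 𝓢'(ℝ, X)) (k : ℕ) (x : ℝ) : conv (φ k) g x = g (translate x (lpAtom φ k)) := by
  rw [conv, reflectTranslate_eq_translate]; rfl

theorem fourier_lpTruncation (n : ℕ) (ξ : ℝ) :
    𝓕 (lpTruncation φ n) ξ = 𝓕 (φ 0) (-(ξ / 2 ^ n)) := by
  rw [lpTruncation, fourier_dyadicDilation, lpAtom, fourier_reflectTranslate_zero]
  congr 1
  rw [zpow_neg, zpow_natCast]; ring

theorem IsLittlewoodPaley.sum_lpAtom (hφ : IsLittlewoodPaley φ) (n : ℕ) :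
    ∑ k ∈ Finset.range (n + 1), lpAtom φ k = lpTruncation φ n := by
  induction n with
  | zero =>
    ext x
    simp [lpTruncation, dyadicDilation_apply]
  | succ n ih =>
    rw [Finset.sum_range_succ, ih]
    refine schwartzMap_ext_fourier fun ξ => ?_
    rw [FourierTransform.fourier_add, add_apply, fourier_lpTruncation,
      fourier_lpTruncation, lpAtom, fourier_reflectTranslate_zero]
    have : 𝓕 (φ (n + 1)) (-ξ) = 𝓕 (φ 1) (-ξ / 2 ^ n) := by
      rcases Nat.eq_zero_or_pos n with rfl | hn
      · simp
      · have := hφ.step (n + 1) (by omega) (-ξ)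
        simpa using this
    rw [this, hφ.one]
    rw [neg_div, neg_div, div_div, ← pow_succ]
    ring

/-- Truncation reproduces the lower blocks: for `j < n` the Fourier transform of `φ_j` lives where that
of the truncation kernel is `1`. -/
theorem IsLittlewoodPaley.schwartzConv_lpAtom (hφ : IsLittlewoodPaley φ) {j n : ℕ} (h : j < n) :
    schwartzConv (lpTruncation φ n) (lpAtom φ j) = lpAtom φ j := by
  refine schwartzMap_ext_fourier fun ξ => ?_
  rw [fourier_schwartzConv, fourier_lpTruncation]
  rcases le_or_gt |ξ| (2 ^ n) with hξ | hξ
  · rw [hφ.eq_one, one_mul]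
    rw [abs_neg, abs_div, abs_of_pos (by positivity : (0 : ℝ) < 2 ^ n)]
    exact div_le_one_of_le₀ hξ (by positivity)
  · have h2 : (0 : ℝ) < 2 ^ j := by positivity
    have hjn : (2 : ℝ) * 2 ^ j ≤ 2 ^ n := by
      rw [← pow_succ']; exact pow_le_pow_right₀ (by norm_num) h
    have hz : 𝓕 (lpAtom φ j) ξ = 0 := by
      rw [lpAtom, fourier_reflectTranslate_zero]
      have hlow : 𝓕 (φ 0) (-ξ / 2 ^ j) = 0 := by
        refine hφ.eq_zero _ ?_
        rw [abs_div, abs_neg, abs_of_pos h2, le_div_iff₀ h2]; linarith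
      rcases j with _ | j
      · simpa using hlow
      · have h2' : (0 : ℝ) < 2 ^ j := by positivity
        have : 𝓕 (φ (j + 1)) (-ξ) = 𝓕 (φ 1) (-ξ / 2 ^ j) := by
          rcases Nat.eq_zero_or_pos j with rfl | hn
          · simp
          · simpa using hφ.step (j + 1) (by omega) (-ξ)
        rw [this, hφ.one, div_div, ← pow_succ, hlow, hφ.eq_zero, sub_zero]
        rw [abs_div, abs_neg, abs_of_pos h2', le_div_iff₀ h2']
        rw [pow_succ] at hjn
        linarith
    rw [hz, mul_zero]

theorem IsLittlewoodPaley.tendsto_schwartzConv_lpTruncation (hφ : IsLittlewoodPaley φ)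
    (ψ : 𝓢(ℝ, ℂ)) : Tendsto (fun n => schwartzConv ψ (lpTruncation φ n)) atTop (𝓝 ψ) := by
  refine tendsto_schwartzConv_dyadicDilation (fun ξ hξ => ?_) ψ
  rw [lpAtom, fourier_reflectTranslate_zero]
  exact hφ.eq_one _ (by rwa [abs_neg])

end LittlewoodPaley

/-! ### A bump on the positive half-line -/

theorem exists_bump : ∃ η : 𝓢(ℝ, ℂ), (∫ x, η x = 1) ∧ ∀ x, x ∉ Ioc (1 / 2 : ℝ) 1 → η x = 0 := by
  let b : ContDiffBump (3 / 4 : ℝ) := ⟨1 / 8, 1 / 4, by norm_num, by norm_num⟩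
  let f : ℝ → ℂ := fun x => (b.normed volume x : ℂ)
  have hsm : ContDiff ℝ (⊤ : ℕ∞) f := Complex.ofRealCLM.contDiff.comp b.contDiff_normed
  have hz : ∀ x, x ∉ Ioo (1 / 2 : ℝ) 1 → f x = 0 := by
    intro x hx
    have : x ∉ Function.support (b.normed volume) := by
      rw [b.support_normed_eq]
      intro h
      apply hx
      have h' : |x - 3 / 4| < 1 / 4 := by simpa [Real.dist_eq, b] using h
      rw [abs_lt] at h'
      constructor <;> linarith [h'.1, h'.2]
    simp only [Function.mem_support, not_not] at this
    simp [f, this]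
  have hcs : HasCompactSupport f := HasCompactSupport.of_support_subset_isCompact
    (isCompact_Icc (a := (1 / 2 : ℝ)) (b := 1)) fun x hx => by
      by_contra h
      exact hx (hz x fun h' => h ⟨h'.1.le, h'.2.le⟩)
  refine ⟨hcs.toSchwartzMap hsm, ?_, fun x hx => hz x fun h => hx ⟨h.1, h.2.le⟩⟩
  change ∫ x, f x = 1
  simp only [f]
  rw [integral_complex_ofReal, b.integral_normed, Complex.ofReal_one]

/-- A fixed Schwartz function of integral `1` supported in `[1/2, 1]`. -/
def bump : 𝓢(ℝ, ℂ) := exists_bump.choose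

theorem integral_bump : ∫ x, bump x = 1 := exists_bump.choose_spec.1

theorem bump_eq_zero {x : ℝ} (hx : x ∉ Ioc (1 / 2 : ℝ) 1) : bump x = 0 :=
  exists_bump.choose_spec.2 x hx

/-- The bump at scale `2ʲ`: it has integral `1` and lives on `[2ʲ⁻¹, 2ʲ]`. -/
def bumpAt (j : ℤ) : 𝓢(ℝ, ℂ) := dyadicDilation (-j) bump

theorem integral_bumpAt (j : ℤ) : ∫ x, bumpAt j x = 1 := by
  rw [bumpAt, integral_dyadicDilation, integral_bump]

theorem bumpAt_eq_zero {j : ℤ} {x : ℝ} (hx : x ∉ Ioc ((2 : ℝ) ^ (j - 1)) (2 ^ j)) :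
    bumpAt j x = 0 := by
  rw [bumpAt, dyadicDilation_apply, bump_eq_zero, mul_zero]
  intro h
  apply hx
  have h2 : (0 : ℝ) < 2 ^ j := by positivity
  rw [zpow_neg, mem_Ioc, lt_inv_mul_iff₀ h2, inv_mul_le_iff₀ h2, mul_one] at h
  rw [zpow_sub_one₀ two_ne_zero, mem_Ioc]
  exact ⟨by linarith [h.1], h.2⟩

theorem tsupport_bumpAt_subset (j : ℤ) : tsupport (bumpAt j) ⊆ Icc ((2 : ℝ) ^ (j - 1)) (2 ^ j) := by
  refine closure_minimal (fun x hx => ?_) isClosed_Icc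
  by_contra h
  exact hx (bumpAt_eq_zero fun h' => h (Ioc_subset_Icc_self h'))

theorem tsupport_bumpAt_subset_Ioi (j : ℤ) : tsupport (bumpAt j) ⊆ Ioi 0 :=
  (tsupport_bumpAt_subset j).trans fun _ hx => lt_of_lt_of_le (by positivity) hx.1

theorem hasCompactSupport_bumpAt (j : ℤ) : HasCompactSupport (bumpAt j) :=
  HasCompactSupport.of_support_subset_isCompact isCompact_Icc
    ((subset_tsupport _).trans (tsupport_bumpAt_subset j))

theorem exists_norm_bumpAt_le : ∃ M : ℝ≥0, ∀ (j : ℤ) (x : ℝ), ‖bumpAt j x‖ₑ ≤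
    M * ENNReal.ofReal (2 ^ (-j)) := by
  refine ⟨Real.toNNReal (SchwartzMap.seminorm ℂ 0 0 bump), fun j x => ?_⟩
  have := SchwartzMap.norm_le_seminorm ℂ bump (2 ^ (-j) * x)
  rw [bumpAt, dyadicDilation_apply, enorm_mul, mul_comm]
  gcongr
  · rw [← ofReal_norm]; exact ENNReal.ofReal_le_ofReal this
  · rw [← ofReal_norm, norm_zpow, Complex.norm_ofNat]

/-! ### The blocks of a tempered distribution at the origin -/

section Blocks

variable {X : Type*} [NormedAddCommGroup X] [NormedSpace ℂ X]
variable {φ : ℕ → 𝓢(ℝ, ℂ)} {s p γ : ℝ}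

theorem continuous_conv (k : ℕ) (g : 𝓢'(ℝ, X)) : Continuous (conv (φ k) g) := by
  have : conv (φ k) g = fun x => g (translate x (lpAtom φ k)) :=
    funext fun x => conv_eq_apply_translate g k x
  rw [this]
  exact continuous_apply_translate g _

/-- The `k`-th term `2^{sk} ‖φ_k * g‖_{L^p(|x|^γ)}` of the Littlewood-Paley norm. -/
def blockNorm (φ : ℕ → 𝓢(ℝ, ℂ)) (s p γ : ℝ) (g : 𝓢'(ℝ, X)) (k : ℕ) : ℝ≥0∞ :=
  ENNReal.ofReal ((2 : ℝ) ^ (s * k)) * weightedLpNorm univ p γ (conv (φ k) g)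

theorem weightedLpNorm_rpow {Y : Type*} [NormedAddCommGroup Y] (hp : 0 < p) (I : Set ℝ)
    (f : ℝ → Y) :
    weightedLpNorm I p γ f ^ p = ∫⁻ x in I, ‖f x‖ₑ ^ p * ENNReal.ofReal (|x| ^ γ) := by
  rw [weightedLpNorm, ← ENNReal.rpow_mul, one_div, inv_mul_cancel₀ hp.ne', ENNReal.rpow_one]

/-- For equal exponents the norm of `F^s_{p,p}` is the `ℓ^p`-sum of the block norms. -/
theorem normF_rpow (hp : 1 < p) (g : 𝓢'(ℝ, X)) :
    normF φ s p p γ g ^ p = ∑' k, blockNorm φ s p γ g k ^ p := by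
  have hp0 : 0 < p := by linarith
  rw [normF, ← ENNReal.rpow_mul, one_div, inv_mul_cancel₀ hp0.ne', ENNReal.rpow_one,
    div_self hp0.ne']
  have hm : ∀ k, Measurable fun x => ‖conv (φ k) g x‖ₑ := fun k =>
    (continuous_conv k g).enorm.measurable
  simp_rw [ENNReal.rpow_one, ← ENNReal.tsum_mul_right]
  rw [lintegral_tsum fun k => by have := hm k; fun_prop]
  congr with k
  rw [blockNorm, ENNReal.mul_rpow_of_nonneg _ _ hp0.le, weightedLpNorm_rpow hp0,
    Measure.restrict_univ, ← lintegral_const_mul _ (by have := hm k; fun_prop)]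
  refine lintegral_congr fun x => ?_
  rw [ENNReal.mul_rpow_of_nonneg _ _ hp0.le, mul_assoc]

theorem blockNorm_le_normF (hp : 1 < p) (g : 𝓢'(ℝ, X)) (k : ℕ) :
    blockNorm φ s p γ g k ≤ normF φ s p p γ g := by
  have hp0 : 0 < p := by linarith
  refine (ENNReal.rpow_le_rpow_iff hp0).1 ?_
  rw [normF_rpow hp]
  exact ENNReal.le_tsum k

/-- Hölder's inequality for a density that is dominated by a Cauchy kernel. -/
theorem enorm_integral_smul_le_of_cauchyKernel (hp : 1 < p) (hγ : γ ∈ Ioo (-1 : ℝ) (p - 1)) :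
    ∃ C : ℝ≥0, ∀ (f : ℝ → X), Continuous f → ∀ (ψ : ℝ → ℂ) (M a : ℝ), 0 < a →
      (∀ x, ‖ψ x‖ ≤ M * cauchyKernel a x) →
      ‖∫ x, ψ x • f x‖ₑ ≤
        C * ENNReal.ofReal M * ENNReal.ofReal (a ^ (-((1 + γ) / p))) * weightedLpNorm univ p γ f := by
  obtain ⟨C, hC⟩ := lintegral_cauchyKernel_mul_le hp hγ
  refine ⟨C, fun f hf ψ M a ha hψ => ?_⟩
  have hfm : Measurable fun x => ‖f x‖ₑ := hf.enorm.measurable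
  calc ‖∫ x, ψ x • f x‖ₑ ≤ ∫⁻ x, ‖ψ x • f x‖ₑ := enorm_integral_le_lintegral_enorm _
    _ ≤ ∫⁻ x, ENNReal.ofReal M * (ENNReal.ofReal (cauchyKernel a x) * ‖f x‖ₑ) := by
        refine lintegral_mono fun x => ?_
        rw [enorm_smul, ← mul_assoc, ← ENNReal.ofReal_mul' (cauchyKernel_nonneg ha x)]
        gcongr
        rw [← ofReal_norm]
        exact ENNReal.ofReal_le_ofReal (hψ x)
    _ = ENNReal.ofReal M * ∫⁻ x, ENNReal.ofReal (cauchyKernel a x) * ‖f x‖ₑ :=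
        lintegral_const_mul _ (by fun_prop)
    _ ≤ ENNReal.ofReal M * (C * ENNReal.ofReal (a ^ (-((1 + γ) / p))) *
          weightedLpNorm univ p γ f) := by
        gcongr
        rw [weightedLpNorm, Measure.restrict_univ]
        exact hC a ha _ hfm
    _ = _ := by ring

theorem apply_schwartzConv_lpAtom [CompleteSpace X] (g : 𝓢'(ℝ, X)) (ψ : 𝓢(ℝ, ℂ)) (k : ℕ) :
    g (schwartzConv ψ (lpAtom φ k)) = ∫ x, ψ x • conv (φ k) g x := by
  simp_rw [apply_schwartzConv, conv_eq_apply_translate]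

theorem rpow_dyadic_eq (k : ℤ) (e : ℝ) : ((2 : ℝ) ^ (-k)) ^ (-e) = 2 ^ (e * k) := by
  rw [← Real.rpow_intCast, ← Real.rpow_mul (by norm_num)]
  congr 1; push_cast; ring

theorem two_rpow_mul_weightedLpNorm (g : 𝓢'(ℝ, X)) (e : ℝ) (k : ℕ) :
    ENNReal.ofReal ((2 : ℝ) ^ (e * k)) * weightedLpNorm univ p γ (conv (φ k) g) =
      ENNReal.ofReal ((2 : ℝ) ^ (-((s - e) * k))) * blockNorm φ s p γ g k := by
  rw [blockNorm, ← mul_assoc, ← ENNReal.ofReal_mul (by positivity),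
    ← Real.rpow_add (by norm_num)]
  congr 3; ring

variable [CompleteSpace X]

/-- Point evaluation of a block at `0`: the block reproduces itself under a kernel at scale
`2⁻ᵏ`, so Hölder's inequality with the dual weight applies. -/
theorem exists_enorm_apply_lpAtom_le (hφ : IsLittlewoodPaley φ) (hp : 1 < p)
    (hγ : γ ∈ Ioo (-1 : ℝ) (p - 1)) (s : ℝ) :
    ∃ C : ℝ≥0, ∀ (g : 𝓢'(ℝ, X)) (k : ℕ), ‖g (lpAtom φ k)‖ₑ ≤
      C * (ENNReal.ofReal ((2 : ℝ) ^ (-((s - (1 + γ) / p) * k))) * blockNorm φ s p γ g k) := by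
  obtain ⟨C, hC⟩ := enorm_integral_smul_le_of_cauchyKernel (X := X) hp hγ
  obtain ⟨M, hM0, hM⟩ := exists_norm_dyadicDilation_le (lpAtom φ 0)
  refine ⟨C * M.toNNReal * ((2 : ℝ) ^ ((1 + γ) / p)).toNNReal, fun g k => ?_⟩
  have h := hC _ (continuous_conv (φ := φ) k g) (lpTruncation φ (k + 1)) M (2 ^ (-(k + 1 : ℤ)))
    (by positivity) (fun x => by simpa [lpTruncation] using hM (k + 1) x)
  rw [← apply_schwartzConv_lpAtom, hφ.schwartzConv_lpAtom (Nat.lt_succ_self k),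
    rpow_dyadic_eq] at h
  rw [← two_rpow_mul_weightedLpNorm]
  refine h.trans (le_of_eq ?_)
  push_cast
  rw [mul_add, mul_one, Real.rpow_add (by norm_num), ENNReal.ofReal_mul (by positivity)]
  simp only [ENNReal.ofReal]
  ring

/-- The average of a block at scale `2ʲ` differs little from its value at `0` when `2ʲ` is small compared
with the scale `2⁻ᵏ` of the block. -/
theorem exists_enorm_apply_bumpAt_sub_le (hφ : IsLittlewoodPaley φ) (hp : 1 < p)
    (hγ : γ ∈ Ioo (-1 : ℝ) (p - 1)) (s : ℝ) :
    ∃ C : ℝ≥0, ∀ (g : 𝓢'(ℝ, X)) (k : ℕ) (j : ℤ),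
      ‖g (schwartzConv (bumpAt j) (lpAtom φ k)) - g (lpAtom φ k)‖ₑ ≤
      C * (ENNReal.ofReal (min 1 (2 ^ (j + k))) *
        (ENNReal.ofReal ((2 : ℝ) ^ (-((s - (1 + γ) / p) * k))) * blockNorm φ s p γ g k)) := by
  obtain ⟨C, hC⟩ := enorm_integral_smul_le_of_cauchyKernel (X := X) hp hγ
  obtain ⟨C₁, hC₁⟩ := exists_enorm_apply_lpAtom_le (X := X) hφ hp hγ s
  obtain ⟨M, hM0, hM⟩ := exists_norm_dyadicDilation_le bump
  obtain ⟨N, hN0, hN⟩ := exists_norm_schwartzConv_dyadicDilation_sub_le integral_bump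
    (fun x hx => bump_eq_zero fun h => by
      rw [abs_of_pos (by linarith [h.1])] at hx; linarith [h.2]) (lpAtom φ 0)
  set e := (1 + γ) / p with he
  have he0 : 0 < e := by rw [he]; exact div_pos (by linarith [hγ.1]) (by linarith)
  refine ⟨C * M.toNNReal + C₁ + C * (N * 2).toNNReal * ((2 : ℝ) ^ e).toNNReal,
    fun g k j => ?_⟩
  rcases le_total 0 (j + k) with hjk | hjk
  · -- coarse scale: bound both terms separately
    have h1 : (1 : ℝ) ≤ 2 ^ (j + k) := one_le_zpow₀ (by norm_num) hjk
    rw [min_eq_left h1, ENNReal.ofReal_one, one_mul]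
    have hb := hC _ (continuous_conv (φ := φ) k g) (bumpAt j) M (2 ^ j) (by positivity)
      (fun x => by simpa [bumpAt] using hM (-j) x)
    rw [← apply_schwartzConv_lpAtom] at hb
    have hle : ((2 : ℝ) ^ j) ^ (-e) ≤ 2 ^ (e * k) := by
      have := rpow_dyadic_eq (-j) e
      rw [neg_neg] at this
      rw [this]
      refine Real.rpow_le_rpow_of_exponent_le (by norm_num) ?_
      have : (-j : ℝ) ≤ k := by exact_mod_cast (by omega : -j ≤ (k : ℤ))
      push_cast
      gcongr
    have hb' : ‖g (schwartzConv (bumpAt j) (lpAtom φ k))‖ₑ ≤ (C * M.toNNReal : ℝ≥0) *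
        (ENNReal.ofReal ((2 : ℝ) ^ (-((s - e) * k))) * blockNorm φ s p γ g k) := by
      rw [← two_rpow_mul_weightedLpNorm]
      refine hb.trans ?_
      push_cast
      rw [mul_assoc]
      gcongr
      rfl
    refine enorm_sub_le.trans ((add_le_add hb' (hC₁ g k)).trans ?_)
    rw [← add_mul]
    gcongr
    push_cast
    exact le_self_add
  · -- fine scale: the reproducing kernel is nearly constant on the support of the bump
    have h1 : (2 : ℝ) ^ (j + k) ≤ 1 := zpow_le_one_of_nonpos₀ (by norm_num) hjk
    rw [min_eq_right h1]
    have hrep : g (schwartzConv (bumpAt j) (lpAtom φ k)) - g (lpAtom φ k) =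
        ∫ x, (schwartzConv (bumpAt j) (lpTruncation φ (k + 1)) - lpTruncation φ (k + 1)) x •
          conv (φ k) g x := by
      rw [← apply_schwartzConv_lpAtom]
      have : schwartzConv (schwartzConv (bumpAt j) (lpTruncation φ (k + 1)) -
          lpTruncation φ (k + 1)) (lpAtom φ k) =
          schwartzConv (bumpAt j) (lpAtom φ k) - lpAtom φ k := by
        have h := hφ.schwartzConv_lpAtom (Nat.lt_succ_self k)
        have e1 : ∀ a b c : 𝓢(ℝ, ℂ), schwartzConv (a - b) c = schwartzConv a c - schwartzConv b c :=
          fun a b c => by simp [schwartzConv]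
        rw [e1, schwartzConv_assoc, h]
      rw [this, map_sub]
    have hb := hC _ (continuous_conv (φ := φ) k g)
      (schwartzConv (bumpAt j) (lpTruncation φ (k + 1)) - lpTruncation φ (k + 1) : 𝓢(ℝ, ℂ))
      (N * 2 ^ ((k + 1 : ℤ) + j)) (2 ^ (-(k + 1 : ℤ))) (by positivity) (fun x => by
        have := hN (k + 1) j (by omega) x
        simpa [lpTruncation, bumpAt] using this)
    rw [← hrep, rpow_dyadic_eq] at hb
    rw [← two_rpow_mul_weightedLpNorm]
    have e2 : N * 2 ^ ((k + 1 : ℤ) + j) = N * 2 * 2 ^ (j + k) := by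
      rw [show ((k : ℤ) + 1 + j) = 1 + (j + k) by ring, zpow_add₀ two_ne_zero (1 : ℤ), zpow_one]; ring
    rw [e2] at hb
    have e3 : ENNReal.ofReal ((2 : ℝ) ^ (e * ((k + 1 : ℤ) : ℝ))) =
        ENNReal.ofReal (2 ^ (e * k)) * ENNReal.ofReal (2 ^ e) := by
      rw [← ENNReal.ofReal_mul (by positivity), ← Real.rpow_add (by norm_num)]
      congr 2; push_cast; ring
    rw [e3, ENNReal.ofReal_mul (by positivity : 0 ≤ N * 2)] at hb
    refine hb.trans ?_
    calc _ = ((C * (N * 2).toNNReal * ((2 : ℝ) ^ e).toNNReal : ℝ≥0) : ℝ≥0∞) *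
          (ENNReal.ofReal (2 ^ (j + k)) * (ENNReal.ofReal (2 ^ (e * k)) *
            weightedLpNorm univ p γ (conv (φ k) g))) := by
          push_cast; simp only [ENNReal.ofReal]; ring
      _ ≤ _ := by gcongr; exact le_add_self

end Blocks

/-! ### The trace of a tempered distribution as the sum of its blocks at the origin -/

theorem summable_min_one_zpow_mul_rpow {ρ η : ℝ} (hρ : 1 < ρ) (hη0 : 0 < η) (hη1 : η < 1) :
    Summable fun i : ℤ => min 1 (ρ ^ i) * (ρ ^ i) ^ (-η) := by
  have hρ0 : 0 < ρ := by linarith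
  refine Summable.of_nat_of_neg ?_ ?_
  · have h : Summable fun n : ℕ => (ρ ^ (-η)) ^ n :=
      summable_geometric_of_lt_one (by positivity)
        (Real.rpow_lt_one_of_one_lt_of_neg hρ (by linarith))
    refine h.congr fun n => ?_
    rw [min_eq_left (one_le_zpow₀ hρ.le (by positivity)), one_mul, zpow_natCast,
      ← Real.rpow_natCast, ← Real.rpow_natCast, ← Real.rpow_mul hρ0.le, ← Real.rpow_mul hρ0.le,
      mul_comm]
  · have h : Summable fun n : ℕ => (ρ ^ (η - 1)) ^ n :=
      summable_geometric_of_lt_one (by positivity)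
        (Real.rpow_lt_one_of_one_lt_of_neg hρ (by linarith))
    refine h.congr fun n => ?_
    rw [min_eq_right (zpow_le_one_of_nonpos₀ hρ.le (by simp)), ← Real.rpow_intCast,
      ← Real.rpow_mul hρ0.le, ← Real.rpow_add hρ0, ← Real.rpow_natCast, ← Real.rpow_mul hρ0.le]
    congr 1; push_cast; ring

section Trace

variable {X : Type*} [NormedAddCommGroup X] [NormedSpace ℂ X]
variable {φ : ℕ → 𝓢(ℝ, ℂ)} {s p γ : ℝ}

/-- The value at the origin of a tempered distribution, computed as the sum of the values of its
Littlewood-Paley blocks. -/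
def traceOf (φ : ℕ → 𝓢(ℝ, ℂ)) (g : 𝓢'(ℝ, X)) : X := ∑' k, g (lpAtom φ k)

theorem tsum_ofReal_two_rpow_neg_lt_top {δ : ℝ} (hδ : 0 < δ) :
    ∑' k : ℕ, ENNReal.ofReal ((2 : ℝ) ^ (-(δ * k))) < ∞ := by
  have h : Summable fun n : ℕ => ((2 : ℝ) ^ (-δ)) ^ n :=
    summable_geometric_of_lt_one (by positivity)
      (Real.rpow_lt_one_of_one_lt_of_neg (by norm_num) (by linarith))
  refine Summable.tsum_ofReal_lt_top (h.congr fun n => ?_)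
  rw [← Real.rpow_natCast, ← Real.rpow_mul (by norm_num)]
  congr 1; ring

theorem tendsto_apply_lpTruncation (hφ : IsLittlewoodPaley φ) {g : 𝓢'(ℝ, X)}
    (hs : Summable fun k => g (lpAtom φ k)) :
    Tendsto (fun n => g (lpTruncation φ n)) atTop (𝓝 (traceOf φ g)) := by
  have := (tendsto_add_atTop_iff_nat 1).2 hs.hasSum.tendsto_sum_nat
  refine this.congr fun n => ?_
  rw [← hφ.sum_lpAtom, map_sum]

/-- Since `∑_{k ≤ n} φ_k * ψ → ψ` in the Schwartz space, `g ψ - traceOf φ g` may be computed blockwise. -/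
theorem enorm_apply_sub_traceOf_le (hφ : IsLittlewoodPaley φ) {g : 𝓢'(ℝ, X)}
    (hs : Summable fun k => g (lpAtom φ k)) (ψ : 𝓢(ℝ, ℂ)) :
    ‖g ψ - traceOf φ g‖ₑ ≤ ∑' k, ‖g (schwartzConv ψ (lpAtom φ k)) - g (lpAtom φ k)‖ₑ := by
  have h1 : Tendsto (fun n => g (schwartzConv ψ (lpTruncation φ n))) atTop (𝓝 (g ψ)) :=
    ((map_continuous g).tendsto ψ).comp (hφ.tendsto_schwartzConv_lpTruncation ψ)
  have h2 := (h1.sub (tendsto_apply_lpTruncation hφ hs)).enorm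
  refine le_of_tendsto h2 (Eventually.of_forall fun n => ?_)
  rw [← hφ.sum_lpAtom, schwartzConv_sum, map_sum, map_sum, ← Finset.sum_sub_distrib]
  exact (enorm_sum_le _ _).trans (ENNReal.sum_le_tsum _)

variable [CompleteSpace X]

theorem exists_tsum_enorm_apply_lpAtom_le (hφ : IsLittlewoodPaley φ) (hp : 1 < p)
    (hγ : γ ∈ Ioo (-1 : ℝ) (p - 1)) (hδ : 0 < s - (1 + γ) / p) :
    ∃ C : ℝ≥0, ∀ g : 𝓢'(ℝ, X), ∑' k, ‖g (lpAtom φ k)‖ₑ ≤ C * normF φ s p p γ g := by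
  obtain ⟨C, hC⟩ := exists_enorm_apply_lpAtom_le (X := X) hφ hp hγ s
  have hS := tsum_ofReal_two_rpow_neg_lt_top hδ
  refine ⟨C * (∑' k : ℕ, ENNReal.ofReal ((2 : ℝ) ^ (-((s - (1 + γ) / p) * k)))).toNNReal,
    fun g => ?_⟩
  rw [ENNReal.coe_mul, ENNReal.coe_toNNReal hS.ne, mul_assoc, ← ENNReal.tsum_mul_right,
    ← ENNReal.tsum_mul_left]
  refine ENNReal.tsum_le_tsum fun k => (hC g k).trans ?_
  gcongr
  exact blockNorm_le_normF hp g k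

theorem summable_apply_lpAtom (hφ : IsLittlewoodPaley φ) (hp : 1 < p)
    (hγ : γ ∈ Ioo (-1 : ℝ) (p - 1)) (hδ : 0 < s - (1 + γ) / p) {g : 𝓢'(ℝ, X)}
    (hg : normF φ s p p γ g < ∞) : Summable fun k => g (lpAtom φ k) := by
  obtain ⟨C, hC⟩ := exists_tsum_enorm_apply_lpAtom_le (X := X) hφ hp hγ hδ
  refine Summable.of_norm ?_
  have : ∑' k, ‖g (lpAtom φ k)‖ₑ ≠ ∞ :=
    ((hC g).trans_lt (ENNReal.mul_lt_top (by simp) hg)).ne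
  have := ENNReal.summable_toReal this
  simpa using this

theorem exists_enorm_apply_bumpAt_le (hφ : IsLittlewoodPaley φ) (hp : 1 < p)
    (hγ : γ ∈ Ioo (-1 : ℝ) (p - 1)) (hδ : 0 < s - (1 + γ) / p) :
    ∃ C : ℝ≥0, ∀ g : 𝓢'(ℝ, X), normF φ s p p γ g < ∞ → ∀ j,
      ‖g (bumpAt j)‖ₑ ≤ C * normF φ s p p γ g := by
  obtain ⟨C, hC⟩ := exists_enorm_apply_bumpAt_sub_le (X := X) hφ hp hγ s
  obtain ⟨C₁, hC₁⟩ := exists_tsum_enorm_apply_lpAtom_le (X := X) hφ hp hγ hδ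
  have hS := tsum_ofReal_two_rpow_neg_lt_top hδ
  refine ⟨C * (∑' k : ℕ, ENNReal.ofReal ((2 : ℝ) ^ (-((s - (1 + γ) / p) * k)))).toNNReal + C₁,
    fun g hg j => ?_⟩
  have hs := summable_apply_lpAtom hφ hp hγ hδ hg
  have h1 := enorm_apply_sub_traceOf_le hφ hs (bumpAt j)
  have h2 : ‖traceOf φ g‖ₑ ≤ C₁ * normF φ s p p γ g := enorm_tsum_le_tsum_enorm.trans (hC₁ g)
  have h3 : ∑' k, ‖g (schwartzConv (bumpAt j) (lpAtom φ k)) - g (lpAtom φ k)‖ₑ ≤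
      C * (∑' k : ℕ, ENNReal.ofReal ((2 : ℝ) ^ (-((s - (1 + γ) / p) * k)))) *
        normF φ s p p γ g := by
    rw [mul_assoc, ← ENNReal.tsum_mul_right, ← ENNReal.tsum_mul_left]
    refine ENNReal.tsum_le_tsum fun k => (hC g k j).trans (mul_le_mul' le_rfl ?_)
    refine (mul_le_of_le_one_left' ?_).trans (mul_le_mul' le_rfl (blockNorm_le_normF hp g k))
    rw [← ENNReal.ofReal_one]
    exact ENNReal.ofReal_le_ofReal (min_le_left _ _)
  calc ‖g (bumpAt j)‖ₑ = ‖(g (bumpAt j) - traceOf φ g) + traceOf φ g‖ₑ := by rw [sub_add_cancel]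
    _ ≤ ‖g (bumpAt j) - traceOf φ g‖ₑ + ‖traceOf φ g‖ₑ := enorm_add_le _ _
    _ ≤ _ := by
      rw [ENNReal.coe_add, ENNReal.coe_mul, ENNReal.coe_toNNReal hS.ne, add_mul]
      exact add_le_add (h1.trans h3) h2

/-- The averages of `g` at scale `2ʲ` converge to its trace at the rate `2^{δj}`, `δ = s - (1+γ)/p`,
in the `ℓ^p` sense. -/
theorem tsum_rpow_apply_bumpAt_sub_lt_top (hφ : IsLittlewoodPaley φ) (hp : 1 < p) (hs1 : s < 1)
    (hγ : γ ∈ Ioo (-1 : ℝ) (p - 1)) (hδ : 0 < s - (1 + γ) / p) {g : 𝓢'(ℝ, X)}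
    (hg : normF φ s p p γ g < ∞) :
    ∑' j : ℤ, (ENNReal.ofReal (((2 : ℝ) ^ j) ^ (-(s - (1 + γ) / p))) *
      ‖g (bumpAt j) - traceOf φ g‖ₑ) ^ p < ∞ := by
  obtain ⟨C, hC⟩ := exists_enorm_apply_bumpAt_sub_le (X := X) hφ hp hγ s
  have hp0 : 0 < p := by linarith
  set δ := s - (1 + γ) / p with hδd
  have hδ1 : δ < 1 := by
    have : 0 < (1 + γ) / p := div_pos (by linarith [hγ.1]) hp0
    linarith
  set κ : ℤ → ℝ≥0∞ := fun i => ENNReal.ofReal (min 1 ((2 : ℝ) ^ i) * ((2 : ℝ) ^ i) ^ (-δ)) with hκ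
  have hκS : ∑' i, κ i < ∞ :=
    (summable_min_one_zpow_mul_rpow (by norm_num) hδ hδ1).tsum_ofReal_lt_top
  have hterm : ∀ j : ℤ, ENNReal.ofReal (((2 : ℝ) ^ j) ^ (-δ)) * ‖g (bumpAt j) - traceOf φ g‖ₑ ≤
      C * ∑' k : ℕ, κ (j + k) * blockNorm φ s p γ g k := by
    intro j
    have h1 := (enorm_apply_sub_traceOf_le hφ (summable_apply_lpAtom hφ hp hγ hδ hg)
      (bumpAt j)).trans (ENNReal.tsum_le_tsum fun k => hC g k j)
    refine (mul_le_mul_right h1 _).trans (le_of_eq ?_)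
    rw [ENNReal.tsum_mul_left, mul_left_comm, ← ENNReal.tsum_mul_left]
    congr 2
    ext k
    have e : (((2 : ℝ) ^ (j + (k : ℤ))) ^ (-δ)) = ((2 : ℝ) ^ j) ^ (-δ) * 2 ^ (-(δ * k)) := by
      rw [zpow_add₀ two_ne_zero, Real.mul_rpow (by positivity) (by positivity), zpow_natCast,
        ← Real.rpow_natCast, ← Real.rpow_mul (by norm_num)]
      congr 2; ring
    simp only [hκ]
    rw [e, ENNReal.ofReal_mul (by positivity), ENNReal.ofReal_mul (by positivity)]
    ring
  calc _ ≤ ∑' j : ℤ, (C * ∑' k : ℕ, κ (j + k) * blockNorm φ s p γ g k) ^ p :=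
        ENNReal.tsum_le_tsum fun j => ENNReal.rpow_le_rpow (hterm j) hp0.le
    _ = C ^ p * ∑' j : ℤ, (∑' k : ℕ, κ (j + k) * blockNorm φ s p γ g k) ^ p := by
        simp_rw [ENNReal.mul_rpow_of_nonneg _ _ hp0.le, ENNReal.tsum_mul_left]
    _ ≤ C ^ p * ((∑' i, κ i) ^ (p - 1) * (∑' i, κ i) * ∑' k, blockNorm φ s p γ g k ^ p) := by
        gcongr
        refine tsum_rpow_le_of_schur hp (fun (j : ℤ) (k : ℕ) => κ (j + k)) _ (fun j => ?_)
          fun k => ?_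
        · exact ENNReal.tsum_comp_le_tsum_of_injective
            (f := fun k : ℕ => j + (k : ℤ)) (fun a b h => by simpa using h) κ
        · exact ENNReal.tsum_comp_le_tsum_of_injective
            (f := fun j : ℤ => j + (k : ℤ)) (fun a b h => by simpa using h) κ
    _ < ∞ := by
        rw [← normF_rpow hp]
        refine ENNReal.mul_lt_top (ENNReal.rpow_lt_top_of_nonneg hp0.le (by simp)) ?_
        exact ENNReal.mul_lt_top (ENNReal.mul_lt_top (ENNReal.rpow_lt_top_of_nonneg
          (by linarith) hκS.ne) hκS) (ENNReal.rpow_lt_top_of_nonneg hp0.le hg.ne)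

/-- A sequence with a finite weighted `ℓ^p` norm tends to zero at `-∞` when the weight blows up
there. -/
theorem tendsto_atBot_of_tsum_rpow_lt_top {δ : ℝ} (hδ : 0 < δ) (hp : 0 < p) {a : ℤ → ℝ≥0∞}
    (h : ∑' j : ℤ, (ENNReal.ofReal (((2 : ℝ) ^ j) ^ (-δ)) * a j) ^ p < ∞) :
    Tendsto a atBot (𝓝 0) := by
  set S := ∑' j : ℤ, (ENNReal.ofReal (((2 : ℝ) ^ j) ^ (-δ)) * a j) ^ p
  have hS : S ^ (1 / p) ≠ ∞ := (ENNReal.rpow_lt_top_of_nonneg (by positivity) h.ne).ne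
  have hb : ∀ j, a j ≤ ENNReal.ofReal (((2 : ℝ) ^ j) ^ δ) * S ^ (1 / p) := by
    intro j
    have h1 : ENNReal.ofReal (((2 : ℝ) ^ j) ^ (-δ)) * a j ≤ S ^ (1 / p) := by
      rw [one_div, ENNReal.le_rpow_inv_iff hp]
      exact ENNReal.le_tsum j
    calc a j = ENNReal.ofReal (((2 : ℝ) ^ j) ^ δ) *
          (ENNReal.ofReal (((2 : ℝ) ^ j) ^ (-δ)) * a j) := by
          rw [← mul_assoc, ← ENNReal.ofReal_mul (by positivity), ← Real.rpow_add (by positivity),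
            add_neg_cancel, Real.rpow_zero, ENNReal.ofReal_one, one_mul]
      _ ≤ _ := by gcongr
  have hlim : Tendsto (fun j : ℤ => ((2 : ℝ) ^ j) ^ δ) atBot (𝓝 0) := by
    have h2 : Tendsto (fun j : ℤ => (2 : ℝ) ^ j) atBot (𝓝 0) :=
      ((tendsto_rpow_atBot_of_base_gt_one (2 : ℝ) (by norm_num)).comp
        (tendsto_intCast_atBot_iff.2 tendsto_id)).congr fun j => Real.rpow_intCast 2 j
    have := h2.rpow_const (p := δ) (Or.inr hδ.le)
    rwa [Real.zero_rpow hδ.ne'] at this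
  have h3 : Tendsto (fun j : ℤ => ENNReal.ofReal (((2 : ℝ) ^ j) ^ δ) * S ^ (1 / p)) atBot (𝓝 0) := by
    have := ENNReal.Tendsto.mul_const (b := S ^ (1 / p)) (ENNReal.tendsto_ofReal hlim) (Or.inr hS)
    simpa using this
  exact tendsto_of_tendsto_of_tendsto_of_le_of_le tendsto_const_nhds h3 (fun _ => zero_le) hb

end Trace

/-! ### Low-frequency truncations are dense -/

section Truncation

variable {X : Type*} [NormedAddCommGroup X] [NormedSpace ℂ X]
variable {φ : ℕ → 𝓢(ℝ, ℂ)} {s p γ : ℝ}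

/-- The low-frequency truncation `∑_{k ≤ n} φ_k * g`, as a tempered distribution; since `lpTruncation`
is a reflected kernel, it acts on test functions by convolution with `lpTruncation`. -/
def truncate (φ : ℕ → 𝓢(ℝ, ℂ)) (n : ℕ) (g : 𝓢'(ℝ, X)) : 𝓢'(ℝ, X) :=
  PointwiseConvergenceCLM.precomp X
    (SchwartzMap.convolution (ContinuousLinearMap.mul ℂ ℂ) (lpTruncation φ n)) g

theorem truncate_apply (n : ℕ) (g : 𝓢'(ℝ, X)) (ψ : 𝓢(ℝ, ℂ)) :
    truncate φ n g ψ = g (schwartzConv (lpTruncation φ n) ψ) := rfl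

/-- The low-frequency truncation `∑_{k ≤ n} φ_k * g`, as a function. -/
def truncateFun (φ : ℕ → 𝓢(ℝ, ℂ)) (n : ℕ) (g : 𝓢'(ℝ, X)) (x : ℝ) : X :=
  g (translate x (lpTruncation φ n))

theorem continuous_truncateFun (n : ℕ) (g : 𝓢'(ℝ, X)) : Continuous (truncateFun φ n g) :=
  continuous_apply_translate g _

theorem truncateFun_zero (n : ℕ) (g : 𝓢'(ℝ, X)) :
    truncateFun φ n g 0 = g (lpTruncation φ n) := by
  simp [truncateFun, translate]

theorem conv_sub_truncate_eq_zero (hφ : IsLittlewoodPaley φ) {j n : ℕ} (h : j < n) (g : 𝓢'(ℝ, X))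
    (x : ℝ) : conv (φ j) (g - truncate φ n g) x = 0 := by
  rw [conv_eq_apply_translate]
  change g _ - truncate φ n g _ = 0
  rw [truncate_apply, translate_schwartzConv, hφ.schwartzConv_lpAtom h, sub_self]

theorem blockNorm_sub_truncate_eq_zero (hφ : IsLittlewoodPaley φ) (hp : 0 < p) {j n : ℕ}
    (h : j < n) (g : 𝓢'(ℝ, X)) : blockNorm φ s p γ (g - truncate φ n g) j = 0 := by
  have h0 : conv (φ j) (g - truncate φ n g) = fun _ => 0 :=
    funext fun x => conv_sub_truncate_eq_zero hφ h g x
  rw [blockNorm, weightedLpNorm, h0]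
  simp [ENNReal.zero_rpow_of_pos hp, hp]

theorem tsum_eq_tsum_nat_add_of_eq_zero {b : ℕ → ℝ≥0∞} {n : ℕ} (h : ∀ j < n, b j = 0) :
    ∑' j, b j = ∑' k, b (k + n) := by
  rw [← (ENNReal.summable (f := fun k => b (k + n))).sum_add_tsum_nat_add', Finset.sum_eq_zero fun j hj => h j (by simpa using hj),
    zero_add]

theorem blockNorm_sub_rpow_le (hp : 1 < p) (g g' : 𝓢'(ℝ, X)) (j : ℕ) :
    blockNorm φ s p γ (g - g') j ^ p ≤
      2 ^ (p - 1) * (blockNorm φ s p γ g j ^ p + blockNorm φ s p γ g' j ^ p) := by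
  have hp0 : 0 < p := by linarith
  have hf : Measurable fun x => ‖conv (φ j) g x‖ₑ := (continuous_conv j g).enorm.measurable
  have hf' : Measurable fun x => ‖conv (φ j) g' x‖ₑ := (continuous_conv j g').enorm.measurable
  have h : ∫⁻ x, ‖conv (φ j) (g - g') x‖ₑ ^ p * ENNReal.ofReal (|x| ^ γ) ≤
      2 ^ (p - 1) * ((∫⁻ x, ‖conv (φ j) g x‖ₑ ^ p * ENNReal.ofReal (|x| ^ γ)) +
        ∫⁻ x, ‖conv (φ j) g' x‖ₑ ^ p * ENNReal.ofReal (|x| ^ γ)) := by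
    rw [← lintegral_add_left (by fun_prop), ← lintegral_const_mul _ (by fun_prop)]
    refine lintegral_mono fun x => ?_
    rw [← add_mul, ← mul_assoc]
    gcongr
    exact (ENNReal.rpow_le_rpow enorm_sub_le hp0.le).trans
      (ENNReal.rpow_add_le_mul_rpow_add_rpow _ _ hp.le)
  simp only [blockNorm]
  simp_rw [ENNReal.mul_rpow_of_nonneg _ _ hp0.le, weightedLpNorm_rpow hp0,
    Measure.restrict_univ]
  rw [← mul_add, mul_left_comm]
  gcongr

variable [CompleteSpace X]

theorem conv_truncate (j n : ℕ) (g : 𝓢'(ℝ, X)) (x : ℝ) :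
    conv (φ j) (truncate φ n g) x = ∫ y, lpTruncation φ n (y - x) • conv (φ j) g y := by
  rw [conv_eq_apply_translate, truncate_apply, translate_schwartzConv,
    ← translate_schwartzConv_left, apply_schwartzConv_lpAtom]
  rfl

/-- Truncations are bounded on each block, uniformly in `n`: they are convolutions with kernels dominated
by Cauchy kernels. -/
theorem exists_blockNorm_truncate_rpow_le (hp : 1 < p) (hγ : γ ∈ Ioo (-1 : ℝ) (p - 1)) :
    ∃ C : ℝ≥0, ∀ (g : 𝓢'(ℝ, X)) (n j : ℕ), blockNorm φ s p γ (truncate φ n g) j ^ p ≤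
      C * blockNorm φ s p γ g j ^ p := by
  have hp0 : 0 < p := by linarith
  obtain ⟨C, hC⟩ := lintegral_rpow_cauchyKernel_conv_le hp hγ
  obtain ⟨M, hM0, hM⟩ := exists_norm_dyadicDilation_le (lpAtom φ 0)
  refine ⟨M.toNNReal ^ p * C, fun g n j => ?_⟩
  have hfm : Measurable fun y => ‖conv (φ j) g y‖ₑ := (continuous_conv j g).enorm.measurable
  have hK : ∀ x, Measurable fun y => ENNReal.ofReal (cauchyKernel (2 ^ (-n : ℤ)) (x - y)) := by
    intro x; fun_prop
  have hpt : ∀ x, ‖conv (φ j) (truncate φ n g) x‖ₑ ≤ M.toNNReal *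
      ∫⁻ y, ENNReal.ofReal (cauchyKernel (2 ^ (-n : ℤ)) (x - y)) * ‖conv (φ j) g y‖ₑ := by
    intro x
    rw [conv_truncate, ← lintegral_const_mul _ (by have := hK x; fun_prop)]
    refine (enorm_integral_le_lintegral_enorm _).trans (lintegral_mono fun y => ?_)
    rw [enorm_smul, ← mul_assoc]
    gcongr
    change _ ≤ ENNReal.ofReal M * _
    rw [← ENNReal.ofReal_mul hM0, ← cauchyKernel_neg, neg_sub, ← ofReal_norm]
    exact ENNReal.ofReal_le_ofReal (hM n (y - x))
  rw [blockNorm, blockNorm, ENNReal.mul_rpow_of_nonneg _ _ hp0.le,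
    ENNReal.mul_rpow_of_nonneg _ _ hp0.le, weightedLpNorm_rpow hp0, weightedLpNorm_rpow hp0,
    Measure.restrict_univ, mul_left_comm]
  gcongr
  calc _ ≤ ∫⁻ x, (M.toNNReal : ℝ≥0∞) ^ p *
        ((∫⁻ y, ENNReal.ofReal (cauchyKernel (2 ^ (-n : ℤ)) (x - y)) * ‖conv (φ j) g y‖ₑ) ^ p *
          ENNReal.ofReal (|x| ^ γ)) := by
        refine lintegral_mono fun x => ?_
        rw [← mul_assoc, ← ENNReal.mul_rpow_of_nonneg _ _ hp0.le]
        gcongr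
        exact hpt x
    _ = (M.toNNReal : ℝ≥0∞) ^ p * ∫⁻ x,
        ((∫⁻ y, ENNReal.ofReal (cauchyKernel (2 ^ (-n : ℤ)) (x - y)) * ‖conv (φ j) g y‖ₑ) ^ p *
          ENNReal.ofReal (|x| ^ γ)) :=
        lintegral_const_mul' _ _ (ENNReal.rpow_lt_top_of_nonneg hp0.le (by simp)).ne
    _ ≤ _ := by
        rw [ENNReal.coe_mul, ← ENNReal.coe_rpow_of_nonneg _ hp0.le, mul_assoc]
        gcongr
        exact hC _ (by positivity) _ hfm

theorem normF_truncate_lt_top (hp : 1 < p) (hγ : γ ∈ Ioo (-1 : ℝ) (p - 1)) {g : 𝓢'(ℝ, X)}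
    (hg : normF φ s p p γ g < ∞) (n : ℕ) : normF φ s p p γ (truncate φ n g) < ∞ := by
  have hp0 : 0 < p := by linarith
  obtain ⟨C, hC⟩ := exists_blockNorm_truncate_rpow_le (X := X) (φ := φ) (s := s) hp hγ
  refine (ENNReal.rpow_lt_top_iff_of_pos hp0).1 ?_
  rw [normF_rpow hp]
  refine (ENNReal.tsum_le_tsum fun j => hC g n j).trans_lt ?_
  rw [ENNReal.tsum_mul_left, ← normF_rpow hp]
  exact ENNReal.mul_lt_top (by simp) (ENNReal.rpow_lt_top_of_nonneg hp0.le hg.ne)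

/-- The blocks of `g - truncate φ n g` below `n` vanish and the others are bounded by those of `g`. -/
theorem tendsto_normF_sub_truncate (hφ : IsLittlewoodPaley φ) (hp : 1 < p)
    (hγ : γ ∈ Ioo (-1 : ℝ) (p - 1)) {g : 𝓢'(ℝ, X)} (hg : normF φ s p p γ g < ∞) :
    Tendsto (fun n => normF φ s p p γ (g - truncate φ n g)) atTop (𝓝 0) := by
  have hp0 : 0 < p := by linarith
  obtain ⟨C, hC⟩ := exists_blockNorm_truncate_rpow_le (X := X) (φ := φ) (s := s) hp hγ
  have hbS : ∑' k, blockNorm φ s p γ g k ^ p ≠ ∞ := by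
    rw [← normF_rpow hp]; exact (ENNReal.rpow_lt_top_of_nonneg hp0.le hg.ne).ne
  obtain ⟨D, hD, hDle⟩ : ∃ D : ℝ≥0∞, D ≠ ∞ ∧ ∀ n j,
      blockNorm φ s p γ (g - truncate φ n g) j ^ p ≤ D * blockNorm φ s p γ g j ^ p := by
    refine ⟨2 ^ (p - 1) * (1 + C), ENNReal.mul_ne_top
      (ENNReal.rpow_lt_top_of_nonneg (by linarith) (by simp)).ne (by simp), fun n j => ?_⟩
    refine (blockNorm_sub_rpow_le hp _ _ j).trans ?_
    rw [mul_assoc, add_mul, one_mul]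
    gcongr
    exact hC g n j
  have htail : Tendsto (fun n => D * ∑' k, blockNorm φ s p γ g (k + n) ^ p) atTop (𝓝 0) := by
    simpa using ENNReal.Tendsto.const_mul (a := D)
      (ENNReal.tendsto_sum_nat_add (fun k => blockNorm φ s p γ g k ^ p) hbS) (Or.inr hD)
  have hle : ∀ n, normF φ s p p γ (g - truncate φ n g) ^ p ≤
      D * ∑' k, blockNorm φ s p γ g (k + n) ^ p := by
    intro n
    rw [normF_rpow hp, tsum_eq_tsum_nat_add_of_eq_zero (n := n) fun j hj => by
      rw [blockNorm_sub_truncate_eq_zero hφ hp0 hj, ENNReal.zero_rpow_of_pos hp0],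
      ← ENNReal.tsum_mul_left]
    exact ENNReal.tsum_le_tsum fun k => hDle n (k + n)
  have h0 := (tendsto_of_tendsto_of_tendsto_of_le_of_le tendsto_const_nhds htail
    (fun _ => zero_le) hle).ennrpow_const (1 / p)
  rw [ENNReal.zero_rpow_of_pos (by positivity)] at h0
  refine h0.congr fun n => ?_
  rw [← ENNReal.rpow_mul, mul_one_div, div_self hp0.ne', ENNReal.rpow_one]

end Truncation

/-! ### The trace at zero exists and is given by the blocks -/

section TraceZero

variable {X : Type*} [NormedAddCommGroup X] [NormedSpace ℂ X]
variable {φ : ℕ → 𝓢(ℝ, ℂ)} {s p γ : ℝ} {I : Set ℝ}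

theorem integrableOn_smul_of_tsupport_subset (hI : MeasurableSet I) {u : ℝ → X}
    (hu : LocallyIntegrableOn u I) {ψ : 𝓢(ℝ, ℂ)} (hψ : HasCompactSupport ψ)
    (hψI : tsupport ψ ⊆ I) : IntegrableOn (fun x => ψ x • u x) I := by
  have h1 : IntegrableOn u (tsupport ψ) := hu.integrableOn_compact_subset hψI hψ
  have h2 : IntegrableOn (fun x => ψ x • u x) (tsupport ψ) :=
    Integrable.bdd_smul h1 ψ.continuous.aestronglyMeasurable
      (C := SchwartzMap.seminorm ℂ 0 0 ψ)
      (Eventually.of_forall fun x => SchwartzMap.norm_le_seminorm ℂ ψ x)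
  refine h2.of_forall_sdiff_eq_zero hI fun x hx => ?_
  rw [image_eq_zero_of_notMem_tsupport hx.2, zero_smul]

theorem RestrictsTo.sub (hI : MeasurableSet I) {g g' : 𝓢'(ℝ, X)} {u u' : ℝ → X}
    (h : RestrictsTo I g u) (h' : RestrictsTo I g' u') (hu : LocallyIntegrableOn u I)
    (hu' : LocallyIntegrableOn u' I) : RestrictsTo I (g - g') (u - u') := by
  intro ψ hψ hψI
  have e : (g - g') ψ = g ψ - g' ψ := rfl
  rw [e, h ψ hψ hψI, h' ψ hψ hψI, ← integral_sub
    (integrableOn_smul_of_tsupport_subset hI hu hψ hψI)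
    (integrableOn_smul_of_tsupport_subset hI hu' hψ hψI)]
  simp [smul_sub]

theorem restrictsTo_truncate [CompleteSpace X] (n : ℕ) (g : 𝓢'(ℝ, X)) :
    RestrictsTo I (truncate φ n g) (truncateFun φ n g) := by
  intro ψ hψ hψI
  rw [truncate_apply, schwartzConv_comm, apply_schwartzConv]
  refine (setIntegral_eq_integral_of_forall_compl_eq_zero fun x hx => ?_).symm
  rw [image_eq_zero_of_notMem_tsupport fun h => hx (hψI h), zero_smul]

/-- Averages of a function that is continuous up to `0` converge to its value at `0`. -/
theorem tendsto_setIntegral_bumpAt_smul [CompleteSpace X] (hI : MeasurableSet I) (hI0 : Ioi 0 ⊆ I)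
    {v : ℝ → X} (hv : ContinuousOn v (closure I)) (hvI : LocallyIntegrableOn v I) :
    Tendsto (fun j : ℤ => ∫ x in I, bumpAt j x • v x) atBot (𝓝 (v 0)) := by
  have h0 : (0 : ℝ) ∈ closure I := closure_mono hI0 (by simp)
  have hsub : ∀ j, tsupport (bumpAt j) ⊆ I := fun j => (tsupport_bumpAt_subset_Ioi j).trans hI0
  have hone : ∀ j, ∫ x in I, bumpAt j x • v 0 = v 0 := by
    intro j
    rw [integral_smul_const, setIntegral_eq_integral_of_forall_compl_eq_zero
      (fun x hx => image_eq_zero_of_notMem_tsupport fun h => hx (hsub j h)), integral_bumpAt,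
      one_smul]
  set L := ∫ x, ‖bump x‖ with hL
  have hL0 : 0 ≤ L := integral_nonneg fun x => norm_nonneg _
  rw [Metric.tendsto_nhds]
  intro ε hε
  have hε' : 0 < ε / (L + 1) := by positivity
  obtain ⟨r, hr, hr'⟩ := Metric.continuousWithinAt_iff.1 (hv 0 h0) _ hε'
  have h2 : ∀ᶠ j : ℤ in atBot, (2 : ℝ) ^ j < r :=
    (((tendsto_rpow_atBot_of_base_gt_one (2 : ℝ) (by norm_num)).comp
        (tendsto_intCast_atBot_iff.2 tendsto_id)).congr fun j =>
          Real.rpow_intCast 2 j).eventually_lt_const hr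
  filter_upwards [h2] with j hj
  have hi1 := integrableOn_smul_of_tsupport_subset hI hvI (hasCompactSupport_bumpAt j) (hsub j)
  have hi2 : IntegrableOn (fun x => bumpAt j x • v 0) I :=
    ((bumpAt j).integrable.smul_const (v 0)).integrableOn
  have e : (∫ x in I, bumpAt j x • v x) - v 0 = ∫ x in I, bumpAt j x • (v x - v 0) := by
    simp_rw [smul_sub]
    rw [integral_sub hi1 hi2, hone]
  rw [dist_eq_norm, e]
  have hb : ∀ x ∈ I, ‖bumpAt j x • (v x - v 0)‖ ≤ ‖bumpAt j x‖ * (ε / (L + 1)) := by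
    intro x hx
    rw [norm_smul]
    by_cases hxj : x ∈ Ioc ((2 : ℝ) ^ (j - 1)) (2 ^ j)
    · gcongr
      have hx0 : 0 < x := lt_trans (by positivity) hxj.1
      have := hr' (subset_closure hx) (by
        rw [Real.dist_eq, sub_zero, abs_of_pos hx0]; exact hxj.2.trans_lt hj)
      rw [dist_eq_norm] at this
      exact this.le
    · simp [bumpAt_eq_zero hxj]
  have hn : Integrable fun x => ‖bumpAt j x‖ * (ε / (L + 1)) :=
    (bumpAt j).integrable.norm.mul_const _
  calc _ ≤ ∫ x in I, ‖bumpAt j x‖ * (ε / (L + 1)) :=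
        norm_integral_le_of_norm_le hn.integrableOn
          ((ae_restrict_mem hI).mono hb)
    _ ≤ ∫ x, ‖bumpAt j x‖ * (ε / (L + 1)) :=
        setIntegral_le_integral hn (Eventually.of_forall fun x => by positivity)
    _ = L * (ε / (L + 1)) := by
        rw [integral_mul_const, bumpAt, integral_norm_dyadicDilation]
    _ < (L + 1) * (ε / (L + 1)) := by
        exact mul_lt_mul_of_pos_right (by linarith) hε'
    _ = ε := by field_simp

theorem normFOn_le {g : 𝓢'(ℝ, X)} {u : ℝ → X} (h : RestrictsTo I g u) :
    normFOn φ I s p p γ u ≤ normF φ s p p γ g :=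
  iInf₂_le (f := fun (g : 𝓢'(ℝ, X)) (_ : RestrictsTo I g u) => normF φ s p p γ g) g h

/-- On functions that are continuous up to `0`, evaluation at `0` is controlled by the norm of
`F^s_{p,p}(I, |t|^γ; X)`; the bump functions detect the value at `0` of a difference `u - v`. -/
theorem exists_enorm_traceOf_sub_le [CompleteSpace X] (hφ : IsLittlewoodPaley φ) (hp : 1 < p)
    (hs1 : s < 1) (hγ : γ ∈ Ioo (-1 : ℝ) (p - 1)) (hδ : 0 < s - (1 + γ) / p)
    (hI : MeasurableSet I) (hI0 : Ioi 0 ⊆ I) {u : ℝ → X} (hu : LocallyIntegrableOn u I)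
    {g : 𝓢'(ℝ, X)} (hgu : RestrictsTo I g u) (hg : normF φ s p p γ g < ∞) :
    ∃ C : ℝ≥0, ∀ v : ℝ → X, LocallyIntegrableOn v I → ContinuousOn v (closure I) →
      normFOn φ I s p p γ (u - v) < ∞ →
      ‖traceOf φ g - v 0‖ₑ ≤ C * normFOn φ I s p p γ (u - v) := by
  have hp0 : 0 < p := by linarith
  obtain ⟨C, hC⟩ := exists_enorm_apply_bumpAt_le (X := X) hφ hp hγ hδ
  have hgb : Tendsto (fun j => g (bumpAt j)) atBot (𝓝 (traceOf φ g)) := by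
    rw [tendsto_iff_edist_tendsto_0]
    simp_rw [edist_eq_enorm_sub]
    exact tendsto_atBot_of_tsum_rpow_lt_top hδ hp0
      (tsum_rpow_apply_bumpAt_sub_lt_top hφ hp hs1 hγ hδ hg)
  refine ⟨C, fun v hvl hvc hfin => ?_⟩
  have key : ∀ g' : 𝓢'(ℝ, X), RestrictsTo I g' (u - v) → normF φ s p p γ g' < ∞ →
      ‖traceOf φ g - v 0‖ₑ ≤ C * normF φ s p p γ g' := by
    intro g' hg' hfin'
    have hlim := (hgb.sub (tendsto_setIntegral_bumpAt_smul hI hI0 hvc hvl)).enorm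
    refine le_of_tendsto hlim (Eventually.of_forall fun j => ?_)
    have hsub : tsupport (bumpAt j) ⊆ I := (tsupport_bumpAt_subset_Ioi j).trans hI0
    have hcs := hasCompactSupport_bumpAt j
    have e : g (bumpAt j) - ∫ x in I, bumpAt j x • v x = g' (bumpAt j) := by
      rw [hgu _ hcs hsub, hg' _ hcs hsub, ← integral_sub
        (integrableOn_smul_of_tsupport_subset hI hu hcs hsub)
        (integrableOn_smul_of_tsupport_subset hI hvl hcs hsub)]
      simp [smul_sub]
    rw [e]
    exact hC g' hfin' j
  refine le_of_forall_gt fun c hc => ?_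
  by_cases hC0 : C = 0
  · obtain ⟨g', hg'⟩ := iInf_lt_iff.1 hfin
    obtain ⟨hr, hlt⟩ := iInf_lt_iff.1 hg'
    have := key g' hr hlt
    simp only [hC0, ENNReal.coe_zero, zero_mul, nonpos_iff_eq_zero] at this hc
    rwa [this]
  · have hC0' : (C : ℝ≥0∞) ≠ 0 := by simpa using hC0
    have hc' : normFOn φ I s p p γ (u - v) < c / C := by
      rw [ENNReal.lt_div_iff_mul_lt (Or.inl hC0') (Or.inl (by simp)), mul_comm]
      exact hc
    obtain ⟨g', hg'⟩ := iInf_lt_iff.1 hc'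
    obtain ⟨hr, hlt⟩ := iInf_lt_iff.1 hg'
    refine (key g' hr (hlt.trans_le le_top)).trans_lt ?_
    rwa [mul_comm, ← ENNReal.lt_div_iff_mul_lt (Or.inl hC0') (Or.inl (by simp))]

/-- The trace at zero of `u` exists, is unique, and equals the sum of the blocks at the origin of
any extension of `u` with finite norm. -/
theorem isTraceZero_iff [CompleteSpace X] (hφ : IsLittlewoodPaley φ) (hp : 1 < p) (hs1 : s < 1)
    (hγ : γ ∈ Ioo (-1 : ℝ) (p - 1)) (hδ : 0 < s - (1 + γ) / p) (hI : MeasurableSet I)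
    (hI0 : Ioi 0 ⊆ I) {u : ℝ → X} (hu : LocallyIntegrableOn u I) {g : 𝓢'(ℝ, X)}
    (hgu : RestrictsTo I g u) (hg : normF φ s p p γ g < ∞) (y : X) :
    IsTraceZero φ I s p p γ u y ↔ y = traceOf φ g := by
  have hvl : ∀ n, LocallyIntegrableOn (truncateFun φ n g) I := fun n =>
    (continuous_truncateFun n g).locallyIntegrable.locallyIntegrableOn I
  constructor
  · rintro ⟨v, hv, hlim, hy⟩
    refine tendsto_nhds_unique hy ?_
    obtain ⟨C, hC⟩ := exists_enorm_traceOf_sub_le hφ hp hs1 hγ hδ hI hI0 hu hgu hg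
    have hCl : Tendsto (fun n => C * normFOn φ I s p p γ (u - v n)) atTop (𝓝 0) := by
      simpa using ENNReal.Tendsto.const_mul (a := (C : ℝ≥0∞)) hlim (Or.inr (by simp))
    rw [tendsto_iff_edist_tendsto_0]
    refine tendsto_of_tendsto_of_tendsto_of_le_of_le' tendsto_const_nhds hCl
      (Eventually.of_forall fun _ => zero_le) ?_
    filter_upwards [hlim.eventually_lt_const (u := (1 : ℝ≥0∞)) (by simp)] with n hn
    rw [edist_comm, edist_eq_enorm_sub]
    exact hC (v n) (hv n).1.1 (hv n).2 (hn.trans_le le_top)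
  · rintro rfl
    refine ⟨fun n => truncateFun φ n g, fun n => ⟨⟨hvl n, ?_⟩,
      (continuous_truncateFun n g).continuousOn⟩, ?_, ?_⟩
    · exact (normFOn_le (restrictsTo_truncate n g)).trans_lt (normF_truncate_lt_top hp hγ hg n)
    · exact tendsto_of_tendsto_of_tendsto_of_le_of_le tendsto_const_nhds
        (tendsto_normF_sub_truncate hφ hp hγ hg) (fun _ => zero_le) fun n =>
          normFOn_le (hgu.sub hI (restrictsTo_truncate n g) hu (hvl n))
    · simp_rw [truncateFun_zero]
      exact tendsto_apply_lpTruncation hφ (summable_apply_lpAtom hφ hp hγ hδ hg)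

end TraceZero

/-! ### From discrete decompositions to the real interpolation norm -/

section Interpolation

/-- Every summable weight on `ℤ` has a summable majorant that is increasing and grows at most
geometrically. -/
theorem exists_majorant {ρ η : ℝ} (hρ : 1 < ρ) (hη0 : 0 < η) (hη1 : η < 1) :
    ∃ K : ℝ≥0, ∀ c : ℤ → ℝ≥0∞, ∑' n : ℤ, ENNReal.ofReal ((ρ ^ n) ^ (-η)) * c n < ∞ →
      ∃ L : ℤ → ℝ, (∀ n, 0 < L n) ∧ (∀ n, c n ≤ ENNReal.ofReal (L n)) ∧
        (∀ n, L n ≤ L (n + 1)) ∧ (∀ n, L (n + 1) ≤ ρ * L n) ∧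
        ∑' n : ℤ, ENNReal.ofReal (L n * (ρ ^ n) ^ (-η)) ≤
          K * (∑' n : ℤ, ENNReal.ofReal ((ρ ^ n) ^ (-η)) * c n + 1) := by
  have hρ0 : 0 < ρ := by linarith
  have hsum := summable_min_one_zpow_mul_rpow hρ hη0 hη1
  set f : ℤ → ℝ := fun i => min 1 (ρ ^ i) * (ρ ^ i) ^ (-η) with hf
  have hf0 : ∀ i, 0 ≤ f i := fun i => by positivity
  refine ⟨(∑' i, f i).toNNReal, fun c hc => ?_⟩
  -- a unit mass at the origin makes the majorant positive
  set d : ℤ → ℝ≥0∞ := fun n => c n + if n = 0 then 1 else 0 with hd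
  have hdsum : ∑' n : ℤ, ENNReal.ofReal ((ρ ^ n) ^ (-η)) * d n =
      ∑' n : ℤ, ENNReal.ofReal ((ρ ^ n) ^ (-η)) * c n + 1 := by
    simp_rw [hd, mul_add]
    rw [ENNReal.tsum_add]
    congr 1
    rw [tsum_eq_single 0 (by intro b hb; simp [hb])]
    simp
  set M : ℤ → ℝ≥0∞ := fun n => ∑' m, ENNReal.ofReal (min 1 (ρ ^ (n - m))) * d m with hM
  have hMsum : ∑' n : ℤ, ENNReal.ofReal ((ρ ^ n) ^ (-η)) * M n =
      ENNReal.ofReal (∑' i, f i) * (∑' n : ℤ, ENNReal.ofReal ((ρ ^ n) ^ (-η)) * c n + 1) := by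
    rw [← hdsum, ← ENNReal.tsum_mul_left]
    simp_rw [hM, ← ENNReal.tsum_mul_left]
    rw [ENNReal.tsum_comm]
    refine tsum_congr fun m => ?_
    rw [ENNReal.ofReal_tsum_of_nonneg hf0 hsum, ← (Equiv.subRight m).tsum_eq
      (fun i => ENNReal.ofReal (f i)), ← ENNReal.tsum_mul_right]
    refine tsum_congr fun n => ?_
    rw [← mul_assoc, ← mul_assoc, ← ENNReal.ofReal_mul (by positivity),
      ← ENNReal.ofReal_mul (hf0 _)]
    congr 2
    simp only [hf, Equiv.subRight_apply]
    rw [mul_assoc, ← Real.mul_rpow (by positivity) (by positivity), ← zpow_add₀ hρ0.ne',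
      sub_add_cancel, mul_comm]
  have hMfin : ∀ n, M n ≠ ∞ := by
    intro n h
    have h1 : ENNReal.ofReal ((ρ ^ n) ^ (-η)) * M n < ∞ := by
      refine (ENNReal.le_tsum (f := fun n => ENNReal.ofReal ((ρ ^ n) ^ (-η)) * M n) n).trans_lt ?_
      rw [hMsum]
      exact ENNReal.mul_lt_top ENNReal.ofReal_lt_top (ENNReal.add_lt_top.2 ⟨hc, by simp⟩)
    have h2 : ENNReal.ofReal ((ρ ^ n) ^ (-η)) ≠ 0 := by
      rw [Ne, ENNReal.ofReal_eq_zero, not_le]; positivity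
    rw [h, ENNReal.mul_top h2] at h1
    exact lt_irrefl _ h1
  have hMpos : ∀ n, M n ≠ 0 := by
    intro n h
    have h1 := ENNReal.tsum_eq_zero.1 h 0
    have h2 : ENNReal.ofReal (min 1 (ρ ^ (n - 0))) ≠ 0 := by
      rw [Ne, ENNReal.ofReal_eq_zero, not_le]; positivity
    rcases mul_eq_zero.1 h1 with h3 | h3
    · exact h2 h3
    · simp [hd] at h3
  refine ⟨fun n => (M n).toReal, fun n => ENNReal.toReal_pos (hMpos n) (hMfin n), fun n => ?_,
    fun n => ?_, fun n => ?_, ?_⟩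
  · rw [ENNReal.ofReal_toReal (hMfin n)]
    refine le_trans ?_ (ENNReal.le_tsum n)
    simp [hd]
  · refine ENNReal.toReal_mono (hMfin _) (ENNReal.tsum_le_tsum fun m => ?_)
    gcongr
    · exact hρ.le
    · omega
  · have e : ρ * (M n).toReal = (ENNReal.ofReal ρ * M n).toReal := by
      rw [ENNReal.toReal_mul, ENNReal.toReal_ofReal hρ0.le]
    rw [e]
    refine ENNReal.toReal_mono (ENNReal.mul_ne_top (by simp) (hMfin n)) ?_
    rw [hM, ← ENNReal.tsum_mul_left]
    refine ENNReal.tsum_le_tsum fun m => ?_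
    rw [← mul_assoc, ← ENNReal.ofReal_mul hρ0.le]
    gcongr
    rw [mul_min_of_nonneg _ _ hρ0.le, mul_one, show n + 1 - m = (n - m) + 1 by ring,
      zpow_add_one₀ hρ0.ne', mul_comm ρ]
    exact min_le_min hρ.le le_rfl
  · refine le_of_eq ?_
    change _ = ENNReal.ofReal _ * _
    rw [← hMsum]
    refine tsum_congr fun n => ?_
    rw [ENNReal.ofReal_mul (by positivity), ENNReal.ofReal_toReal (hMfin n), mul_comm]

/-- An increasing sequence `t` on `ℤ` running from `0` to `∞` with bounded ratios bounds
integrals against `dt / t` by sums over `ℤ`. -/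
theorem lintegral_Ioi_mul_inv_le_tsum {t : ℤ → ℝ} {R : ℝ} (ht : ∀ n, 0 < t n)
    (hR : ∀ n, t (n + 1) ≤ R * t n) (h0 : Tendsto t atBot (𝓝 0)) (h1 : Tendsto t atTop atTop)
    {f : ℝ → ℝ≥0∞} {b : ℤ → ℝ≥0∞} (hf : ∀ n, ∀ x ∈ Icc (t n) (t (n + 1)), f x ≤ b n) :
    ∫⁻ x in Ioi 0, f x * ENNReal.ofReal x⁻¹ ≤ ENNReal.ofReal R * ∑' n, b n := by
  have hcov : Ioi (0 : ℝ) ⊆ ⋃ n, Icc (t n) (t (n + 1)) := by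
    intro x hx
    obtain ⟨N, hN⟩ := eventually_atTop.1 (h1.eventually_gt_atTop x)
    obtain ⟨m, hm⟩ := (h0.eventually_lt_const hx).exists
    obtain ⟨n, hn, hn'⟩ := Int.exists_greatest_of_bdd (P := fun n => t n ≤ x)
      ⟨N, fun z hz => by
        by_contra! h
        exact absurd hz (not_le.2 (hN z h.le))⟩ ⟨m, hm.le⟩
    refine mem_iUnion.2 ⟨n, hn, ?_⟩
    by_contra! h
    have := hn' _ h.le
    omega
  calc _ ≤ ∫⁻ x in ⋃ n, Icc (t n) (t (n + 1)), f x * ENNReal.ofReal x⁻¹ :=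
        lintegral_mono_set hcov
    _ ≤ ∑' n, ∫⁻ x in Icc (t n) (t (n + 1)), f x * ENNReal.ofReal x⁻¹ := lintegral_iUnion_le _ _
    _ ≤ ∑' n, ENNReal.ofReal R * b n := by
        refine ENNReal.tsum_le_tsum fun n => ?_
        calc _ ≤ ∫⁻ x in Icc (t n) (t (n + 1)), b n * ENNReal.ofReal (t n)⁻¹ := by
              refine setLIntegral_mono measurable_const fun x hx => ?_
              gcongr
              · exact hf n x hx
              · exact ht n
              · exact hx.1
          _ = b n * (ENNReal.ofReal (t n)⁻¹ * ENNReal.ofReal (t (n + 1) - t n)) := by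
              rw [setLIntegral_const, Real.volume_Icc, mul_assoc]
          _ ≤ ENNReal.ofReal R * b n := by
              rw [mul_comm]
              gcongr
              rw [← ENNReal.ofReal_mul (by have := ht n; positivity)]
              refine ENNReal.ofReal_le_ofReal ?_
              rw [inv_mul_le_iff₀ (ht n)]
              have := hR n
              have := ht n
              nlinarith
    _ = _ := ENNReal.tsum_mul_left

end Interpolation

section Interpolation

/-! The nodes `L_n ^ (1 / p₀) (ρ ^ n / L_n) ^ (1 / p₁)` are where the two parts of the decomposition
with index `n` have equal size. -/

section Nodes

variable {ρ η S q₀ q₁ : ℝ} {L : ℤ → ℝ}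

theorem nodes_succ_le (hρ : 1 < ρ) (hq₀ : 0 < q₀) (hq₁ : 0 < q₁) (hL : ∀ n, 0 < L n)
    (hmono : ∀ n, L n ≤ L (n + 1)) (hgrow : ∀ n, L (n + 1) ≤ ρ * L n) (n : ℤ) :
    L (n + 1) ^ q₀ * (ρ ^ (n + 1) / L (n + 1)) ^ q₁ ≤
      ρ ^ q₀ * ρ ^ q₁ * (L n ^ q₀ * (ρ ^ n / L n) ^ q₁) := by
  have hρ0 : 0 < ρ := by linarith
  have h1 : L (n + 1) ^ q₀ ≤ ρ ^ q₀ * L n ^ q₀ := by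
    rw [← Real.mul_rpow hρ0.le (hL n).le]
    exact Real.rpow_le_rpow (hL _).le (hgrow n) hq₀.le
  have h2 : (ρ ^ (n + 1) / L (n + 1)) ^ q₁ ≤ ρ ^ q₁ * (ρ ^ n / L n) ^ q₁ := by
    have := hL n
    have := hL (n + 1)
    rw [← Real.mul_rpow hρ0.le (by positivity)]
    refine Real.rpow_le_rpow (by positivity) ?_ hq₁.le
    rw [zpow_add_one₀ hρ0.ne', mul_comm, mul_div_assoc]
    gcongr
    exact hmono n
  have := hL n
  have := hL (n + 1)
  calc _ ≤ (ρ ^ q₀ * L n ^ q₀) * (ρ ^ q₁ * (ρ ^ n / L n) ^ q₁) := by gcongr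
    _ = _ := by ring

theorem monotone_zpow_div (hρ : 1 < ρ) (hL : ∀ n, 0 < L n)
    (hgrow : ∀ n, L (n + 1) ≤ ρ * L n) : Monotone fun n : ℤ => ρ ^ n / L n := by
  have hρ0 : 0 < ρ := by linarith
  refine monotone_int_of_le_succ fun n => ?_
  rw [div_le_div_iff₀ (hL _) (hL _), zpow_add_one₀ hρ0.ne', mul_assoc]
  have := hgrow n
  gcongr

theorem tendsto_nodes_atBot (hρ : 1 < ρ) (hη0 : 0 < η) (hq₀ : 0 < q₀) (hq₁ : 0 < q₁)
    (hL : ∀ n, 0 < L n) (hgrow : ∀ n, L (n + 1) ≤ ρ * L n) (hS : ∀ n, L n ≤ S * (ρ ^ n) ^ η) :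
    Tendsto (fun n => L n ^ q₀ * (ρ ^ n / L n) ^ q₁) atBot (𝓝 0) := by
  have hρ0 : 0 < ρ := by linarith
  have hs : Tendsto (fun n : ℤ => ρ ^ n) atBot (𝓝 0) :=
    ((tendsto_rpow_atBot_of_base_gt_one ρ hρ).comp
      (tendsto_intCast_atBot_iff.2 tendsto_id)).congr fun j => Real.rpow_intCast ρ j
  have hL0 : Tendsto L atBot (𝓝 0) := by
    have := (hs.rpow_const (p := η) (Or.inr hη0.le)).const_mul S
    rw [Real.zero_rpow hη0.ne', mul_zero] at this
    exact tendsto_of_tendsto_of_tendsto_of_le_of_le tendsto_const_nhds this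
      (fun n => (hL n).le) hS
  have hL1 := (hL0.rpow_const (p := q₀) (Or.inr hq₀.le)).mul_const ((ρ ^ (0 : ℤ) / L 0) ^ q₁)
  rw [Real.zero_rpow hq₀.ne', zero_mul] at hL1
  have hpos : ∀ n, 0 < ρ ^ n / L n := fun n => by have := hL n; positivity
  refine tendsto_of_tendsto_of_tendsto_of_le_of_le' tendsto_const_nhds hL1
    (Eventually.of_forall fun n => by have := hL n; positivity) ?_
  filter_upwards [eventually_le_atBot 0] with n hn
  have h1 := Real.rpow_le_rpow (hpos n).le (monotone_zpow_div hρ hL hgrow hn) hq₁.le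
  have h2 : 0 ≤ L n ^ q₀ := by have := hL n; positivity
  exact mul_le_mul_of_nonneg_left h1 h2

theorem tendsto_nodes_atTop (hρ : 1 < ρ) (hη1 : η < 1) (hq₀ : 0 < q₀) (hq₁ : 0 < q₁)
    (hL : ∀ n, 0 < L n) (hmono : ∀ n, L n ≤ L (n + 1)) (hS : ∀ n, L n ≤ S * (ρ ^ n) ^ η) :
    Tendsto (fun n => L n ^ q₀ * (ρ ^ n / L n) ^ q₁) atTop atTop := by
  have hρ0 : 0 < ρ := by linarith
  have hS0 : 0 < S := by
    have := (hL 0).trans_le (hS 0)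
    simpa using this
  have hs : Tendsto (fun n : ℤ => ρ ^ n) atTop atTop :=
    ((tendsto_rpow_atTop_of_base_gt_one ρ hρ).comp
      (tendsto_intCast_atTop_iff.2 tendsto_id)).congr fun j => Real.rpow_intCast ρ j
  have h1 : Tendsto (fun n : ℤ => (ρ ^ n) ^ (1 - η) / S) atTop atTop :=
    ((tendsto_rpow_atTop (by linarith)).comp hs).atTop_div_const hS0
  have h2 := ((tendsto_rpow_atTop hq₁).comp h1).const_mul_atTop
    (Real.rpow_pos_of_pos (hL 0) q₀)
  refine tendsto_atTop_mono' _ ?_ h2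
  filter_upwards [eventually_ge_atTop 0] with n hn
  have hLn := hL n
  have h3 : L 0 ^ q₀ ≤ L n ^ q₀ :=
    Real.rpow_le_rpow (hL 0).le (monotone_int_of_le_succ hmono hn) hq₀.le
  have h4 : (ρ ^ n) ^ (1 - η) / S ≤ ρ ^ n / L n := by
    have hsn : 0 < ρ ^ n := by positivity
    rw [div_le_div_iff₀ hS0 hLn, Real.rpow_sub hsn, Real.rpow_one]
    have := hS n
    have h5 : 0 < (ρ ^ n) ^ η := by positivity
    rw [div_mul_eq_mul_div, div_le_iff₀ h5]
    nlinarith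
  simp only [Function.comp]
  gcongr

end Nodes

/-- A linear decomposition `k t ≤ α j + t β j` with `α` and `β` in weighted sequence spaces
bounds the norm of `k` that defines real interpolation. On the interval between two nodes the
decomposition with the index of the left node is used. -/
theorem exists_lintegral_rpow_le_of_pos {p₀ p₁ δ₀ δ₁ θ p : ℝ} (hp₀ : 1 < p₀) (hp₁ : 1 < p₁)
    (hδ₀ : 0 < δ₀) (hδ₁ : δ₁ < 0) (hθ : θ = δ₀ / (δ₀ - δ₁))
    (hp : 1 / p = (1 - θ) / p₀ + θ / p₁) :
    ∃ K : ℝ≥0, ∀ (k : ℝ → ℝ≥0∞) (α β : ℤ → ℝ≥0∞),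
      (∀ j, ∀ t > 0, k t ≤ α j + ENNReal.ofReal t * β j) →
      ∀ a b : ℝ, 0 < a → 0 < b →
      ∑' j : ℤ, (ENNReal.ofReal (((2 : ℝ) ^ j) ^ (-δ₀)) * α j) ^ p₀ ≤ ENNReal.ofReal a ^ p₀ →
      ∑' j : ℤ, (ENNReal.ofReal (((2 : ℝ) ^ j) ^ (-δ₁)) * β j) ^ p₁ ≤ ENNReal.ofReal b ^ p₁ →
      ∫⁻ t in Ioi (0 : ℝ), (ENNReal.ofReal (t ^ (-θ)) * k t) ^ p * ENNReal.ofReal t⁻¹ ≤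
        K * ENNReal.ofReal ((a ^ (1 - θ) * b ^ θ) ^ p) := by
  have hp₀' : 0 < p₀ := by linarith
  have hp₁' : 0 < p₁ := by linarith
  have hd : 0 < δ₀ - δ₁ := by linarith
  have hθ0 : 0 < θ := by rw [hθ]; positivity
  have hθ1 : θ < 1 := by rw [hθ, div_lt_one hd]; linarith
  have hp0 : 0 < p := by
    rw [← one_div_pos, hp]
    have : 0 < 1 - θ := by linarith
    positivity
  -- with `ρ = 2 ^ σ` both weights are powers of `ρ ^ n`: `2^{-nδ₀p₀} = ρ^{-nη}` and
  -- `2^{-nδ₁p₁} = ρ^{n(1-η)}`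
  set σ := δ₀ * p₀ - δ₁ * p₁ with hσ
  have hσ1 : 0 < -δ₁ * p₁ := mul_pos (by linarith) hp₁'
  have hσ0 : 0 < δ₀ * p₀ := mul_pos hδ₀ hp₀'
  have hσpos : 0 < σ := by rw [hσ]; linarith
  set η := δ₀ * p₀ / σ with hη
  have hη0 : 0 < η := by positivity
  have hη1 : η < 1 := by rw [hη, div_lt_one hσpos]; linarith
  have hpη : p * (θ / p₁) = η := by
    have h1 : 1 / p = σ / ((δ₀ - δ₁) * p₀ * p₁) := by
      rw [hp, hθ, hσ]; field_simp; ring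
    have h2 : p = ((δ₀ - δ₁) * p₀ * p₁) / σ := by
      rw [← one_div_one_div p, h1, one_div_div]
    rw [h2, hη, hθ]; field_simp
  have hp1 : p * ((1 - θ) / p₀ + θ / p₁) = 1 := by rw [← hp]; field_simp
  set ρ : ℝ := 2 ^ σ with hρdef
  have hρ : 1 < ρ := Real.one_lt_rpow (by norm_num) hσpos
  have hρ0 : 0 < ρ := by linarith
  have hρn : ∀ n : ℤ, ρ ^ n = ((2 : ℝ) ^ n) ^ σ := by
    intro n
    rw [hρdef, ← Real.rpow_intCast, ← Real.rpow_mul (by norm_num), mul_comm,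
      Real.rpow_mul (by norm_num), Real.rpow_intCast]
  have hρη : ∀ n : ℤ, (ρ ^ n) ^ (-η) = (((2 : ℝ) ^ n) ^ (-δ₀)) ^ p₀ := by
    intro n
    rw [hρn, ← Real.rpow_mul (by positivity), ← Real.rpow_mul (by positivity)]
    congr 1
    rw [hη]; field_simp
  have hρη1 : ∀ n : ℤ, (ρ ^ n) ^ (-η) * ρ ^ n = (((2 : ℝ) ^ n) ^ (-δ₁)) ^ p₁ := by
    intro n
    rw [hρη, hρn, ← Real.rpow_mul (by positivity), ← Real.rpow_mul (by positivity),
      ← Real.rpow_add (by positivity)]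
    congr 1
    rw [hσ]; ring
  obtain ⟨K, hK⟩ := exists_majorant hρ hη0 hη1
  set R : ℝ := ρ ^ p₀⁻¹ * ρ ^ p₁⁻¹ with hR
  have hR0 : 0 < R := by positivity
  refine ⟨R.toNNReal * (((1 + R) ^ p).toNNReal * (K * 3)), ?_⟩
  intro k α β hk a b ha hb hα hβ
  have ha0 : ENNReal.ofReal a ≠ 0 := by simpa using ha
  have hb0 : ENNReal.ofReal b ≠ 0 := by simpa using hb
  -- a majorant of `c` controls both parts of the decomposition after normalisation by `a` and `b`
  set c : ℤ → ℝ≥0∞ := fun n => (α n / ENNReal.ofReal a) ^ p₀ +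
    ENNReal.ofReal (ρ ^ n) * (β n / ENNReal.ofReal b) ^ p₁ with hc
  have hcsum : ∑' n : ℤ, ENNReal.ofReal ((ρ ^ n) ^ (-η)) * c n ≤ 2 := by
    have e : ∀ n, ENNReal.ofReal ((ρ ^ n) ^ (-η)) * c n =
        (ENNReal.ofReal (((2 : ℝ) ^ n) ^ (-δ₀)) * α n) ^ p₀ * (ENNReal.ofReal a ^ p₀)⁻¹ +
        (ENNReal.ofReal (((2 : ℝ) ^ n) ^ (-δ₁)) * β n) ^ p₁ * (ENNReal.ofReal b ^ p₁)⁻¹ := by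
      intro n
      simp only [hc]
      rw [mul_add, ← mul_assoc, ← ENNReal.ofReal_mul (by positivity), hρη1, hρη,
        ← ENNReal.ofReal_rpow_of_nonneg (by positivity) hp₀'.le,
        ← ENNReal.ofReal_rpow_of_nonneg (by positivity) hp₁'.le,
        ENNReal.mul_rpow_of_nonneg _ _ hp₀'.le, ENNReal.mul_rpow_of_nonneg _ _ hp₁'.le,
        ENNReal.div_rpow_of_nonneg _ _ hp₀'.le, ENNReal.div_rpow_of_nonneg _ _ hp₁'.le,
        div_eq_mul_inv, div_eq_mul_inv, mul_assoc, mul_assoc]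
    simp_rw [e]
    rw [ENNReal.tsum_add, ENNReal.tsum_mul_right, ENNReal.tsum_mul_right,
      ← div_eq_mul_inv, ← div_eq_mul_inv]
    exact (add_le_add (ENNReal.div_le_of_le_mul (hα.trans_eq (one_mul _).symm))
      (ENNReal.div_le_of_le_mul (hβ.trans_eq (one_mul _).symm))).trans_eq
        one_add_one_eq_two
  obtain ⟨L, hL, hcL, hmono, hgrow, hsum⟩ := hK c (hcsum.trans_lt (by simp))
  have hsum' : ∑' n : ℤ, ENNReal.ofReal (L n * (ρ ^ n) ^ (-η)) ≤ K * 3 := by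
    refine hsum.trans (mul_le_mul' le_rfl ?_)
    calc _ ≤ (2 : ℝ≥0∞) + 1 := by gcongr
      _ = 3 := by norm_num
  have hS : ∀ n, L n ≤ (K * 3 : ℝ≥0) * (ρ ^ n) ^ η := by
    intro n
    have h1 : ENNReal.ofReal (L n * (ρ ^ n) ^ (-η)) ≤ ((K * 3 : ℝ≥0) : ℝ≥0∞) := by
      refine ((ENNReal.le_tsum n).trans hsum').trans ?_
      push_cast; rfl
    have h2 : L n * (ρ ^ n) ^ (-η) ≤ (K * 3 : ℝ≥0) := by
      rw [← ENNReal.ofReal_coe_nnreal] at h1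
      exact (ENNReal.ofReal_le_ofReal_iff (by positivity)).1 h1
    rwa [Real.rpow_neg (by positivity), ← div_eq_mul_inv, div_le_iff₀ (by positivity)] at h2
  have hq₀ : 0 < p₀⁻¹ := by positivity
  have hq₁ : 0 < p₁⁻¹ := by positivity
  have hU : ∀ n, 0 < L n ^ p₀⁻¹ * (ρ ^ n / L n) ^ p₁⁻¹ := fun n => by
    have := hL n; positivity
  have hT := lintegral_Ioi_mul_inv_le_tsum
    (t := fun n => a / b * (L n ^ p₀⁻¹ * (ρ ^ n / L n) ^ p₁⁻¹)) (R := R)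
    (f := fun t => (ENNReal.ofReal (t ^ (-θ)) * k t) ^ p)
    (b := fun n => ENNReal.ofReal ((1 + R) ^ p * (a ^ (1 - θ) * b ^ θ) ^ p) *
      ENNReal.ofReal (L n * (ρ ^ n) ^ (-η)))
    (fun n => by have := hU n; positivity)
    (fun n => by
      rw [mul_left_comm R]
      exact mul_le_mul_of_nonneg_left (nodes_succ_le hρ hq₀ hq₁ hL hmono hgrow n) (by positivity))
    (by simpa using (tendsto_nodes_atBot hρ hη0 hq₀ hq₁ hL hgrow hS).const_mul (a / b))
    ((tendsto_nodes_atTop hρ hη1 hq₀ hq₁ hL hmono hS).const_mul_atTop (by positivity))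
    (fun n t ht => by
      have hLn := hL n
      have hsn : 0 < ρ ^ n := by positivity
      have hTn : 0 < a / b * (L n ^ p₀⁻¹ * (ρ ^ n / L n) ^ p₁⁻¹) := by
        have := hU n; positivity
      have ht0 : 0 < t := hTn.trans_le ht.1
      have htR : t ≤ R * (a / b * (L n ^ p₀⁻¹ * (ρ ^ n / L n) ^ p₁⁻¹)) := by
        refine ht.2.trans ?_
        rw [mul_left_comm R]
        exact mul_le_mul_of_nonneg_left (nodes_succ_le hρ hq₀ hq₁ hL hmono hgrow n)
          (by positivity)
      have hαn : α n ≤ ENNReal.ofReal (a * L n ^ p₀⁻¹) := by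
        have h1 : (α n / ENNReal.ofReal a) ^ p₀ ≤ ENNReal.ofReal (L n) :=
          le_self_add.trans (hcL n)
        rw [← ENNReal.le_rpow_inv_iff hp₀', ENNReal.ofReal_rpow_of_pos hLn] at h1
        rw [ENNReal.ofReal_mul ha.le, mul_comm]
        exact (ENNReal.div_le_iff ha0 (by simp)).1 h1
      have hβn : β n ≤ ENNReal.ofReal (b * (L n / ρ ^ n) ^ p₁⁻¹) := by
        have h1 : ENNReal.ofReal (ρ ^ n) * (β n / ENNReal.ofReal b) ^ p₁ ≤ ENNReal.ofReal (L n) :=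
          le_add_self.trans (hcL n)
        rw [mul_comm, ← ENNReal.le_div_iff_mul_le (by simp [hsn]) (by simp),
          ← ENNReal.ofReal_div_of_pos hsn, ← ENNReal.le_rpow_inv_iff hp₁',
          ENNReal.ofReal_rpow_of_pos (by positivity)] at h1
        rw [ENNReal.ofReal_mul hb.le, mul_comm]
        exact (ENNReal.div_le_iff hb0 (by simp)).1 h1
      have hkt : k t ≤ ENNReal.ofReal ((1 + R) * (a * L n ^ p₀⁻¹)) := by
        have e1 : (ρ ^ n / L n) ^ p₁⁻¹ * (L n / ρ ^ n) ^ p₁⁻¹ = 1 := by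
          rw [← Real.mul_rpow (by positivity) (by positivity)]
          have : ρ ^ n / L n * (L n / ρ ^ n) = 1 := by field_simp
          rw [this, Real.one_rpow]
        calc k t ≤ α n + ENNReal.ofReal t * β n := hk n t ht0
          _ ≤ ENNReal.ofReal (a * L n ^ p₀⁻¹) + ENNReal.ofReal
              (R * (a / b * (L n ^ p₀⁻¹ * (ρ ^ n / L n) ^ p₁⁻¹))) *
                ENNReal.ofReal (b * (L n / ρ ^ n) ^ p₁⁻¹) := by gcongr
          _ = ENNReal.ofReal ((1 + R) * (a * L n ^ p₀⁻¹)) := by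
              rw [← ENNReal.ofReal_mul (by positivity),
                ← ENNReal.ofReal_add (by positivity) (by positivity)]
              congr 1
              have e2 : R * (a / b * (L n ^ p₀⁻¹ * (ρ ^ n / L n) ^ p₁⁻¹)) *
                  (b * (L n / ρ ^ n) ^ p₁⁻¹) = R * (a * L n ^ p₀⁻¹) *
                    ((ρ ^ n / L n) ^ p₁⁻¹ * (L n / ρ ^ n) ^ p₁⁻¹) := by
                field_simp
              rw [e2, e1]; ring
      have hreal : ((a / b * (L n ^ p₀⁻¹ * (ρ ^ n / L n) ^ p₁⁻¹)) ^ (-θ) *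
          ((1 + R) * (a * L n ^ p₀⁻¹))) ^ p =
          (1 + R) ^ p * (a ^ (1 - θ) * b ^ θ) ^ p * (L n * (ρ ^ n) ^ (-η)) := by
        generalize ρ ^ n = s at hsn
        generalize L n = l at hLn
        have hR1 : 0 < 1 + R := by positivity
        generalize 1 + R = r at hR1
        -- in logarithmic coordinates the identity is linear
        rw [← Real.exp_log ha, ← Real.exp_log hb, ← Real.exp_log hsn, ← Real.exp_log hLn,
          ← Real.exp_log hR1]
        simp only [← Real.exp_mul, ← Real.exp_add, ← Real.exp_sub]
        congr 1
        simp only [div_eq_mul_inv] at hp1 hpη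
        linear_combination Real.log l * hp1 - Real.log s * hpη
      calc _ ≤ (ENNReal.ofReal ((a / b * (L n ^ p₀⁻¹ * (ρ ^ n / L n) ^ p₁⁻¹)) ^ (-θ)) *
            ENNReal.ofReal ((1 + R) * (a * L n ^ p₀⁻¹))) ^ p := by
            have h1 : t ^ (-θ) ≤ (a / b * (L n ^ p₀⁻¹ * (ρ ^ n / L n) ^ p₁⁻¹)) ^ (-θ) :=
              Real.rpow_le_rpow_of_nonpos hTn ht.1 (by linarith)
            gcongr
        _ = _ := by
            rw [← ENNReal.ofReal_mul (by positivity), ENNReal.ofReal_rpow_of_nonneg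
              (by positivity) hp0.le, hreal, ENNReal.ofReal_mul (by positivity)])
  refine hT.trans ?_
  rw [ENNReal.tsum_mul_left, ENNReal.ofReal_mul (p := (1 + R) ^ p) (by positivity)]
  calc _ ≤ ENNReal.ofReal R * (ENNReal.ofReal ((1 + R) ^ p) *
        ENNReal.ofReal ((a ^ (1 - θ) * b ^ θ) ^ p) * (K * 3)) := by gcongr
    _ = _ := by
        simp only [ENNReal.ofReal, ENNReal.coe_mul, ENNReal.coe_ofNat]
        ring

/-- The estimate of the interpolation norm by a discrete decomposition; the case in which one of
the two sequence norms vanishes follows by letting a positive upper bound tend to it. -/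
theorem exists_rpow_lintegral_le {p₀ p₁ δ₀ δ₁ θ p : ℝ} (hp₀ : 1 < p₀) (hp₁ : 1 < p₁)
    (hδ₀ : 0 < δ₀) (hδ₁ : δ₁ < 0) (hθ : θ = δ₀ / (δ₀ - δ₁))
    (hp : 1 / p = (1 - θ) / p₀ + θ / p₁) :
    ∃ K : ℝ≥0, ∀ (k : ℝ → ℝ≥0∞) (α β : ℤ → ℝ≥0∞),
      (∀ j, ∀ t > 0, k t ≤ α j + ENNReal.ofReal t * β j) →
      ∀ A B : ℝ≥0∞, A ≠ ∞ → B ≠ ∞ →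
      ∑' j : ℤ, (ENNReal.ofReal (((2 : ℝ) ^ j) ^ (-δ₀)) * α j) ^ p₀ ≤ A ^ p₀ →
      ∑' j : ℤ, (ENNReal.ofReal (((2 : ℝ) ^ j) ^ (-δ₁)) * β j) ^ p₁ ≤ B ^ p₁ →
      (∫⁻ t in Ioi (0 : ℝ), (ENNReal.ofReal (t ^ (-θ)) * k t) ^ p * ENNReal.ofReal t⁻¹) ^ (1 / p)
        ≤ K * A ^ (1 - θ) * B ^ θ := by
  have hd : 0 < δ₀ - δ₁ := by linarith
  have hθ0 : 0 < θ := by rw [hθ]; positivity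
  have hθ1 : θ < 1 := by rw [hθ, div_lt_one hd]; linarith
  have hp0 : 0 < p := by
    rw [← one_div_pos, hp]
    have : 0 < 1 - θ := by linarith
    positivity
  obtain ⟨K, hK⟩ := exists_lintegral_rpow_le_of_pos hp₀ hp₁ hδ₀ hδ₁ hθ hp
  refine ⟨K ^ (1 / p), fun k α β hk A B hA hB hα hβ => ?_⟩
  have key : ∀ ε : ℝ≥0, 0 < ε →
      (∫⁻ t in Ioi (0 : ℝ), (ENNReal.ofReal (t ^ (-θ)) * k t) ^ p * ENNReal.ofReal t⁻¹) ^ (1 / p)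
        ≤ (K ^ (1 / p) : ℝ≥0) * (A + ε) ^ (1 - θ) * (B + ε) ^ θ := by
    intro ε hε
    lift A to ℝ≥0 using hA
    lift B to ℝ≥0 using hB
    have e : ∀ A : ℝ≥0, ENNReal.ofReal ((A : ℝ) + ε) = A + ε := fun A => by
      rw [ENNReal.ofReal_add (by positivity) (by positivity)]; simp
    have hAε : 0 < (A : ℝ) + ε := by positivity
    have hBε : 0 < (B : ℝ) + ε := by positivity
    have := hK k α β hk (A + ε) (B + ε) hAε hBε
      (hα.trans (by rw [e]; gcongr; exact le_self_add))
      (hβ.trans (by rw [e]; gcongr; exact le_self_add))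
    refine (ENNReal.rpow_le_rpow this (by positivity : 0 ≤ 1 / p)).trans_eq ?_
    rw [ENNReal.mul_rpow_of_nonneg _ _ (by positivity), ← ENNReal.ofReal_rpow_of_nonneg
      (by positivity) hp0.le, ← ENNReal.rpow_mul, mul_one_div_cancel hp0.ne', ENNReal.rpow_one,
      ENNReal.ofReal_mul (by positivity), ← ENNReal.ofReal_rpow_of_pos hAε,
      ← ENNReal.ofReal_rpow_of_pos hBε, e, e, ENNReal.coe_rpow_of_nonneg _ (by positivity),
      mul_assoc]
  have hlim : Tendsto (fun ε : ℝ≥0 => ((K ^ (1 / p) : ℝ≥0) : ℝ≥0∞) * (A + ε) ^ (1 - θ) *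
      (B + ε) ^ θ) (𝓝[>] 0) (𝓝 ((K ^ (1 / p) : ℝ≥0) * A ^ (1 - θ) * B ^ θ)) := by
    have hε : Tendsto (fun ε : ℝ≥0 => (ε : ℝ≥0∞)) (𝓝[>] 0) (𝓝 0) :=
      (ENNReal.continuous_coe.tendsto' 0 0 rfl).mono_left nhdsWithin_le_nhds
    have h1 : Tendsto (fun ε : ℝ≥0 => (A + ε) ^ (1 - θ)) (𝓝[>] 0) (𝓝 (A ^ (1 - θ))) := by
      simpa using (hε.const_add A).ennrpow_const (1 - θ)
    have h2 : Tendsto (fun ε : ℝ≥0 => (B + ε) ^ θ) (𝓝[>] 0) (𝓝 (B ^ θ)) := by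
      simpa using (hε.const_add B).ennrpow_const θ
    have hA' : A ^ (1 - θ) ≠ ∞ := (ENNReal.rpow_lt_top_of_nonneg (by linarith) hA).ne
    have hB' : B ^ θ ≠ ∞ := (ENNReal.rpow_lt_top_of_nonneg hθ0.le hB).ne
    exact ENNReal.Tendsto.mul (ENNReal.Tendsto.const_mul h1 (Or.inr (by simp))) (Or.inr hB') h2
      (Or.inr (ENNReal.mul_ne_top (by simp) hA'))
  exact ge_of_tendsto hlim (eventually_mem_nhdsWithin.mono fun ε hε => key ε hε)

end Interpolation

/-! ### Dyadic averages -/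

section Averages

variable {I : Set ℝ}

/-- The average of `u` over the dyadic interval `(2^{j-1}, 2^j]` with the density `bumpAt j`. -/
def dyadicAverage {X : Type*} [NormedAddCommGroup X] [NormedSpace ℂ X] (I : Set ℝ) (u : ℝ → X)
    (j : ℤ) : X := ∫ x in I, bumpAt j x • u x

/-- Hölder's inequality on a dyadic interval, where the weight is comparable to a constant; `F` need
not be measurable. -/
theorem rpow_setLIntegral_dyadic_le {p γ : ℝ} (hp : 1 < p) (j : ℤ) (F : ℝ → ℝ≥0∞) :
    (∫⁻ x in Ioc ((2 : ℝ) ^ (j - 1)) (2 ^ j), F x) ^ p ≤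
      ENNReal.ofReal (2 ^ |γ| * ((2 : ℝ) ^ j) ^ (p - 1 - γ)) *
        ∫⁻ x in Ioc ((2 : ℝ) ^ (j - 1)) (2 ^ j), F x ^ p * ENNReal.ofReal (|x| ^ γ) := by
  have hp0 : 0 < p := by linarith
  set r : ℝ := 2 ^ j with hr
  have hr0 : 0 < r := by positivity
  have hhalf : (2 : ℝ) ^ (j - 1) = r / 2 := by rw [zpow_sub_one₀ (by norm_num)]; rfl
  rw [hhalf]
  obtain ⟨f, hf, hfF, hfint⟩ := exists_measurable_le_lintegral_eq (volume.restrict (Ioc (r / 2) r)) F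
  have h1 := rpow_lintegral_mul_le (volume.restrict (Ioc (r / 2) r)) hp (κ := fun _ => 1)
    aemeasurable_const hf.aemeasurable
  simp only [one_mul, lintegral_one, Measure.restrict_apply_univ, Real.volume_Ioc] at h1
  have h2 : ∀ x ∈ Ioc (r / 2) r, F x ^ p ≤ ENNReal.ofReal (2 ^ |γ| * r ^ (-γ)) *
      (F x ^ p * ENNReal.ofReal (|x| ^ γ)) := by
    intro x hx
    have hx0 : 0 < x := by linarith [hx.1]
    have h3 : 1 ≤ 2 ^ |γ| * r ^ (-γ) * |x| ^ γ := by
      have h4 : (1 / 2 : ℝ) ^ |γ| ≤ (x / r) ^ γ := by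
        have h5 : 1 / 2 ≤ x / r := by rw [le_div_iff₀ hr0]; linarith [hx.1]
        exact (Real.rpow_le_rpow (by norm_num) h5 (abs_nonneg γ)).trans
          (Real.rpow_le_rpow_of_exponent_ge (by positivity) ((div_le_one hr0).2 hx.2)
            (le_abs_self γ))
      rw [Real.div_rpow hx0.le hr0.le, Real.div_rpow (by norm_num) (by norm_num),
        Real.one_rpow, div_le_iff₀ (by positivity)] at h4
      rw [abs_of_pos hx0, Real.rpow_neg hr0.le, mul_assoc, mul_comm _ (x ^ γ), ← div_eq_mul_inv]
      rwa [mul_comm]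
    rw [mul_left_comm, ← ENNReal.ofReal_mul (by positivity)]
    calc F x ^ p = F x ^ p * 1 := (mul_one _).symm
      _ ≤ _ := by gcongr; exact ENNReal.one_le_ofReal.2 h3
  calc _ ≤ ENNReal.ofReal (r - r / 2) ^ (p - 1) * ∫⁻ x in Ioc (r / 2) r, f x ^ p := by
        rw [hfint]; exact h1
    _ ≤ ENNReal.ofReal (r ^ (p - 1)) * ∫⁻ x in Ioc (r / 2) r,
          ENNReal.ofReal (2 ^ |γ| * r ^ (-γ)) * (F x ^ p * ENNReal.ofReal (|x| ^ γ)) := by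
        gcongr ?_ * ?_
        · rw [← ENNReal.ofReal_rpow_of_pos hr0]
          gcongr
          linarith
        · refine setLIntegral_mono' measurableSet_Ioc fun x hx => le_trans ?_ (h2 x hx)
          gcongr
          exact hfF x
    _ = _ := by
        rw [lintegral_const_mul' _ _ (by simp), ← mul_assoc, ← ENNReal.ofReal_mul (by positivity),
          sub_eq_add_neg (p - 1), Real.rpow_add hr0, mul_left_comm]

theorem tsum_setLIntegral_dyadic_le (hI0 : Ioi 0 ⊆ I) (F : ℝ → ℝ≥0∞) :
    ∑' j : ℤ, ∫⁻ x in Ioc ((2 : ℝ) ^ (j - 1)) (2 ^ j), F x ≤ ∫⁻ x in I, F x := by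
  have hmono : Monotone fun j : ℤ => (2 : ℝ) ^ j := zpow_right_mono₀ (by norm_num)
  have hd : Pairwise (Function.onFun Disjoint fun j : ℤ => Ioc ((2 : ℝ) ^ (j - 1)) (2 ^ j)) :=
    hmono.pairwise_disjoint_on_Ioc_pred
  rw [← lintegral_iUnion (fun j => measurableSet_Ioc) hd]
  refine lintegral_mono_set (iUnion_subset fun j x hx => hI0 ?_)
  exact lt_trans (by positivity) hx.1

theorem setLIntegral_enorm_bumpAt_mul_le {M : ℝ≥0}
    (hM : ∀ (j : ℤ) (x : ℝ), ‖bumpAt j x‖ₑ ≤ M * ENNReal.ofReal (2 ^ (-j))) (j : ℤ)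
    (F : ℝ → ℝ≥0∞) :
    ∫⁻ x in I, ‖bumpAt j x‖ₑ * F x ≤
      M * ENNReal.ofReal (2 ^ (-j)) * ∫⁻ x in Ioc ((2 : ℝ) ^ (j - 1)) (2 ^ j), F x := by
  rw [← lintegral_const_mul' _ _ (ENNReal.mul_ne_top (by simp) (by simp)),
    ← lintegral_indicator measurableSet_Ioc]
  refine (setLIntegral_le_lintegral _ _).trans (lintegral_mono fun x => ?_)
  by_cases hx : x ∈ Ioc ((2 : ℝ) ^ (j - 1)) (2 ^ j)
  · rw [indicator_of_mem hx]
    gcongr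
    exact hM j x
  · simp [bumpAt_eq_zero hx]

/-- The averages of a function in weighted `L^p` lie in a weighted sequence space. -/
theorem exists_tsum_rpow_dyadicAverage_le {p γ : ℝ} (hp : 1 < p) :
    ∃ C : ℝ≥0, ∀ (X : Type*) [NormedAddCommGroup X] [NormedSpace ℂ X] (I : Set ℝ) (u : ℝ → X),
      Ioi 0 ⊆ I →
      ∑' j : ℤ, (ENNReal.ofReal (((2 : ℝ) ^ j) ^ ((1 + γ) / p)) * ‖dyadicAverage I u j‖ₑ) ^ p ≤
        C * ∫⁻ x in I, ‖u x‖ₑ ^ p * ENNReal.ofReal (|x| ^ γ) := by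
  have hp0 : 0 < p := by linarith
  obtain ⟨M, hM⟩ := exists_norm_bumpAt_le
  refine ⟨M ^ p * Real.toNNReal (2 ^ |γ|), fun X _ _ I u hI0 => ?_⟩
  refine le_trans ?_ (mul_le_mul' le_rfl (tsum_setLIntegral_dyadic_le hI0 _))
  rw [← ENNReal.tsum_mul_left]
  refine ENNReal.tsum_le_tsum fun j => ?_
  have h1 : ‖dyadicAverage I u j‖ₑ ≤ M * ENNReal.ofReal (2 ^ (-j)) *
      ∫⁻ x in Ioc ((2 : ℝ) ^ (j - 1)) (2 ^ j), ‖u x‖ₑ := by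
    refine (enorm_integral_le_lintegral_enorm _).trans ?_
    simp_rw [enorm_smul]
    exact setLIntegral_enorm_bumpAt_mul_le hM j _
  have hr : (0 : ℝ) < 2 ^ j := by positivity
  calc _ ≤ (ENNReal.ofReal (((2 : ℝ) ^ j) ^ ((1 + γ) / p)) * (M * ENNReal.ofReal (2 ^ (-j)) *
        ∫⁻ x in Ioc ((2 : ℝ) ^ (j - 1)) (2 ^ j), ‖u x‖ₑ)) ^ p := by gcongr
    _ = (M : ℝ≥0∞) ^ p * ENNReal.ofReal ((((2 : ℝ) ^ j) ^ ((1 + γ) / p) * 2 ^ (-j)) ^ p) *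
        (∫⁻ x in Ioc ((2 : ℝ) ^ (j - 1)) (2 ^ j), ‖u x‖ₑ) ^ p := by
        rw [← ENNReal.ofReal_rpow_of_nonneg (by positivity) hp0.le,
          ENNReal.ofReal_mul (by positivity)]
        simp_rw [ENNReal.mul_rpow_of_nonneg _ _ hp0.le]
        ring
    _ ≤ _ := by
        refine (mul_le_mul' le_rfl (rpow_setLIntegral_dyadic_le (γ := γ) hp j _)).trans_eq ?_
        rw [← mul_assoc]
        congr 1
        rw [mul_assoc, ← ENNReal.ofReal_mul (by positivity), ENNReal.coe_mul,
          ENNReal.coe_rpow_of_nonneg _ hp0.le]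
        congr 1
        change _ = ENNReal.ofReal _
        congr 1
        rw [mul_left_comm, zpow_neg, ← Real.rpow_neg_one, ← Real.rpow_add hr,
          ← Real.rpow_mul hr.le, ← Real.rpow_add hr]
        have : ((1 + γ) / p + -1) * p + (p - 1 - γ) = 0 := by field_simp; ring
        rw [this, Real.rpow_zero, mul_one]

/-- Consecutive averages are compared through first-order differences. -/
theorem enorm_dyadicAverage_sub_le {X : Type*} [NormedAddCommGroup X] [NormedSpace ℂ X]
    [CompleteSpace X] {M : ℝ≥0}
    (hM : ∀ (j : ℤ) (x : ℝ), ‖bumpAt j x‖ₑ ≤ M * ENNReal.ofReal (2 ^ (-j)))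
    (hI : MeasurableSet I) (hI0 : Ioi 0 ⊆ I) {u : ℝ → X} (hu : LocallyIntegrableOn u I) (j : ℤ) :
    ‖dyadicAverage I u j - dyadicAverage I u (j - 1)‖ₑ ≤
      M * ENNReal.ofReal (2 ^ (-j)) * ∫⁻ x in Ioc ((2 : ℝ) ^ (j - 1)) (2 ^ j),
        (M * ENNReal.ofReal (2 ^ (-(j - 1))) *
          ∫⁻ h in {h : ℝ | |h| < 2 ^ j ∧ x + ((1 : ℕ) : ℝ) * h ∈ I}, ‖nthDifference 1 h u x‖ₑ) := by
  have hsub : ∀ j, tsupport (bumpAt j) ⊆ I := fun j => (tsupport_bumpAt_subset_Ioi j).trans hI0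
  have hint : ∀ j, IntegrableOn (fun x => bumpAt j x • u x) I := fun j =>
    integrableOn_smul_of_tsupport_subset hI hu (hasCompactSupport_bumpAt j) (hsub j)
  have hintc : ∀ j (y : X), IntegrableOn (fun x => bumpAt j x • y) I := fun j y =>
    ((bumpAt j).integrable.smul_const y).integrableOn
  have hone : ∀ j (y : X), ∫ x in I, bumpAt j x • y = y := by
    intro j y
    rw [integral_smul_const, setIntegral_eq_integral_of_forall_compl_eq_zero
      (fun x hx => image_eq_zero_of_notMem_tsupport fun h => hx (hsub j h)), integral_bumpAt,
      one_smul]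
  have e1 : dyadicAverage I u j - dyadicAverage I u (j - 1) =
      ∫ x in I, bumpAt j x • (u x - dyadicAverage I u (j - 1)) := by
    simp_rw [smul_sub]
    rw [integral_sub (hint j) (hintc _ _), hone]
    rfl
  have e2 : ∀ x, u x - dyadicAverage I u (j - 1) =
      ∫ y in I, bumpAt (j - 1) y • (u x - u y) := by
    intro x
    simp_rw [smul_sub]
    rw [integral_sub (hintc _ _) (hint _), hone]
    rfl
  rw [e1]
  refine (enorm_integral_le_lintegral_enorm _).trans ?_
  simp_rw [enorm_smul]
  refine (setLIntegral_enorm_bumpAt_mul_le hM j _).trans (mul_le_mul' le_rfl ?_)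
  refine setLIntegral_mono' measurableSet_Ioc fun x hx => ?_
  rw [e2]
  refine (enorm_integral_le_lintegral_enorm _).trans ?_
  simp_rw [enorm_smul]
  refine (setLIntegral_enorm_bumpAt_mul_le hM (j - 1) _).trans (mul_le_mul' le_rfl ?_)
  have hmeas : MeasurableSet {h : ℝ | |h| < 2 ^ j ∧ x + ((1 : ℕ) : ℝ) * h ∈ I} :=
    (measurableSet_lt (by fun_prop : Measurable fun h : ℝ => |h|) measurable_const).inter
      ((by fun_prop : Measurable fun h : ℝ => x + ((1 : ℕ) : ℝ) * h) hI)
  rw [← lintegral_indicator measurableSet_Ioc, ← lintegral_add_left_eq_self _ x,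
    ← lintegral_indicator hmeas]
  refine lintegral_mono fun h => ?_
  by_cases hh : x + h ∈ Ioc ((2 : ℝ) ^ (j - 1 - 1)) (2 ^ (j - 1))
  · have hpos : (0 : ℝ) < 2 ^ (j - 1 - 1) := by positivity
    have h2 : (2 : ℝ) ^ (j - 1) < 2 ^ j := zpow_lt_zpow_right₀ (by norm_num) (by omega)
    have hmem : h ∈ {h : ℝ | |h| < 2 ^ j ∧ x + ((1 : ℕ) : ℝ) * h ∈ I} := by
      refine ⟨abs_lt.2 ⟨?_, ?_⟩, ?_⟩
      · linarith [hx.2, hh.1]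
      · have : (0 : ℝ) < 2 ^ j := by positivity
        linarith [hx.1, hh.2]
      · rw [Nat.cast_one, one_mul]
        exact hI0 (hpos.trans hh.1)
    rw [indicator_of_mem hh, indicator_of_mem hmem, ← enorm_neg]
    simp [nthDifference, Finset.sum_range_succ, sub_eq_add_neg]
  · rw [indicator_of_notMem hh]; exact zero_le

end Averages

/-! ### Averages and the difference seminorm -/

section Differences

/-- The times `t ∈ (2ʲ, 2ʲ⁺¹]` alone already see all differences with step smaller than `2ʲ`. -/
theorem rpow_mul_le_lintegral_diffMean {X : Type*} [NormedAddCommGroup X] {s p : ℝ} (hs : 0 < s)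
    (hp : 0 < p) (I : Set ℝ) (u : ℝ → X) (x : ℝ) (j : ℤ) :
    (ENNReal.ofReal ((2 * (2 : ℝ) ^ j) ^ (-s) * (2 * 2 ^ j)⁻¹) *
        ∫⁻ h in {h : ℝ | |h| < 2 ^ j ∧ x + ((1 : ℕ) : ℝ) * h ∈ I}, ‖nthDifference 1 h u x‖ₑ) ^ p *
        ENNReal.ofReal (1 / 2) ≤
      ∫⁻ t in Ioi (0 : ℝ), (ENNReal.ofReal (t ^ (-s)) * diffMean I 1 t u x) ^ p *
        ENNReal.ofReal t⁻¹ := by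
  set r : ℝ := 2 ^ j with hr
  have hr0 : 0 < r := by positivity
  have hsub : Ioc r (2 * r) ⊆ Ioi 0 := fun t ht => hr0.trans ht.1
  refine le_trans ?_ (lintegral_mono_set hsub)
  rw [show (1 : ℝ) / 2 = (2 * r)⁻¹ * (2 * r - r) by field_simp; ring,
    ENNReal.ofReal_mul (p := (2 * r)⁻¹) (by positivity), ← mul_assoc, ← Real.volume_Ioc,
    ← setLIntegral_const]
  refine setLIntegral_mono' measurableSet_Ioc fun t ht => ?_
  have ht0 : 0 < t := hr0.trans ht.1
  rw [ENNReal.ofReal_mul (by positivity), mul_assoc, diffMean]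
  gcongr ?_ * ?_
  · refine ENNReal.rpow_le_rpow (mul_le_mul' ?_ (mul_le_mul' ?_ ?_)) hp.le
    · exact ENNReal.ofReal_le_ofReal (Real.rpow_le_rpow_of_nonpos ht0 ht.2 (by linarith))
    · exact ENNReal.ofReal_le_ofReal (inv_anti₀ ht0 ht.2)
    · exact lintegral_mono_set fun h hh => ⟨hh.1.trans ht.1, hh.2⟩
  · exact ENNReal.ofReal_le_ofReal (inv_anti₀ ht0 ht.2)

theorem diffSeminorm_rpow {X : Type*} [NormedAddCommGroup X] {s p γ : ℝ} (hp : 0 < p) (I : Set ℝ)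
    (m : ℕ) (u : ℝ → X) : diffSeminorm I m s p p γ u ^ p =
      ∫⁻ x in I, (∫⁻ t in Ioi (0 : ℝ), (ENNReal.ofReal (t ^ (-s)) * diffMean I m t u x) ^ p *
        ENNReal.ofReal t⁻¹) * ENNReal.ofReal (|x| ^ γ) := by
  rw [diffSeminorm]
  simp_rw [← ENNReal.rpow_mul, one_div_mul_cancel hp.ne', ENNReal.rpow_one]

/-- The estimate at a single dyadic scale; all powers of `2 ^ j` cancel. -/
theorem rpow_mul_le_setLIntegral_dyadic {s p γ : ℝ} (hp : 1 < p) (M : ℝ≥0) (j : ℤ) (d : ℝ≥0∞)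
    (H Q : ℝ → ℝ≥0∞)
    (hd : d ≤ M * ENNReal.ofReal ((2 : ℝ) ^ j)⁻¹ * ∫⁻ x in Ioc ((2 : ℝ) ^ (j - 1)) (2 ^ j),
      M * ENNReal.ofReal (2 * ((2 : ℝ) ^ j)⁻¹) * H x)
    (hHQ : ∀ x, (ENNReal.ofReal ((2 * (2 : ℝ) ^ j) ^ (-s) * (2 * 2 ^ j)⁻¹) * H x) ^ p *
      ENNReal.ofReal (1 / 2) ≤ Q x) :
    (ENNReal.ofReal (((2 : ℝ) ^ j) ^ (-(s - (1 + γ) / p))) * d) ^ p ≤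
      (M ^ p * M ^ p * Real.toNNReal (2 ^ |γ| * (2 * (2 ^ (s + 2)) ^ p)) : ℝ≥0) *
        ∫⁻ x in Ioc ((2 : ℝ) ^ (j - 1)) (2 ^ j), Q x * ENNReal.ofReal (|x| ^ γ) := by
  have hp0 : 0 < p := by linarith
  have hholder := rpow_setLIntegral_dyadic_le (γ := γ) hp j
    fun x => M * ENNReal.ofReal (2 * ((2 : ℝ) ^ j)⁻¹) * H x
  set r : ℝ := 2 ^ j with hr
  have hr0 : 0 < r := by positivity
  have hF : ∀ x, (M * ENNReal.ofReal (2 * r⁻¹) * H x) ^ p ≤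
      (M : ℝ≥0∞) ^ p * ENNReal.ofReal (2 * (2 ^ (s + 2)) ^ p * r ^ (s * p)) * Q x := by
    intro x
    refine le_trans (le_of_eq ?_) (mul_le_mul' le_rfl (hHQ x))
    simp_rw [ENNReal.mul_rpow_of_nonneg _ _ hp0.le]
    rw [show (M : ℝ≥0∞) ^ p * ENNReal.ofReal (2 * (2 ^ (s + 2)) ^ p * r ^ (s * p)) *
      (ENNReal.ofReal ((2 * r) ^ (-s) * (2 * r)⁻¹) ^ p * H x ^ p * ENNReal.ofReal (1 / 2)) =
      (M : ℝ≥0∞) ^ p * (ENNReal.ofReal (2 * (2 ^ (s + 2)) ^ p * r ^ (s * p)) *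
      ENNReal.ofReal ((2 * r) ^ (-s) * (2 * r)⁻¹) ^ p * ENNReal.ofReal (1 / 2)) * H x ^ p by ring,
      ENNReal.ofReal_rpow_of_nonneg (by positivity) hp0.le,
      ENNReal.ofReal_rpow_of_nonneg (by positivity) hp0.le, ← ENNReal.ofReal_mul (by positivity),
      ← ENNReal.ofReal_mul (by positivity)]
    congr 3
    have e : 2 * r⁻¹ = 2 ^ (s + 2) * r ^ s * ((2 * r) ^ (-s) * (2 * r)⁻¹) := by
      rw [Real.rpow_neg (by positivity), Real.mul_rpow (by norm_num) hr0.le,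
        Real.rpow_add (by norm_num)]
      norm_num
      field_simp
      norm_num
    rw [e, Real.mul_rpow (by positivity) (by positivity), Real.mul_rpow (by positivity)
      (by positivity), ← Real.rpow_mul hr0.le]
    ring
  have hcancel : (r ^ (-(s - (1 + γ) / p)) * r⁻¹) ^ p * r ^ (p - 1 - γ) * r ^ (s * p) = 1 := by
    rw [← Real.rpow_neg_one r, ← Real.rpow_add hr0, ← Real.rpow_mul hr0.le,
      ← Real.rpow_add hr0, ← Real.rpow_add hr0]
    have : (-(s - (1 + γ) / p) + -1) * p + (p - 1 - γ) + s * p = 0 := by field_simp; ring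
    rw [this, Real.rpow_zero]
  calc _ ≤ (ENNReal.ofReal (r ^ (-(s - (1 + γ) / p))) * (M * ENNReal.ofReal r⁻¹ *
        ∫⁻ x in Ioc ((2 : ℝ) ^ (j - 1)) r, M * ENNReal.ofReal (2 * r⁻¹) * H x)) ^ p := by gcongr
    _ = (M : ℝ≥0∞) ^ p * ENNReal.ofReal ((r ^ (-(s - (1 + γ) / p)) * r⁻¹) ^ p) *
        (∫⁻ x in Ioc ((2 : ℝ) ^ (j - 1)) r, M * ENNReal.ofReal (2 * r⁻¹) * H x) ^ p := by
        generalize (∫⁻ x in Ioc ((2 : ℝ) ^ (j - 1)) r, M * ENNReal.ofReal (2 * r⁻¹) * H x) = Z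
        rw [← ENNReal.ofReal_rpow_of_nonneg (by positivity) hp0.le,
          ENNReal.ofReal_mul (p := r ^ (-(s - (1 + γ) / p))) (by positivity)]
        simp_rw [ENNReal.mul_rpow_of_nonneg _ _ hp0.le]
        ring
    _ ≤ (M : ℝ≥0∞) ^ p * ENNReal.ofReal ((r ^ (-(s - (1 + γ) / p)) * r⁻¹) ^ p) *
        (ENNReal.ofReal (2 ^ |γ| * r ^ (p - 1 - γ)) * ∫⁻ x in Ioc ((2 : ℝ) ^ (j - 1)) r,
          (M * ENNReal.ofReal (2 * r⁻¹) * H x) ^ p * ENNReal.ofReal (|x| ^ γ)) :=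
        mul_le_mul' le_rfl hholder
    _ ≤ (M : ℝ≥0∞) ^ p * ENNReal.ofReal ((r ^ (-(s - (1 + γ) / p)) * r⁻¹) ^ p) *
        (ENNReal.ofReal (2 ^ |γ| * r ^ (p - 1 - γ)) * ∫⁻ x in Ioc ((2 : ℝ) ^ (j - 1)) r,
          ((M : ℝ≥0∞) ^ p * ENNReal.ofReal (2 * (2 ^ (s + 2)) ^ p * r ^ (s * p))) *
            (Q x * ENNReal.ofReal (|x| ^ γ))) := by
        refine mul_le_mul' le_rfl (mul_le_mul' le_rfl (lintegral_mono fun x => ?_))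
        rw [← mul_assoc]
        exact mul_le_mul' (hF x) le_rfl
    _ = _ := by
        rw [lintegral_const_mul' _ _ (ENNReal.mul_ne_top
          (ENNReal.rpow_lt_top_of_nonneg hp0.le (by simp)).ne (by simp)), ← mul_assoc, ← mul_assoc]
        congr 1
        rw [show (M : ℝ≥0∞) ^ p * ENNReal.ofReal ((r ^ (-(s - (1 + γ) / p)) * r⁻¹) ^ p) *
          ENNReal.ofReal (2 ^ |γ| * r ^ (p - 1 - γ)) *
          ((M : ℝ≥0∞) ^ p * ENNReal.ofReal (2 * (2 ^ (s + 2)) ^ p * r ^ (s * p))) =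
          (M : ℝ≥0∞) ^ p * (M : ℝ≥0∞) ^ p * (ENNReal.ofReal
            ((r ^ (-(s - (1 + γ) / p)) * r⁻¹) ^ p) * ENNReal.ofReal (2 ^ |γ| * r ^ (p - 1 - γ)) *
            ENNReal.ofReal (2 * (2 ^ (s + 2)) ^ p * r ^ (s * p))) by ring,
          ← ENNReal.ofReal_mul (by positivity), ← ENNReal.ofReal_mul (by positivity),
          ENNReal.coe_mul, ENNReal.coe_mul, ENNReal.coe_rpow_of_nonneg _ hp0.le]
        congr 1
        change _ = ENNReal.ofReal _
        congr 1
        linear_combination (2 ^ |γ| * (2 * (2 ^ (s + 2)) ^ p)) * hcancel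

/-- Differences of consecutive averages are controlled by the difference seminorm. -/
theorem exists_tsum_rpow_dyadicAverage_sub_le {s p γ : ℝ} (hs : 0 < s) (hp : 1 < p) :
    ∃ C : ℝ≥0, ∀ (X : Type*) [NormedAddCommGroup X] [NormedSpace ℂ X] [CompleteSpace X]
      (I : Set ℝ) (u : ℝ → X), MeasurableSet I → Ioi 0 ⊆ I → LocallyIntegrableOn u I →
      ∑' j : ℤ, (ENNReal.ofReal (((2 : ℝ) ^ j) ^ (-(s - (1 + γ) / p))) *
        ‖dyadicAverage I u j - dyadicAverage I u (j - 1)‖ₑ) ^ p ≤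
        C * diffSeminorm I 1 s p p γ u ^ p := by
  have hp0 : 0 < p := by linarith
  obtain ⟨M, hM⟩ := exists_norm_bumpAt_le
  refine ⟨M ^ p * M ^ p * Real.toNNReal (2 ^ |γ| * (2 * (2 ^ (s + 2)) ^ p)),
    fun X _ _ _ I u hI hI0 hu => ?_⟩
  rw [diffSeminorm_rpow hp0]
  refine le_trans ?_ (mul_le_mul' le_rfl (tsum_setLIntegral_dyadic_le hI0 _))
  rw [← ENNReal.tsum_mul_left]
  refine ENNReal.tsum_le_tsum fun j => ?_
  have h1 := enorm_dyadicAverage_sub_le hM hI hI0 hu j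
  have hj : (2 : ℝ) ^ (-(j - 1)) = 2 * (2 ^ j)⁻¹ := by
    rw [neg_sub, sub_eq_add_neg, zpow_add₀ (by norm_num), zpow_one, zpow_neg]
  rw [hj, zpow_neg] at h1
  exact rpow_mul_le_setLIntegral_dyadic hp M j _ _ _ h1 fun x =>
    rpow_mul_le_lintegral_diffMean hs hp0 I u x j

/-- A discrete Hardy inequality: a sequence with a limit at `-∞` is controlled by its increments
in weighted sequence spaces. -/
theorem exists_tsum_rpow_enorm_sub_le {δ p : ℝ} (hδ : 0 < δ) (hp : 1 < p) :
    ∃ C : ℝ≥0, ∀ (X : Type*) [NormedAddCommGroup X] (A : ℤ → X) (x : X),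
      Tendsto A atBot (𝓝 x) →
      ∑' j : ℤ, (ENNReal.ofReal (((2 : ℝ) ^ j) ^ (-δ)) * ‖x - A j‖ₑ) ^ p ≤
        C * ∑' j : ℤ, (ENNReal.ofReal (((2 : ℝ) ^ j) ^ (-δ)) * ‖A j - A (j - 1)‖ₑ) ^ p := by
  have hp0 : 0 < p := by linarith
  set κ : ℕ → ℝ≥0∞ := fun l => ENNReal.ofReal ((2 : ℝ) ^ (-(δ * l))) with hκ
  set S := ∑' l, κ l with hS
  have hS0 : S ≠ ∞ := (tsum_ofReal_two_rpow_neg_lt_top hδ).ne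
  have hfin : S ^ (p - 1) * S ≠ ∞ :=
    ENNReal.mul_ne_top (ENNReal.rpow_lt_top_of_nonneg (by linarith) hS0).ne hS0
  refine ⟨(S ^ (p - 1) * S).toNNReal, fun X _ A x hA => ?_⟩
  rw [ENNReal.coe_toNNReal hfin]
  set e : ℤ → ℝ≥0∞ := fun j => ENNReal.ofReal (((2 : ℝ) ^ j) ^ (-δ)) * ‖A j - A (j - 1)‖ₑ with he
  have hpt : ∀ j, ENNReal.ofReal (((2 : ℝ) ^ j) ^ (-δ)) * ‖x - A j‖ₑ ≤
      ∑' l : ℕ, κ l * e (j - l) := by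
    intro j
    have hlim : Tendsto (fun l : ℕ => A (j - l)) atTop (𝓝 x) :=
      hA.comp (tendsto_atBot_add_const_left _ j
        (tendsto_neg_atTop_atBot.comp tendsto_natCast_atTop_atTop))
    have h1 := edist_le_tsum_of_edist_le_of_tendsto₀
      (fun l : ℕ => ‖A (j - l) - A (j - l - 1)‖ₑ) (f := fun l : ℕ => A (j - l)) (fun l => by
        rw [edist_eq_enorm_sub]; push_cast; rw [sub_sub]) hlim
    rw [edist_comm, edist_eq_enorm_sub] at h1
    simp only [Nat.cast_zero, sub_zero] at h1
    refine (mul_le_mul' le_rfl h1).trans_eq ?_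
    rw [← ENNReal.tsum_mul_left]
    refine tsum_congr fun l => ?_
    simp only [hκ, he]
    rw [← mul_assoc, ← ENNReal.ofReal_mul (by positivity)]
    congr 2
    rw [← Real.rpow_intCast, ← Real.rpow_intCast, ← Real.rpow_mul (by norm_num),
      ← Real.rpow_mul (by norm_num), ← Real.rpow_add (by norm_num)]
    congr 1
    push_cast; ring
  have hj : ∀ j, (ENNReal.ofReal (((2 : ℝ) ^ j) ^ (-δ)) * ‖x - A j‖ₑ) ^ p ≤
      S ^ (p - 1) * ∑' l : ℕ, κ l * e (j - l) ^ p := by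
    intro j
    refine (ENNReal.rpow_le_rpow (hpt j) hp0.le).trans ?_
    have := rpow_lintegral_mul_le Measure.count hp (κ := κ) (f := fun l : ℕ => e (j - l))
      (measurable_of_countable _).aemeasurable (measurable_of_countable _).aemeasurable
    simpa only [lintegral_count] using this
  calc _ ≤ ∑' j : ℤ, S ^ (p - 1) * ∑' l : ℕ, κ l * e (j - l) ^ p := ENNReal.tsum_le_tsum hj
    _ = S ^ (p - 1) * ∑' l : ℕ, κ l * ∑' j : ℤ, e (j - l) ^ p := by
        rw [ENNReal.tsum_mul_left, ENNReal.tsum_comm]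
        simp_rw [ENNReal.tsum_mul_left]
    _ = S ^ (p - 1) * ∑' l : ℕ, κ l * ∑' j : ℤ, e j ^ p := by
        congr 1
        refine tsum_congr fun l => ?_
        rw [← (Equiv.subRight (l : ℤ)).tsum_eq (fun j => e j ^ p)]
        rfl
    _ = _ := by rw [ENNReal.tsum_mul_right, ← hS, mul_assoc]

end Differences

/-! ### The interpolation estimate for the trace -/

section Main

theorem integrableOn_bumpAt_smul_of_memWeightedLp {X : Type*} [NormedAddCommGroup X]
    [NormedSpace ℂ X] {I : Set ℝ} (hI0 : Ioi 0 ⊆ I) {p γ : ℝ} (hp : 1 < p)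
    {u : ℝ → X} (hu : MemWeightedLp I p γ u) (j : ℤ) :
    IntegrableOn (fun x => bumpAt j x • u x) I := by
  have hp0 : 0 < p := by linarith
  refine ⟨(bumpAt j).continuous.aestronglyMeasurable.smul hu.1, ?_⟩
  obtain ⟨M, hM⟩ := exists_norm_bumpAt_le
  have h1 : ∫⁻ x in Ioc ((2 : ℝ) ^ (j - 1)) (2 ^ j), ‖u x‖ₑ < ∞ := by
    rw [← ENNReal.rpow_lt_top_iff_of_pos hp0]
    refine (rpow_setLIntegral_dyadic_le (γ := γ) hp j _).trans_lt
      (ENNReal.mul_lt_top (by simp) ?_)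
    refine (lintegral_mono_set (t := I) fun x hx => hI0 (lt_trans (by positivity) hx.1)).trans_lt ?_
    rw [← weightedLpNorm_rpow hp0]
    exact ENNReal.rpow_lt_top_of_nonneg hp0.le hu.2.ne
  rw [HasFiniteIntegral]
  simp_rw [enorm_smul]
  exact (setLIntegral_enorm_bumpAt_mul_le hM j _).trans_lt
    (ENNReal.mul_lt_top (ENNReal.mul_lt_top (by simp) (by simp)) h1)

/-- Integrals of two functions that agree in the ambient space agree in the ambient space. -/
theorem map_integral_eq_map_integral {X₀ X₁ V : Type*}
    [NormedAddCommGroup X₀] [NormedSpace ℂ X₀] [CompleteSpace X₀]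
    [NormedAddCommGroup X₁] [NormedSpace ℂ X₁] [CompleteSpace X₁]
    [AddCommGroup V] [Module ℂ V] [TopologicalSpace V] [T2Space V]
    (ι₀ : X₀ →L[ℂ] V) (ι₁ : X₁ →L[ℂ] V) {α : Type*} [MeasurableSpace α] {μ : Measure α}
    {f₀ : α → X₀} {f₁ : α → X₁} (h₀ : Integrable f₀ μ) (h₁ : Integrable f₁ μ)
    (h : ∀ᵐ t ∂μ, ι₀ (f₀ t) = ι₁ (f₁ t)) : ι₀ (∫ t, f₀ t ∂μ) = ι₁ (∫ t, f₁ t ∂μ) := by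
  set S : Submodule ℂ (X₀ × X₁) := LinearMap.eqLocus
    (ι₀.comp (ContinuousLinearMap.fst ℂ X₀ X₁)).toLinearMap
    (ι₁.comp (ContinuousLinearMap.snd ℂ X₀ X₁)).toLinearMap with hSdef
  have hS : IsClosed (S : Set (X₀ × X₁)) :=
    isClosed_eq (ι₀.continuous.comp continuous_fst) (ι₁.continuous.comp continuous_snd)
  have hmem := integral_mem_of_isClosed S hS (h₀.prodMk h₁) (h.mono fun t ht => ht)
  rw [integral_pair h₀ h₁] at hmem
  exact hmem

end Main

end WeightedTrace

end

theorem lemmal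
    (s₀ p₀ p₁ γ₀ γ₁ δ₀ δ₁ θ p : ℝ)
    (hs₀ : s₀ ∈ Ioo (0 : ℝ) 1) (hp₀ : 1 < p₀) (hp₁ : 1 < p₁)
    (hγ₀ : γ₀ ∈ Ioo (-1 : ℝ) (p₀ - 1)) (hγ₁ : γ₁ ∈ Ioo (-1 : ℝ) (p₁ - 1))
    (hδ₀ : δ₀ = s₀ - (1 + γ₀) / p₀) (hδ₁ : δ₁ = -((1 + γ₁) / p₁))
    (hθ : θ = δ₀ / (δ₀ - δ₁)) (hp : 1 / p = (1 - θ) / p₀ + θ / p₁)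
    (hδ₀_pos : 0 < δ₀) :
    ∃ C : ℝ≥0,
      ∀ (X₀ X₁ V : Type*)
        [NormedAddCommGroup X₀] [NormedSpace ℂ X₀] [CompleteSpace X₀]
        [NormedAddCommGroup X₁] [NormedSpace ℂ X₁] [CompleteSpace X₁]
        [AddCommGroup V] [Module ℂ V] [TopologicalSpace V] [IsTopologicalAddGroup V]
        [ContinuousSMul ℂ V] [T2Space V]
        (ι₀ : X₀ →L[ℂ] V) (ι₁ : X₁ →L[ℂ] V),
        Function.Injective ι₀ → Function.Injective ι₁ →
      ∀ φ : ℕ → 𝓢(ℝ, ℂ), IsLittlewoodPaley φ →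
      ∀ I : Set ℝ, (I = Ioi 0 ∨ I = univ) →
      -- `u₀` and `u₁` are the same function `u`, regarded as `X₀`- and as `X₁`-valued
      ∀ (u₀ : ℝ → X₀) (u₁ : ℝ → X₁),
        MemF φ I s₀ p₀ p₀ γ₀ u₀ → MemWeightedLp I p₁ γ₁ u₁ →
        (∀ᵐ t ∂(volume.restrict I), ι₀ (u₀ t) = ι₁ (u₁ t)) →
        ∃ x : X₀,
          (∀ y : X₀, IsTraceZero φ I s₀ p₀ p₀ γ₀ u₀ y ↔ y = x) ∧
          interpNorm ι₀ ι₁ θ p (ι₀ x) < ∞ ∧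
          interpNorm ι₀ ι₁ θ p (ι₀ x) ≤
            (C : ℝ≥0∞) * diffSeminorm I 1 s₀ p₀ p₀ γ₀ u₀ ^ (1 - θ)
              * weightedLpNorm I p₁ γ₁ u₁ ^ θ := by
  have hp₀' : 0 < p₀ := by linarith
  have hp₁' : 0 < p₁ := by linarith
  have hδ₁_neg : δ₁ < 0 := by
    have h1 : 0 < 1 + γ₁ := by linarith [hγ₁.1]
    rw [hδ₁]
    exact neg_neg_of_pos (by positivity)
  have hd : 0 < δ₀ - δ₁ := by linarith
  have hθ0 : 0 < θ := by rw [hθ]; positivity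
  have hθ1 : 0 < 1 - θ := by
    have : θ < 1 := by rw [hθ, div_lt_one hd]; linarith
    linarith
  obtain ⟨K, hK⟩ := exists_rpow_lintegral_le hp₀ hp₁ hδ₀_pos hδ₁_neg hθ hp
  obtain ⟨C₁, hC₁⟩ := exists_tsum_rpow_enorm_sub_le hδ₀_pos hp₀
  obtain ⟨C₂, hC₂⟩ := exists_tsum_rpow_dyadicAverage_sub_le (γ := γ₀) hs₀.1 hp₀
  obtain ⟨C₃, hC₃⟩ := exists_tsum_rpow_dyadicAverage_le (γ := γ₁) hp₁
  refine ⟨K * ((C₁ * C₂) ^ (1 / p₀)) ^ (1 - θ) * (C₃ ^ (1 / p₁)) ^ θ, ?_⟩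
  intro X₀ X₁ V _ _ _ _ _ _ _ _ _ _ _ _ ι₀ ι₁ _ _ φ hφ I hI u₀ u₁ hu₀ hu₁ hu
  -- only `(0, ∞) ⊆ I` matters: all bumps are supported there
  have hIm : MeasurableSet I := by rcases hI with rfl | rfl <;> measurability
  have hI0 : Ioi 0 ⊆ I := by rcases hI with rfl | rfl <;> simp
  obtain ⟨g, hg'⟩ := iInf_lt_iff.1 hu₀.2
  obtain ⟨hgu, hg⟩ := iInf_lt_iff.1 hg'
  have hδ : 0 < s₀ - (1 + γ₀) / p₀ := hδ₀ ▸ hδ₀_pos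
  refine ⟨traceOf φ g, fun y => isTraceZero_iff hφ hp₀ hs₀.2 hγ₀ hδ hIm hI0 hu₀.1 hgu hg y, ?_⟩
  set x := traceOf φ g
  have hsub : ∀ j, tsupport (bumpAt j) ⊆ I := fun j => (tsupport_bumpAt_subset_Ioi j).trans hI0
  have hgA : ∀ j, g (bumpAt j) = dyadicAverage I u₀ j := fun j =>
    hgu _ (hasCompactSupport_bumpAt j) (hsub j)
  have hint₀ : ∀ j, IntegrableOn (fun x => bumpAt j x • u₀ x) I := fun j =>
    integrableOn_smul_of_tsupport_subset hIm hu₀.1 (hasCompactSupport_bumpAt j) (hsub j)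
  have hcompat : ∀ j, ι₀ (dyadicAverage I u₀ j) = ι₁ (dyadicAverage I u₁ j) := fun j =>
    map_integral_eq_map_integral ι₀ ι₁ (hint₀ j)
      (integrableOn_bumpAt_smul_of_memWeightedLp hI0 hp₁ hu₁ j)
      (hu.mono fun t ht => by rw [map_smul, map_smul, ht])
  have hAfin := tsum_rpow_apply_bumpAt_sub_lt_top hφ hp₀ hs₀.2 hγ₀ hδ hg
  have hlim : Tendsto (dyadicAverage I u₀) atBot (𝓝 x) := by
    rw [tendsto_iff_edist_tendsto_0]
    simp_rw [edist_eq_enorm_sub, ← hgA]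
    exact tendsto_atBot_of_tsum_rpow_lt_top hδ hp₀' hAfin
  rw [← hδ₀] at hAfin
  simp_rw [hgA, fun j => enorm_sub_rev (dyadicAverage I u₀ j) (traceOf φ g)] at hAfin
  set A := ∑' j : ℤ, (ENNReal.ofReal (((2 : ℝ) ^ j) ^ (-δ₀)) *
    ‖x - dyadicAverage I u₀ j‖ₑ) ^ p₀ with hA
  set B := ∑' j : ℤ, (ENNReal.ofReal (((2 : ℝ) ^ j) ^ (-δ₁)) *
    ‖dyadicAverage I u₁ j‖ₑ) ^ p₁ with hB
  have hAle : A ≤ (C₁ * C₂ : ℝ≥0) * diffSeminorm I 1 s₀ p₀ p₀ γ₀ u₀ ^ p₀ := by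
    refine (hC₁ X₀ _ x hlim).trans ?_
    rw [ENNReal.coe_mul, mul_assoc, hδ₀]
    exact mul_le_mul' le_rfl (hC₂ X₀ I u₀ hIm hI0 hu₀.1)
  have hBle : B ≤ C₃ * weightedLpNorm I p₁ γ₁ u₁ ^ p₁ := by
    rw [weightedLpNorm_rpow hp₁', hB, hδ₁, neg_neg]
    exact hC₃ X₁ I u₁ hI0
  have hBfin : B < ∞ := hBle.trans_lt (ENNReal.mul_lt_top (by simp)
    (ENNReal.rpow_lt_top_of_nonneg hp₁'.le hu₁.2.ne))
  have hroot : ∀ {q : ℝ} (hq : 0 < q) (a : ℝ≥0∞), (a ^ (1 / q)) ^ q = a := fun hq a => by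
    rw [← ENNReal.rpow_mul, one_div_mul_cancel hq.ne', ENNReal.rpow_one]
  have hroot' : ∀ {q : ℝ} (hq : 0 < q) (c : ℝ≥0) (a : ℝ≥0∞),
      ((c : ℝ≥0∞) * a ^ q) ^ (1 / q) = (c ^ (1 / q) : ℝ≥0) * a := fun hq c a => by
    rw [ENNReal.mul_rpow_of_nonneg _ _ (by positivity), ← ENNReal.rpow_mul,
      mul_one_div_cancel hq.ne', ENNReal.rpow_one, ENNReal.coe_rpow_of_nonneg _ (by positivity)]
  have hAfin' : A ^ (1 / p₀) ≠ ∞ := (ENNReal.rpow_lt_top_of_nonneg (by positivity) hAfin.ne).ne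
  have hBfin' : B ^ (1 / p₁) ≠ ∞ := (ENNReal.rpow_lt_top_of_nonneg (by positivity) hBfin.ne).ne
  have hmain : interpNorm ι₀ ι₁ θ p (ι₀ x) ≤ K * (A ^ (1 / p₀)) ^ (1 - θ) * (B ^ (1 / p₁)) ^ θ := by
    refine hK (fun t => kFunctional ι₀ ι₁ t (ι₀ x)) (fun j => ‖x - dyadicAverage I u₀ j‖ₑ)
      (fun j => ‖dyadicAverage I u₁ j‖ₑ) (fun j t _ => ?_) _ _ hAfin' hBfin'
      (by rw [hroot hp₀']) (by rw [hroot hp₁'])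
    -- decompose `x = (x - A_j u) + A_j u` with the average `A_j u ∈ X₀ ∩ X₁`
    exact iInf_le_of_le (x - dyadicAverage I u₀ j) (iInf_le_of_le (dyadicAverage I u₁ j)
      (iInf_le_of_le (by rw [map_sub, ← hcompat, sub_add_cancel]) le_rfl))
  refine ⟨hmain.trans_lt (ENNReal.mul_lt_top (ENNReal.mul_lt_top (by simp)
    (ENNReal.rpow_lt_top_of_nonneg hθ1.le hAfin'))
    (ENNReal.rpow_lt_top_of_nonneg hθ0.le hBfin')), hmain.trans ?_⟩
  calc _ ≤ (K : ℝ≥0∞) *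
        (((C₁ * C₂ : ℝ≥0) * diffSeminorm I 1 s₀ p₀ p₀ γ₀ u₀ ^ p₀) ^ (1 / p₀)) ^ (1 - θ) *
        ((C₃ * weightedLpNorm I p₁ γ₁ u₁ ^ p₁) ^ (1 / p₁)) ^ θ := by gcongr
    _ = _ := by
        rw [hroot' hp₀', hroot' hp₁', ENNReal.mul_rpow_of_nonneg _ _ hθ1.le,
          ENNReal.mul_rpow_of_nonneg _ _ hθ0.le, ENNReal.coe_mul, ENNReal.coe_mul,
          ENNReal.coe_rpow_of_nonneg _ hθ1.le, ENNReal.coe_rpow_of_nonneg _ hθ0.le]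
        ring
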